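/- Let $\mathfrak B$ be a complex unital Banach algebra, $d\in\mathbb N$, and let $C_b=C_b(\mathbb R^d,\mathfrak B)$ be the algebra of bounded continuous functions $x:\mathbb R^d\to\mathfrak B$ with the norm $\|x\|=\sup_s\|x(s)\|$. For $f\in L_1(\mathbb R^d)$ put $\hat f(\lambda)=\int f(t)e^{-it\cdot\lambda}\,dt$ and $(f*x)(s)=\int f(t)x(s-t)\,dt$. For $a\in\mathbb R^d$ let $\phi_a\in L_1(\mathbb R^d)$ be the function with $\hat\phi_a(\lambda)=\prod_{k=1}^d\max(1-|\lambda_k-a_k|,0)$. For $x\in C_b$ let $\Lambda(x)$ be its Beurling spectrum: $\gamma\notin\Lambda(x)$ if and only if there is $f\in L_1(\mathbb R^d)$ with $\hat f(\gamma)\neq0$ and $f*x=0$. For $h:\mathbb R^d\to\mathbb C$ of the form $h=\mathbf e_\alpha$ or $h=\mathbf h_\alpha$, where $\mathbf e_\alpha(\lambda)=e^{\sum_k\alpha_k\lambda_k}$ and $\mathbf h_\alpha(\lambda)=e^{\sum_k\alpha_k|\lambda_k|}$, define $h\diamond x$ first for $x\in C_b$ with $\Lambda(x)$ compact by $h\diamond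 x=\psi*x$, where $\psi\in L_1(\mathbb R^d)$ satisfies $\hat\psi=h\hat\varphi$ for some $\varphi\in L_1(\mathbb R^d)$ such that $\hat\varphi$ has compact support and $\hat\varphi=1$ in a neighbourhood of $\Lambda(x)$ (the result does not depend on $\varphi$). Let $D(h)$ be the domain of the closure of this operator in $C_b$, that is, the set of all $x\in C_b$ for which there are $x_n\to x$ in $C_b$ such that all $\Lambda(x_n)$ are compact and $h\diamond x_n$ converges in $C_b$. Consider the following classes. * Wiener class: $\mathcal W=\{x\in C_b:\int_{\mathbb R^d}\|\phi_a*x\|\,da<\infty\}$. * Exponential spectral decay: $\mathcal W_{exp}=\bigcup_{\alpha}D(\mathbf h_\alpha)$, the union over all $\alpha\in\mathbb R^d$ with all $\alpha_k>0$. * One-sided exponential spectral decay: $\mathcal W_{exp}^{\pm}=\bigcup_{\alpha}D(\mathbf e_\alpha)$, the union over all $\alpha\in\mathbb R^d$ with all $\pm\alpha_k>0$. * Beurling class: $\mathcal B=\{x\in C_b:\sum_{k\in\mathbb Z^d}\sup_{n\in\mathbb Z^d,\,|n|_\infty\ge|k|_\infty}\|\phi_n*x\|<\infty\}$. * Sobolev-type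 classes, for every integer $m\ge0$: $\mathcal W^{(m)}$, respectively $\mathcal B^{(m)}$, is the set of all $x\in C_b$ that have continuous bounded partial derivatives up to order $m$ such that $x^{(\alpha)}\in\mathcal W$, respectively $x^{(\alpha)}\in\mathcal B$, for all multi-indices $\alpha$ with $|\alpha|\le m$. **Theorem.** Let $\mathcal F$ be any of the classes $\mathcal W$, $\mathcal W_{exp}$, $\mathcal W_{exp}^{+}$, $\mathcal W_{exp}^{-}$, $\mathcal B$, $\mathcal W^{(m)}$, $\mathcal B^{(m)}$. Let $x\in\mathcal F$ be such that $x(s)$ is invertible in $\mathfrak B$ for every $s\in\mathbb R^d$ and the function $y(s)=x(s)^{-1}$ is bounded. Then $y\in\mathcal F$. -/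

import Mathlib

open scoped BoundedContinuousFunction

noncomputable section

namespace SpectralDecay

/-- `f̂(l) = ∫ f(t) e^{-i t·l} dt`. -/
def fourierT {d : ℕ} (f : (Fin d → ℝ) → ℂ) (l : Fin d → ℝ) : ℂ :=
  ∫ t, f t * Complex.exp (-(Complex.I * ((∑ k, t k * l k : ℝ) : ℂ)))

/-- The triangle function `(1 - |l|) χ_{[-1,1]}(l)`. -/
def triangle (l : ℝ) : ℝ := max (1 - |l|) 0

/-- The integrable function on the line whose Fourier transform is the triangle function. -/
def phi (t : ℝ) : ℂ :=
  ((2 * Real.pi : ℝ) : ℂ)⁻¹ *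
    ∫ l : ℝ, (triangle l : ℂ) * Complex.exp (Complex.I * ((l * t : ℝ) : ℂ))

/-- `φ_a` on `ℝ^d`: the function with Fourier transform `l ↦ ∏ₖ triangle (lₖ - aₖ)`. -/
def phiD {d : ℕ} (a s : Fin d → ℝ) : ℂ :=
  (∏ k, phi (s k)) * Complex.exp (Complex.I * ((∑ k, a k * s k : ℝ) : ℂ))

section Classes

variable {d : ℕ} {B : Type*} [NormedRing B] [NormedAlgebra ℂ B]

/-- The module structure given by translations: `(f * x)(s) = ∫ f(t) x(s - t) dt`. -/
def conv (f : (Fin d → ℝ) → ℂ) (x : (Fin d → ℝ) → B) : (Fin d → ℝ) → B :=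
  MeasureTheory.convolution f x (ContinuousLinearMap.lsmul ℂ ℂ) MeasureTheory.volume

/-- `‖φ_a * x‖ = sup_s ‖(φ_a * x)(s)‖`, as an extended nonnegative number. -/
def coeffNorm (a : Fin d → ℝ) (x : (Fin d → ℝ) → B) : ENNReal :=
  ⨆ s, ‖conv (phiD a) x s‖ₑ

/-- `∫ ‖φ_a * x‖ da`. -/
def wienerNorm (x : (Fin d → ℝ) → B) : ENNReal :=
  ∫⁻ a : Fin d → ℝ, coeffNorm a x

/-- `∑_{k ∈ ℤ^d} sup_{|n|_∞ ≥ |k|_∞} ‖φ_n * x‖`; the norm on `Fin d → ℤ` is `|·|_∞`. -/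
def beurlingNorm (x : (Fin d → ℝ) → B) : ENNReal :=
  ∑' k : Fin d → ℤ, ⨆ n : Fin d → ℤ, ⨆ _ : ‖k‖ ≤ ‖n‖, coeffNorm (fun j => (n j : ℝ)) x

/-- The Wiener class. -/
def wienerClass : Set ((Fin d → ℝ) →ᵇ B) := {x | wienerNorm x < ⊤}

/-- The Beurling class. -/
def beurlingClass : Set ((Fin d → ℝ) →ᵇ B) := {x | beurlingNorm x < ⊤}

/-- The Beurling spectrum of `x`: its complement consists of the `γ` for which there is
an integrable `f` with `f̂(γ) ≠ 0` and `f * x = 0`. -/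
def beurlingSpectrum (x : (Fin d → ℝ) →ᵇ B) : Set (Fin d → ℝ) :=
  {γ | ¬ ∃ f : (Fin d → ℝ) → ℂ, MeasureTheory.Integrable f ∧ fourierT f γ ≠ 0 ∧
    ∀ s, conv f x s = 0}

/-- `y = h ⋄ x` for `x` with compact Beurling spectrum: `y = (h φ̂)^∨ * x`, where `φ` is
integrable, `φ̂` has compact support and equals `1` in a neighbourhood of the spectrum of `x`.
Here `ψ` is the integrable function `(h φ̂)^∨`. -/
def IsDiamondComp (h : (Fin d → ℝ) → ℂ) (x y : (Fin d → ℝ) →ᵇ B) : Prop :=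
  IsCompact (beurlingSpectrum x) ∧
    ∃ φ ψ : (Fin d → ℝ) → ℂ, MeasureTheory.Integrable φ ∧ MeasureTheory.Integrable ψ ∧
      HasCompactSupport (fourierT φ) ∧
      (∀ᶠ l in nhdsSet (beurlingSpectrum x), fourierT φ l = 1) ∧
      (∀ l, fourierT ψ l = h l * fourierT φ l) ∧
      ∀ s, y s = conv ψ x s

/-- The domain `D(h)` of the closure of the operator `x ↦ h ⋄ x`. -/
def diamondDomain (h : (Fin d → ℝ) → ℂ) : Set ((Fin d → ℝ) →ᵇ B) :=
  {x | ∃ (u v : ℕ → (Fin d → ℝ) →ᵇ B) (y : (Fin d → ℝ) →ᵇ B),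
    (∀ n, IsDiamondComp h (u n) (v n)) ∧
    Filter.Tendsto u Filter.atTop (nhds x) ∧ Filter.Tendsto v Filter.atTop (nhds y)}

/-- `e_α(l) = exp(α·l)`. -/
def expFun (α l : Fin d → ℝ) : ℂ := (Real.exp (∑ k, α k * l k) : ℂ)

/-- `h_α(l) = exp(∑ₖ αₖ |lₖ|)`. -/
def absExpFun (α l : Fin d → ℝ) : ℂ := (Real.exp (∑ k, α k * |l k|) : ℂ)

/-- Exponential spectral decay. -/
def expClass : Set ((Fin d → ℝ) →ᵇ B) :=
  {x | ∃ α : Fin d → ℝ, (∀ k, 0 < α k) ∧ x ∈ diamondDomain (absExpFun α)}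

/-- One-sided exponential spectral decay, positive side. -/
def expClassPos : Set ((Fin d → ℝ) →ᵇ B) :=
  {x | ∃ α : Fin d → ℝ, (∀ k, 0 < α k) ∧ x ∈ diamondDomain (expFun α)}

/-- One-sided exponential spectral decay, negative side. -/
def expClassNeg : Set ((Fin d → ℝ) →ᵇ B) :=
  {x | ∃ α : Fin d → ℝ, (∀ k, α k < 0) ∧ x ∈ diamondDomain (expFun α)}

/-- The partial derivative in the `k`-th coordinate. -/
def partialD (k : Fin d) (x : (Fin d → ℝ) → B) : (Fin d → ℝ) → B :=
  fun s => lineDeriv ℝ x s (Pi.single k 1)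

/-- The derivative `x^{(α)} = ∂₁^{α₁} ⋯ ∂_d^{α_d} x`. -/
def multiD (α : Fin d → ℕ) (x : (Fin d → ℝ) → B) : (Fin d → ℝ) → B :=
  (List.finRange d).foldr (fun k f => (partialD k)^[α k] f) x

/-- `C_b^m`: functions with continuous bounded derivatives up to order `m`. -/
def boundedCm (m : ℕ) : Set ((Fin d → ℝ) →ᵇ B) :=
  {x | ContDiff ℝ m x ∧
    ∀ α : Fin d → ℕ, ∑ k, α k ≤ m → ∃ C : ℝ, ∀ s, ‖multiD α x s‖ ≤ C}

/-- The Sobolev-Wiener class. -/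
def sobolevWienerClass (m : ℕ) : Set ((Fin d → ℝ) →ᵇ B) :=
  {x | x ∈ boundedCm m ∧ ∀ α : Fin d → ℕ, ∑ k, α k ≤ m → wienerNorm (multiD α x) < ⊤}

/-- The Sobolev-Beurling class. -/
def sobolevBeurlingClass (m : ℕ) : Set ((Fin d → ℝ) →ᵇ B) :=
  {x | x ∈ boundedCm m ∧ ∀ α : Fin d → ℕ, ∑ k, α k ≤ m → beurlingNorm (multiD α x) < ⊤}

end Classes

end SpectralDecay

end

open scoped BoundedContinuousFunction Topology ENNReal NNReal ContDiff
open MeasureTheory Filter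

noncomputable section

set_option linter.unusedSectionVars false

namespace SpectralDecay

variable {d : ℕ} {B : Type*} [NormedRing B] [NormedAlgebra ℂ B] [CompleteSpace B]

/-! Everything rests on one observation: having `e_α ⋄ x` in `C_b` means that the translates `τ ↦
x(· + τα)`, placed on the imaginary axis, extend to a holomorphic function on the strip `0 ≤ Re z ≤
1` whose value at `z = 1` is `e_α ⋄ x`. This is the relation `Ext`. Translations are algebra
automorphisms, so products of extensions are extensions (`Ext.mul`). Invertibility is an open
condition and translation preserves it, so the inverse of an extension is an extension on a narrower
strip (`Ext.inverse`). This settles the one-sided exponential classes. The two-sided class is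
compared with the `2^d` sign patterns of `α`, at the price of a factor two in the exponent: the
quotients of exponentials that arise are combinations of products of two-sided exponentials, hence
Fourier transforms of integrable functions.

For the Wiener and Beurling classes, `x` is the norm-convergent sum of its lattice parts `φ_n * x`
(`hasSum_latPart`). A finite partial sum `p` close to `x` is invertible and has bounded spectrum, so
`q = p⁻¹` extends to a thin strip of width `h` in all diagonal directions, and `x⁻¹ = ∑ q ((p - x)
q)^k`. The class norm of `q` may grow with `p`, so the Neumann series cannot simply be summed in the
class norm. Instead each lattice part of `p - x` is moved to the origin by a modulation. There its
extensions to any strip of width at most one are bounded by a fixed constant times its norm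
(`exists_hasExts_of_mult_plat_eq`), while the extensions of `q` are bounded by `‖x⁻¹‖ + 2` whatever
the truncation (`exists_hasExts_inverse`). Modulations pull out of products and only shift the
lattice index, so the parts of the `k`-th term are dominated by a `k`-fold convolution of the small
tail sequence with a single `exp(-h|m|₁)` (`exists_decays_one`, `Decays.hasSum_mul`). The thinness
of the strip is thus paid for once and not once per factor. Both classes are given by a weight `N`
on sequences with `N(b * c) ≤ K (N b ‖c‖₁ + ‖b‖₁ N c)`, and then smallness of the tail in `ℓ¹` alone
makes the series converge (`IsWeight.inverse_mem`).

The Sobolev versions follow by induction from `∂(x⁻¹) = -x⁻¹ (∂x) x⁻¹`, because the underlying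
classes are closed under sums, products, negation and inverses. -/

/-- The character `s ↦ exp(i l·s)`. -/
def chr (l s : Fin d → ℝ) : ℂ := Complex.exp (Complex.I * ((∑ k, l k * s k : ℝ) : ℂ))

lemma chr_add_right (l s t : Fin d → ℝ) : chr l (s + t) = chr l s * chr l t := by
  simp only [chr, ← Complex.exp_add, ← mul_add, ← Complex.ofReal_add, ← Finset.sum_add_distrib,
    Pi.add_apply]

lemma chr_add_left (l m s : Fin d → ℝ) : chr (l + m) s = chr l s * chr m s := by
  simp only [chr, ← Complex.exp_add, ← mul_add, ← Complex.ofReal_add, ← Finset.sum_add_distrib,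
    Pi.add_apply, add_mul]

@[simp] lemma chr_zero_left (s : Fin d → ℝ) : chr 0 s = 1 := by simp [chr]
lemma chr_comm (l s : Fin d → ℝ) : chr l s = chr s l := by simp [chr, mul_comm]

lemma chr_neg_right (l s : Fin d → ℝ) : chr l (-s) = chr (-l) s := by simp [chr]

@[simp] lemma norm_chr (l s : Fin d → ℝ) : ‖chr l s‖ = 1 := by
  rw [chr, mul_comm, Complex.norm_exp_ofReal_mul_I]

@[fun_prop] lemma continuous_chr (l : Fin d → ℝ) : Continuous (chr l) := by
  unfold chr; fun_prop

@[fun_prop] lemma continuous_chr_left (s : Fin d → ℝ) : Continuous (fun l => chr l s) := by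
  unfold chr; fun_prop

lemma chr_smul (c : ℝ) (l s : Fin d → ℝ) : chr (c • l) s = chr l (c • s) := by
  simp [chr, mul_left_comm, mul_assoc]

lemma fourierT_eq (f : (Fin d → ℝ) → ℂ) (l : Fin d → ℝ) :
    fourierT f l = ∫ t, f t * chr (-l) t := by
  simp [fourierT, chr, mul_comm]

/-! ### Translations and modulations. -/

/-- Translation by `t` on bounded continuous functions. -/
def trans (t : Fin d → ℝ) : ((Fin d → ℝ) →ᵇ B) →L[ℂ] ((Fin d → ℝ) →ᵇ B) :=
  LinearMap.mkContinuous
    { toFun := fun u => u.compContinuous ⟨fun s => s + t, by fun_prop⟩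
      map_add' := fun _ _ => rfl
      map_smul' := fun _ _ => rfl } 1 fun u => by
    rw [one_mul]
    exact (BoundedContinuousFunction.norm_le (norm_nonneg _)).2 fun s => u.norm_coe_le_norm _

@[simp] lemma trans_apply (t s : Fin d → ℝ) (u : (Fin d → ℝ) →ᵇ B) :
    trans t u s = u (s + t) := rfl

lemma trans_mul (t : Fin d → ℝ) (u v : (Fin d → ℝ) →ᵇ B) :
    trans t (u * v) = trans t u * trans t v := rfl

lemma trans_one (t : Fin d → ℝ) : trans t (1 : (Fin d → ℝ) →ᵇ B) = 1 := rfl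

lemma trans_trans (s t : Fin d → ℝ) (u : (Fin d → ℝ) →ᵇ B) :
    trans s (trans t u) = trans (s + t) u := by
  ext r; simp [add_assoc]

@[simp] lemma trans_zero (u : (Fin d → ℝ) →ᵇ B) : trans 0 u = u := by ext r; simp

@[simp] lemma norm_trans (t : Fin d → ℝ) (u : (Fin d → ℝ) →ᵇ B) : ‖trans t u‖ = ‖u‖ := by
  have h : ∀ (t : Fin d → ℝ) (u : (Fin d → ℝ) →ᵇ B), ‖trans t u‖ ≤ ‖u‖ := fun t u =>
    (BoundedContinuousFunction.norm_le (norm_nonneg _)).2 fun s => u.norm_coe_le_norm _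
  refine le_antisymm (h t u) ?_
  have := h (-t) (trans t u)
  rwa [trans_trans, neg_add_cancel, trans_zero] at this

lemma norm_chr_smul_le (a : Fin d → ℝ) (u : (Fin d → ℝ) →ᵇ B) (s : Fin d → ℝ) :
    ‖chr a s • u s‖ ≤ ‖u‖ := by
  rw [norm_smul, norm_chr, one_mul]; exact u.norm_coe_le_norm s

/-- Multiplication by the character `chr a`. -/
def modu (a : Fin d → ℝ) : ((Fin d → ℝ) →ᵇ B) →L[ℂ] ((Fin d → ℝ) →ᵇ B) :=
  LinearMap.mkContinuous
    { toFun := fun u => BoundedContinuousFunction.ofNormedAddCommGroup (fun s => chr a s • u s)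
        (by fun_prop) ‖u‖ (norm_chr_smul_le a u)
      map_add' := fun u v => by ext s; simp
      map_smul' := fun c u => by ext s; simp [smul_comm (chr a s) c] } 1 fun u => by
    rw [one_mul]
    exact BoundedContinuousFunction.norm_ofNormedAddCommGroup_le _ (norm_nonneg _)
      (norm_chr_smul_le a u)

@[simp] lemma modu_apply (a s : Fin d → ℝ) (u : (Fin d → ℝ) →ᵇ B) :
    modu a u s = chr a s • u s := rfl

lemma modu_modu (a b : Fin d → ℝ) (u : (Fin d → ℝ) →ᵇ B) :
    modu a (modu b u) = modu (a + b) u := by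
  ext s; simp [chr_add_left, smul_smul]

@[simp] lemma modu_zero (u : (Fin d → ℝ) →ᵇ B) : modu 0 u = u := by ext s; simp

@[simp] lemma norm_modu (a : Fin d → ℝ) (u : (Fin d → ℝ) →ᵇ B) : ‖modu a u‖ = ‖u‖ := by
  have h : ∀ s, ‖modu a u s‖ = ‖u s‖ := fun s => by simp [norm_smul]
  refine le_antisymm ?_ ?_
  · exact (BoundedContinuousFunction.norm_le (norm_nonneg _)).2 fun s =>
      (h s).trans_le (u.norm_coe_le_norm _)
  · exact (BoundedContinuousFunction.norm_le (norm_nonneg _)).2 fun s =>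
      (h s).symm.trans_le ((modu a u).norm_coe_le_norm _)

lemma modu_mul_left (a : Fin d → ℝ) (u v : (Fin d → ℝ) →ᵇ B) :
    modu a u * v = modu a (u * v) := by ext s; simp

lemma modu_mul_right (a : Fin d → ℝ) (u v : (Fin d → ℝ) →ᵇ B) :
    u * modu a v = modu a (u * v) := by ext s; simp

/-! ### Convolution operators, dilations and approximate identities. -/

section Conv

lemma integrable_smul_bcf {f : (Fin d → ℝ) → ℂ} (hf : Integrable f) (u : (Fin d → ℝ) →ᵇ B)
    (s : Fin d → ℝ) : Integrable fun t => f t • u (s - t) := by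
  refine Integrable.mono' (hf.norm.mul_const ‖u‖) ?_ (Eventually.of_forall fun t => ?_)
  · exact hf.aestronglyMeasurable.smul (by
      have : Continuous fun t => u (s - t) := by fun_prop
      exact this.aestronglyMeasurable)
  · rw [norm_smul]
    exact mul_le_mul_of_nonneg_left (u.norm_coe_le_norm _) (norm_nonneg _)

lemma norm_integral_smul_bcf_le {f : (Fin d → ℝ) → ℂ} (hf : Integrable f)
    (u : (Fin d → ℝ) →ᵇ B) (s : Fin d → ℝ) :
    ‖∫ t, f t • u (s - t)‖ ≤ (∫ t, ‖f t‖) * ‖u‖ := by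
  rw [← integral_mul_const]
  refine norm_integral_le_of_norm_le (hf.norm.mul_const ‖u‖) (Eventually.of_forall fun t => ?_)
  rw [norm_smul]
  exact mul_le_mul_of_nonneg_left (u.norm_coe_le_norm _) (norm_nonneg _)

open Classical in
/-- Convolution with an integrable function, as an operator on bounded continuous functions. -/
def cv (f : (Fin d → ℝ) → ℂ) : ((Fin d → ℝ) →ᵇ B) →L[ℂ] ((Fin d → ℝ) →ᵇ B) :=
  if hf : Integrable f then
    LinearMap.mkContinuous
      { toFun := fun u => BoundedContinuousFunction.ofNormedAddCommGroup
          (fun s => ∫ t, f t • u (s - t))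
          (continuous_of_dominated (fun s => (integrable_smul_bcf hf u s).aestronglyMeasurable)
            (fun s => Eventually.of_forall fun t => by
              rw [norm_smul]
              exact mul_le_mul_of_nonneg_left (u.norm_coe_le_norm _) (norm_nonneg _))
            (hf.norm.mul_const ‖u‖) (Eventually.of_forall fun t => by fun_prop))
          ((∫ t, ‖f t‖) * ‖u‖) (norm_integral_smul_bcf_le hf u)
        map_add' := fun u v => by
          ext s
          simp only [BoundedContinuousFunction.coe_ofNormedAddCommGroup,
            BoundedContinuousFunction.coe_add, Pi.add_apply, smul_add]
          exact integral_add (integrable_smul_bcf hf u s) (integrable_smul_bcf hf v s)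
        map_smul' := fun c u => by
          ext s
          simp only [BoundedContinuousFunction.coe_ofNormedAddCommGroup,
            BoundedContinuousFunction.coe_smul, RingHom.id_apply]
          rw [← integral_smul]
          simp_rw [smul_comm c] }
      (∫ t, ‖f t‖) fun u =>
        BoundedContinuousFunction.norm_ofNormedAddCommGroup_le _ (by positivity)
          (norm_integral_smul_bcf_le hf u)
  -- A default value; the lemmas that evaluate `cv f` all assume `f` integrable.
  else 0

variable {f g : (Fin d → ℝ) → ℂ}

lemma cv_apply (hf : Integrable f) (u : (Fin d → ℝ) →ᵇ B) (s : Fin d → ℝ) :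
    cv f u s = ∫ t, f t • u (s - t) := by
  rw [cv, dif_pos hf]; rfl

lemma cv_apply_conv (hf : Integrable f) (u : (Fin d → ℝ) →ᵇ B) (s : Fin d → ℝ) :
    cv f u s = conv f u s := cv_apply hf u s

lemma norm_cv_le (hf : Integrable f) :
    ‖(cv f : ((Fin d → ℝ) →ᵇ B) →L[ℂ] _)‖ ≤ ∫ t, ‖f t‖ := by
  rw [cv, dif_pos hf]
  exact LinearMap.mkContinuous_norm_le _ (by positivity) _

lemma cv_add (hf : Integrable f) (hg : Integrable g) :
    (cv (fun t => f t + g t) : ((Fin d → ℝ) →ᵇ B) →L[ℂ] _) = cv f + cv g := by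
  ext u s
  simp only [add_apply, BoundedContinuousFunction.coe_add, Pi.add_apply]
  rw [cv_apply hf, cv_apply hg, cv_apply (f := fun t => f t + g t) (hf.add hg),
    ← integral_add (integrable_smul_bcf hf u s) (integrable_smul_bcf hg u s)]
  simp [add_smul]

lemma cv_smul (c : ℂ) (hf : Integrable f) :
    (cv (fun t => c * f t) : ((Fin d → ℝ) →ᵇ B) →L[ℂ] _) = c • cv f := by
  ext u s
  simp only [smul_apply, BoundedContinuousFunction.coe_smul]
  rw [cv_apply hf, cv_apply (hf.const_mul c), ← integral_smul]
  simp [mul_smul]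

lemma cv_sub (hf : Integrable f) (hg : Integrable g) :
    (cv (fun t => f t - g t) : ((Fin d → ℝ) →ᵇ B) →L[ℂ] _) = cv f - cv g := by
  ext u s
  change _ = cv f u s - cv g u s
  rw [cv_apply hf, cv_apply hg, cv_apply (f := fun t => f t - g t) (hf.sub hg),
    ← integral_sub (integrable_smul_bcf hf u s) (integrable_smul_bcf hg u s)]
  simp [sub_smul]

/-- Convolution of scalar functions. -/
def convS (f g : (Fin d → ℝ) → ℂ) : (Fin d → ℝ) → ℂ := fun s => ∫ t, f t * g (s - t)

lemma convS_eq (f g : (Fin d → ℝ) → ℂ) :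
    convS f g = MeasureTheory.convolution f g (ContinuousLinearMap.mul ℂ ℂ) volume := rfl

lemma integrable_convS (hf : Integrable f) (hg : Integrable g) : Integrable (convS f g) := by
  rw [convS_eq]; exact hf.integrable_convolution _ hg

lemma integrable_convS_integrand (hf : Integrable f) (hg : Integrable g) :
    Integrable (fun p : (Fin d → ℝ) × (Fin d → ℝ) => f p.2 * g (p.1 - p.2))
      (volume.prod volume) :=
  hf.convolution_integrand (ContinuousLinearMap.mul ℂ ℂ) hg

lemma fourierT_convS (hf : Integrable f) (hg : Integrable g) (l : Fin d → ℝ) :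
    fourierT (convS f g) l = fourierT f l * fourierT g l := by
  have hi := integrable_convS_integrand (f := fun t => f t * chr (-l) t)
    (g := fun t => g t * chr (-l) t)
    (hf.mul_bdd (c := 1) (by fun_prop) (Eventually.of_forall fun t => by simp))
    (hg.mul_bdd (c := 1) (by fun_prop) (Eventually.of_forall fun t => by simp))
  have key : ∀ s, convS f g s * chr (-l) s =
      ∫ t, f t * chr (-l) t * (g (s - t) * chr (-l) (s - t)) := by
    intro s
    rw [convS, ← integral_mul_const]
    congr 1; ext t
    have : chr (-l) s = chr (-l) t * chr (-l) (s - t) := by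
      rw [← chr_add_right, add_sub_cancel]
    rw [this]; ring
  rw [fourierT_eq]
  simp_rw [key]
  rw [integral_integral_swap hi]
  simp_rw [integral_const_mul]
  have : ∀ t : Fin d → ℝ, ∫ s, g (s - t) * chr (-l) (s - t) = fourierT g l := fun t => by
    rw [fourierT_eq, integral_sub_right_eq_self (fun s => g s * chr (-l) s)]
  simp_rw [this, integral_mul_const, ← fourierT_eq]

lemma cv_convS (hf : Integrable f) (hg : Integrable g) :
    (cv (convS f g) : ((Fin d → ℝ) →ᵇ B) →L[ℂ] _) = cv f ∘L cv g := by
  ext u s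
  rw [ContinuousLinearMap.comp_apply, cv_apply (integrable_convS hf hg), cv_apply hf]
  simp_rw [cv_apply hg]
  have h1 : ∀ t, convS f g t • u (s - t) = ∫ r, (f r * g (t - r)) • u (s - t) := fun t => by
    rw [convS, integral_smul_const]
  have h2 : ∀ r, f r • ∫ t, g t • u (s - r - t) = ∫ t, (f r * g (t - r)) • u (s - t) := fun r => by
    rw [← integral_smul, ← integral_sub_right_eq_self _ r]
    congr 1; ext t
    simp [mul_smul]
  simp_rw [h1, h2]
  refine integral_integral_swap ?_
  refine Integrable.mono' ((integrable_convS_integrand hf hg).norm.mul_const ‖u‖) ?_ ?_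
  · refine (integrable_convS_integrand hf hg).aestronglyMeasurable.smul ?_
    have : Continuous fun p : (Fin d → ℝ) × (Fin d → ℝ) => u (s - p.1) := by fun_prop
    exact this.aestronglyMeasurable
  · refine Eventually.of_forall fun p => ?_
    simp only [Function.uncurry]
    rw [norm_smul]
    exact mul_le_mul_of_nonneg_left (u.norm_coe_le_norm _) (norm_nonneg _)

lemma cv_trans (hf : Integrable f) (t : Fin d → ℝ) (u : (Fin d → ℝ) →ᵇ B) :
    cv f (trans t u) = trans t (cv f u) := by
  ext s
  rw [trans_apply, cv_apply hf, cv_apply hf]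
  simp [sub_add_eq_add_sub]

lemma fourierT_chr_mul (f : (Fin d → ℝ) → ℂ) (a l : Fin d → ℝ) :
    fourierT (fun t => chr a t * f t) l = fourierT f (l - a) := by
  simp only [fourierT_eq, neg_sub]
  congr 1; ext t
  rw [sub_eq_add_neg, chr_add_left]; ring

lemma cv_chr_mul (hf : Integrable f) (a : Fin d → ℝ) (u : (Fin d → ℝ) →ᵇ B) :
    cv (fun t => chr a t * f t) (modu a u) = modu a (cv f u) := by
  have h : Integrable fun t => chr a t * f t :=
    hf.bdd_mul (c := 1) (by fun_prop) (Eventually.of_forall fun t => by simp)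
  ext s
  rw [modu_apply, cv_apply hf, cv_apply h, ← integral_smul]
  congr 1; ext t
  have : chr a s = chr a t * chr a (s - t) := by rw [← chr_add_right, add_sub_cancel]
  simp only [modu_apply, smul_smul, this]
  congr 1; ring

lemma fourierT_translate (f : (Fin d → ℝ) → ℂ) (a l : Fin d → ℝ) :
    fourierT (fun t => f (t + a)) l = chr l a * fourierT f l := by
  simp only [fourierT_eq]
  rw [← integral_add_right_eq_self (fun t => f t * chr (-l) t) a, ← integral_const_mul]
  congr 1; ext t
  rw [chr_add_right]
  have : chr l a * chr (-l) a = 1 := by rw [← chr_add_left]; simp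
  linear_combination (-f (t + a) * chr (-l) t) * this

lemma cv_translate (hf : Integrable f) (a : Fin d → ℝ) (u : (Fin d → ℝ) →ᵇ B) :
    cv (fun t => f (t + a)) u = trans a (cv f u) := by
  ext s
  rw [trans_apply, cv_apply hf, cv_apply (hf.comp_add_right a),
    ← integral_sub_right_eq_self _ a]
  congr 1; ext t
  simp only [sub_add_cancel]
  congr 2; abel

lemma continuous_fourierT (hf : Integrable f) : Continuous (fourierT f) := by
  have : fourierT f = fun l => ∫ t, f t * chr (-l) t := funext (fourierT_eq f)
  rw [this]
  refine continuous_of_dominated (bound := fun t => ‖f t‖) (fun l => ?_) (fun l => ?_) hf.norm ?_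
  · exact hf.aestronglyMeasurable.mul (continuous_chr _).aestronglyMeasurable
  · exact Eventually.of_forall fun t => by simp
  · exact Eventually.of_forall fun t => by
      have := (continuous_chr_left t).comp (continuous_neg (G := Fin d → ℝ))
      exact continuous_const.mul this

/-- The dilation `n^d f(n t)` of an integrable function. -/
def dil (n : ℝ) (f : (Fin d → ℝ) → ℂ) : (Fin d → ℝ) → ℂ := fun t => ((n ^ d : ℝ) : ℂ) * f (n • t)

lemma integrable_dil {n : ℝ} (hn : 0 < n) (hf : Integrable f) : Integrable (dil n f) :=
  (hf.comp_smul hn.ne').const_mul _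

lemma integral_dil_smul {E : Type*} [NormedAddCommGroup E] [NormedSpace ℂ E]
    {n : ℝ} (hn : 0 < n) (f : (Fin d → ℝ) → ℂ) (F : (Fin d → ℝ) → E) :
    ∫ t, dil n f t • F t = ∫ t, f t • F (n⁻¹ • t) := by
  have h := Measure.integral_comp_smul (volume : Measure (Fin d → ℝ))
    (fun t => f t • F (n⁻¹ • t)) n
  simp only [Module.finrank_fin_fun, smul_smul, inv_mul_cancel₀ hn.ne', one_smul] at h
  simp only [dil, mul_smul]
  rw [integral_smul, h, abs_of_pos (by positivity)]
  rw [← Complex.coe_smul (n ^ d)⁻¹, smul_smul, ← Complex.ofReal_mul, mul_inv_cancel₀ (by positivity)]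
  simp

lemma fourierT_dil {n : ℝ} (hn : 0 < n) (f : (Fin d → ℝ) → ℂ) (l : Fin d → ℝ) :
    fourierT (dil n f) l = fourierT f (n⁻¹ • l) := by
  simp only [fourierT_eq]
  have := integral_dil_smul hn f (chr (-l))
  simp only [smul_eq_mul] at this
  rw [this]
  congr 1; ext t
  rw [← chr_smul, smul_neg]

lemma cv_dil_apply {n : ℝ} (hn : 0 < n) (hf : Integrable f) (u : (Fin d → ℝ) →ᵇ B)
    (s : Fin d → ℝ) : cv (dil n f) u s = ∫ t, f t • u (s - n⁻¹ • t) := by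
  rw [cv_apply (integrable_dil hn hf), integral_dil_smul hn f (fun t => u (s - t))]

lemma tendsto_inv_smul {r : Fin d → ℝ} :
    Tendsto (fun n : ℕ => ((n : ℝ) + 1)⁻¹ • r) atTop (𝓝 0) := by
  have h : Tendsto (fun n : ℕ => ((n : ℝ) + 1)⁻¹) atTop (𝓝 0) := by
    simpa using tendsto_one_div_add_atTop_nhds_zero_nat (𝕜 := ℝ)
  simpa using h.smul_const r

/-- Dilations of an integrable function of integral one form an approximate identity. -/
lemma tendsto_cv_dil (hf : Integrable f) (h1 : fourierT f 0 = 1) (u : (Fin d → ℝ) →ᵇ B)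
    (s : Fin d → ℝ) : Tendsto (fun n : ℕ => cv (dil ((n : ℝ) + 1) f) u s) atTop (𝓝 (u s)) := by
  have hlim : u s = ∫ t, f t • u s := by
    rw [integral_smul_const]
    simp only [fourierT_eq, neg_zero, chr_zero_left, mul_one] at h1
    simp [h1]
  rw [hlim]
  simp_rw [fun n : ℕ => cv_dil_apply (n := (n : ℝ) + 1) (by positivity) hf u s]
  refine tendsto_integral_of_dominated_convergence (fun t => ‖f t‖ * ‖u‖) (fun n => ?_)
    (hf.norm.mul_const _) (fun n => Eventually.of_forall fun t => ?_)
    (Eventually.of_forall fun t => ?_)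
  · refine hf.aestronglyMeasurable.smul ?_
    have : Continuous fun t : Fin d → ℝ => u (s - ((n : ℝ) + 1)⁻¹ • t) := by fun_prop
    exact this.aestronglyMeasurable
  · rw [norm_smul]
    exact mul_le_mul_of_nonneg_left (u.norm_coe_le_norm _) (norm_nonneg _)
  · refine tendsto_const_nhds.smul ((u.continuous.tendsto _).comp ?_)
    simpa using (tendsto_const_nhds (x := s)).sub (tendsto_inv_smul (r := t))

end Conv

/-! ### Uniqueness of the Fourier transform, via Gaussians. -/

section Injective

variable {f g : (Fin d → ℝ) → ℂ}

/-- The Gaussian `exp(-|t|²/2 + i z α·t)`. -/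
def gaussian (α : Fin d → ℝ) (z : ℂ) (t : Fin d → ℝ) : ℂ :=
  Complex.exp (-(1 / 2) * ∑ k, (t k : ℂ) ^ 2 + ∑ k, (Complex.I * z * α k) * t k)

/-- The normalising constant `(2π)^{d/2}`. -/
def gaussianConst (d : ℕ) : ℂ := (Real.pi / (1 / 2 : ℂ)) ^ (Fintype.card (Fin d) / 2 : ℂ)

lemma gaussianConst_ne_zero (d : ℕ) : gaussianConst d ≠ 0 := by
  rw [gaussianConst, Ne, Complex.cpow_eq_zero_iff]
  simp [Real.pi_ne_zero]

lemma integrable_gaussian (α : Fin d → ℝ) (z : ℂ) : Integrable (gaussian α z) :=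
  GaussianFourier.integrable_cexp_neg_mul_sum_add (by norm_num) _

lemma fourierT_gaussian (α : Fin d → ℝ) (z : ℂ) (l : Fin d → ℝ) :
    fourierT (gaussian α z) l = gaussianConst d *
      Complex.exp (z * (∑ k, α k * l k : ℝ) - (1 / 2) * ∑ k, (l k : ℂ) ^ 2
        - (1 / 2) * z ^ 2 * ∑ k, (α k : ℂ) ^ 2) := by
  have h := GaussianFourier.integral_cexp_neg_mul_sum_add (ι := Fin d) (b := 1 / 2) (by norm_num)
    (fun k => Complex.I * z * α k - Complex.I * l k)
  have h2 : ∀ t, gaussian α z t * chr (-l) t =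
      Complex.exp (-(1 / 2) * ∑ k, (t k : ℂ) ^ 2 +
        ∑ k, (Complex.I * z * α k - Complex.I * l k) * t k) := by
    intro t
    rw [gaussian, chr, ← Complex.exp_add]
    congr 1
    push_cast
    rw [Finset.mul_sum _ _ Complex.I, add_assoc, ← Finset.sum_add_distrib]
    congr 1
    refine Finset.sum_congr rfl fun k _ => ?_
    simp; ring
  rw [fourierT_eq]
  simp_rw [h2]
  rw [h, gaussianConst]
  congr 2
  push_cast
  rw [Finset.mul_sum, Finset.mul_sum, Finset.mul_sum, Finset.sum_div, ← Finset.sum_sub_distrib,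
    ← Finset.sum_sub_distrib]
  refine Finset.sum_congr rfl fun k _ => ?_
  ring_nf
  rw [Complex.I_sq]; ring

/-- The standard Gaussian symbol `exp(-|l|²/2)`. -/
def gauss0 (l : Fin d → ℝ) : ℂ := Complex.exp (-(1 / 2) * ∑ k, (l k : ℂ) ^ 2)

lemma gaussian_zero : (gaussian (0 : Fin d → ℝ) 0) = gauss0 := by
  ext t; simp [gaussian, gauss0]

lemma integrable_gauss0 : Integrable (gauss0 : (Fin d → ℝ) → ℂ) :=
  gaussian_zero (d := d) ▸ integrable_gaussian 0 0

lemma fourierT_gauss0 (l : Fin d → ℝ) : fourierT gauss0 l = gaussianConst d * gauss0 l := by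
  rw [← gaussian_zero, fourierT_gaussian]
  simp [gaussian]

lemma gauss0_eq (t : Fin d → ℝ) :
    gauss0 t = (gaussianConst d)⁻¹ * ∫ l, gauss0 l * chr t l := by
  have := fourierT_gauss0 (-t)
  rw [fourierT_eq, neg_neg] at this
  rw [this, inv_mul_cancel_left₀ (gaussianConst_ne_zero d)]
  simp [gauss0]

/-- The Gaussian is an integral of characters, so by Fubini its convolution with `f` is an average
of values of the Fourier transform of `f`. -/
lemma convS_dil_gauss0_eq_zero (hf : Integrable f) (h0 : ∀ l, fourierT f l = 0) (n : ℝ)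
    (s : Fin d → ℝ) : convS f (dil n gauss0) s = 0 := by
  have key : ∀ t, f t * dil n gauss0 (s - t) = ((n ^ d : ℝ) : ℂ) * (gaussianConst d)⁻¹ *
      ∫ l, f t * (gauss0 l * chr (n • (s - t)) l) := by
    intro t
    rw [dil, gauss0_eq, integral_const_mul]; ring
  rw [convS]
  simp_rw [key]
  rw [integral_const_mul, integral_integral_swap]
  · have h3 : ∀ l, ∫ t, f t * (gauss0 l * chr (n • (s - t)) l) = 0 := by
      intro l
      have : ∀ t, f t * (gauss0 l * chr (n • (s - t)) l) =
          (gauss0 l * chr (n • l) s) * (f t * chr (-(n • l)) t) := by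
        intro t
        have e : chr (n • (s - t)) l = chr (n • l) s * chr (-(n • l)) t := by
          rw [chr_smul, chr_comm, sub_eq_add_neg, chr_add_right, chr_neg_right]
        rw [e]; ring
      simp_rw [this]
      rw [integral_const_mul, ← fourierT_eq, h0, mul_zero]
    simp [h3]
  · have : Integrable (fun p : (Fin d → ℝ) × (Fin d → ℝ) => f p.1 * gauss0 p.2)
        (volume.prod volume) := hf.mul_prod integrable_gauss0
    have h2 := this.mul_bdd (c := 1) (g := fun p : (Fin d → ℝ) × (Fin d → ℝ) =>
      chr (n • (s - p.1)) p.2) (by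
        refine Continuous.aestronglyMeasurable ?_
        unfold chr; fun_prop) (Eventually.of_forall fun t => by simp)
    refine h2.congr (Eventually.of_forall fun p => ?_)
    simp [Function.uncurry, mul_assoc]

lemma cv_zero : (cv (fun _ => 0) : ((Fin d → ℝ) →ᵇ B) →L[ℂ] _) = 0 := by
  ext u s
  rw [cv_apply (f := fun _ => 0) (integrable_zero _ _ _)]; simp

/-- Dilated Gaussians form an approximate identity that commutes with `f`, and their convolution
with `f` already vanishes. This is what allows operators to be indexed by their symbols. -/
lemma cv_eq_zero (hf : Integrable f) (h0 : ∀ l, fourierT f l = 0) :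
    (cv f : ((Fin d → ℝ) →ᵇ B) →L[ℂ] _) = 0 := by
  ext u s
  set k : (Fin d → ℝ) → ℂ := fun t => (gaussianConst d)⁻¹ * gauss0 t with hk
  have hki : Integrable k := integrable_gauss0.const_mul _
  have hk1 : fourierT k 0 = 1 := by
    have := fourierT_gauss0 (0 : Fin d → ℝ)
    rw [fourierT_eq] at this
    simp only [hk, fourierT_eq, mul_assoc]
    rw [integral_const_mul, this, inv_mul_cancel_left₀ (gaussianConst_ne_zero d)]
    simp [gauss0]
  have h := tendsto_cv_dil hki hk1 (cv f u) s
  have h2 : ∀ n : ℕ, cv (dil ((n : ℝ) + 1) k) (cv f u) s = 0 := by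
    intro n
    have hd := integrable_dil (n := (n : ℝ) + 1) (by positivity) hki
    have e : cv (dil ((n : ℝ) + 1) k) (cv f u) = cv f (cv (dil ((n : ℝ) + 1) k) u) := by
      ext r
      rw [cv_apply hf, cv_apply hd]
      have a := congrArg (fun T => T u r) (cv_convS (B := B) hf hd)
      have b := congrArg (fun T => T u r) (cv_convS (B := B) hd hf)
      simp only [ContinuousLinearMap.comp_apply] at a b
      rw [cv_apply hf] at a
      rw [cv_apply hd] at b
      rw [← a, ← b]
      congr 2
      rw [convS_eq, convS_eq]
      conv_lhs => rw [← ContinuousLinearMap.flip_mul (𝕜 := ℂ) (R := ℂ)]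
      rw [MeasureTheory.convolution_flip]
    rw [e, ← ContinuousLinearMap.comp_apply, ← cv_convS hf hd]
    have : convS f (dil ((n : ℝ) + 1) k) = fun _ => 0 := by
      ext r
      have := convS_dil_gauss0_eq_zero hf h0 ((n : ℝ) + 1) r
      simp only [convS, dil, hk] at this ⊢
      have e2 : ∀ t, f t * (((((n : ℝ) + 1) ^ d : ℝ) : ℂ) * ((gaussianConst d)⁻¹ *
          gauss0 (((n : ℝ) + 1) • (r - t)))) = (gaussianConst d)⁻¹ * (f t *
          (((((n : ℝ) + 1) ^ d : ℝ) : ℂ) * gauss0 (((n : ℝ) + 1) • (r - t)))) := fun t => by ring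
      simp_rw [e2]
      rw [integral_const_mul, this, mul_zero]
    rw [this, cv_zero]; simp
  simp_rw [h2] at h
  simpa using tendsto_nhds_unique h tendsto_const_nhds

end Injective

/-! ### Fourier multipliers indexed by their symbols. -/

section Mult

variable {G H : (Fin d → ℝ) → ℂ}

/-- `G` is the Fourier transform of an integrable function. -/
def FL1 (G : (Fin d → ℝ) → ℂ) : Prop := ∃ f, Integrable f ∧ ∀ l, fourierT f l = G l

open Classical in
/-- The Fourier multiplier with symbol `G`. -/
def mult (G : (Fin d → ℝ) → ℂ) : ((Fin d → ℝ) →ᵇ B) →L[ℂ] ((Fin d → ℝ) →ᵇ B) :=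
  -- The chosen preimage is irrelevant by `cv_eq_zero`; see `mult_eq`.
  if h : FL1 G then cv h.choose else 0

lemma fourierT_add {f g : (Fin d → ℝ) → ℂ} (hf : Integrable f) (hg : Integrable g)
    (l : Fin d → ℝ) : fourierT (fun t => f t + g t) l = fourierT f l + fourierT g l := by
  have aux : ∀ {f : (Fin d → ℝ) → ℂ}, Integrable f → Integrable fun t => f t * chr (-l) t :=
    fun hf => hf.mul_bdd (c := 1) (by fun_prop) (Eventually.of_forall fun t => by simp)
  simp only [fourierT_eq, add_mul]
  exact integral_add (aux hf) (aux hg)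

lemma fourierT_const_mul (c : ℂ) (f : (Fin d → ℝ) → ℂ) (l : Fin d → ℝ) :
    fourierT (fun t => c * f t) l = c * fourierT f l := by
  simp only [fourierT_eq, mul_assoc, integral_const_mul]

lemma mult_eq {f : (Fin d → ℝ) → ℂ} (hf : Integrable f) (h : ∀ l, fourierT f l = G l) :
    (mult G : ((Fin d → ℝ) →ᵇ B) →L[ℂ] _) = cv f := by
  have hG : FL1 G := ⟨f, hf, h⟩
  rw [mult, dif_pos hG, ← sub_eq_zero, ← cv_sub hG.choose_spec.1 hf]
  refine cv_eq_zero (hG.choose_spec.1.sub hf) fun l => ?_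
  have := fourierT_add hG.choose_spec.1 (hf.const_mul (-1)) l
  rw [fourierT_const_mul, h, hG.choose_spec.2] at this
  simpa [sub_eq_add_neg] using this

lemma mult_fourierT {f : (Fin d → ℝ) → ℂ} (hf : Integrable f) (u : (Fin d → ℝ) →ᵇ B)
    (s : Fin d → ℝ) : mult (fourierT f) u s = conv f u s := by
  rw [mult_eq hf fun _ => rfl, cv_apply_conv hf]

lemma FL1.add (hG : FL1 G) (hH : FL1 H) : FL1 (G + H) := by
  obtain ⟨f, hf, hf'⟩ := hG
  obtain ⟨g, hg, hg'⟩ := hH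
  exact ⟨fun t => f t + g t, hf.add hg, fun l => by simp [fourierT_add hf hg, hf', hg']⟩

lemma FL1.smul (c : ℂ) (hG : FL1 G) : FL1 (c • G) := by
  obtain ⟨f, hf, hf'⟩ := hG
  exact ⟨fun t => c * f t, hf.const_mul c, fun l => by simp [fourierT_const_mul, hf']⟩

lemma FL1.sub (hG : FL1 G) (hH : FL1 H) : FL1 (G - H) := by
  simpa [sub_eq_add_neg] using hG.add (hH.smul (-1))

lemma FL1.mul (hG : FL1 G) (hH : FL1 H) : FL1 (G * H) := by
  obtain ⟨f, hf, hf'⟩ := hG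
  obtain ⟨g, hg, hg'⟩ := hH
  exact ⟨convS f g, integrable_convS hf hg, fun l => by simp [fourierT_convS hf hg, hf', hg']⟩

lemma FL1.zero : FL1 (0 : (Fin d → ℝ) → ℂ) :=
  ⟨fun _ => 0, integrable_zero _ _ _, fun l => by simp [fourierT]⟩

lemma FL1.sum {ι : Type*} (S : Finset ι) {F : ι → (Fin d → ℝ) → ℂ} (h : ∀ i ∈ S, FL1 (F i)) :
    FL1 (∑ i ∈ S, F i) :=
  Finset.sum_induction F FL1 (fun _ _ => FL1.add) FL1.zero h

lemma FL1.continuous (hG : FL1 G) : Continuous G := by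
  obtain ⟨f, hf, hf'⟩ := hG
  rw [← funext hf']; exact continuous_fourierT hf

lemma FL1.shift (hG : FL1 G) (a : Fin d → ℝ) : FL1 (fun l => G (l - a)) := by
  obtain ⟨f, hf, hf'⟩ := hG
  exact ⟨fun t => chr a t * f t, hf.bdd_mul (c := 1) (by fun_prop)
    (Eventually.of_forall fun t => by simp), fun l => by rw [fourierT_chr_mul, hf']⟩

lemma FL1.dil (hG : FL1 G) {n : ℝ} (hn : 0 < n) : FL1 (fun l => G (n⁻¹ • l)) := by
  obtain ⟨f, hf, hf'⟩ := hG
  exact ⟨SpectralDecay.dil n f, integrable_dil hn hf, fun l => by rw [fourierT_dil hn, hf']⟩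

lemma mult_add (hG : FL1 G) (hH : FL1 H) :
    (mult (G + H) : ((Fin d → ℝ) →ᵇ B) →L[ℂ] _) = mult G + mult H := by
  obtain ⟨f, hf, hf'⟩ := hG
  obtain ⟨g, hg, hg'⟩ := hH
  rw [mult_eq hf hf', mult_eq hg hg', ← cv_add hf hg]
  exact mult_eq (hf.add hg) fun l => by
    have := fourierT_add hf hg l
    rw [hf', hg'] at this; exact this

lemma mult_smul (c : ℂ) (hG : FL1 G) :
    (mult (c • G) : ((Fin d → ℝ) →ᵇ B) →L[ℂ] _) = c • mult G := by
  obtain ⟨f, hf, hf'⟩ := hG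
  rw [mult_eq hf hf', ← cv_smul c hf]
  exact mult_eq (hf.const_mul c) fun l => by simp [fourierT_const_mul, hf']

lemma mult_sub (hG : FL1 G) (hH : FL1 H) :
    (mult (G - H) : ((Fin d → ℝ) →ᵇ B) →L[ℂ] _) = mult G - mult H := by
  have : G - H = G + (-1 : ℂ) • H := by ext; simp [sub_eq_add_neg]
  rw [this, mult_add hG (hH.smul _), mult_smul _ hH]
  ext u s
  change mult G u s + (-1 : ℂ) • mult H u s = mult G u s - mult H u s
  rw [neg_one_smul, sub_eq_add_neg]

lemma mult_zero : (mult (0 : (Fin d → ℝ) → ℂ) : ((Fin d → ℝ) →ᵇ B) →L[ℂ] _) = 0 := by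
  rw [mult_eq (integrable_zero _ _ _) fun l => by simp [fourierT]]
  exact cv_zero

lemma mult_sum {ι : Type*} (S : Finset ι) {F : ι → (Fin d → ℝ) → ℂ} (h : ∀ i ∈ S, FL1 (F i)) :
    (mult (∑ i ∈ S, F i) : ((Fin d → ℝ) →ᵇ B) →L[ℂ] _) = ∑ i ∈ S, mult (F i) := by
  classical
  induction S using Finset.induction_on with
  | empty => simpa using mult_zero
  | insert a S ha ih =>
    rw [Finset.sum_insert ha, Finset.sum_insert ha, mult_add (h a (by simp))
      (FL1.sum S fun i hi => h i (by simp [hi])), ih fun i hi => h i (by simp [hi])]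

lemma mult_mul (hG : FL1 G) (hH : FL1 H) (u : (Fin d → ℝ) →ᵇ B) :
    mult (G * H) u = mult G (mult H u) := by
  obtain ⟨f, hf, hf'⟩ := hG
  obtain ⟨g, hg, hg'⟩ := hH
  rw [mult_eq hf hf', mult_eq hg hg', ← ContinuousLinearMap.comp_apply, ← cv_convS hf hg]
  rw [mult_eq (integrable_convS hf hg) fun l => ?_]
  rw [fourierT_convS hf hg, hf', hg', Pi.mul_apply]

lemma mult_comm (hG : FL1 G) (hH : FL1 H) (u : (Fin d → ℝ) →ᵇ B) :
    mult G (mult H u) = mult H (mult G u) := by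
  rw [← mult_mul hG hH, ← mult_mul hH hG, mul_comm]

lemma mult_trans (hG : FL1 G) (t : Fin d → ℝ) (u : (Fin d → ℝ) →ᵇ B) :
    mult G (trans t u) = trans t (mult G u) := by
  obtain ⟨f, hf, hf'⟩ := hG
  rw [mult_eq hf hf', cv_trans hf]

lemma mult_chr_mul (hG : FL1 G) (a : Fin d → ℝ) (u : (Fin d → ℝ) →ᵇ B) :
    mult (fun l => chr l a * G l) u = trans a (mult G u) := by
  obtain ⟨f, hf, hf'⟩ := hG
  rw [mult_eq hf hf', ← cv_translate hf, mult_eq (hf.comp_add_right a)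
    fun l => by rw [fourierT_translate, hf']]

lemma mult_modu (hG : FL1 G) (a : Fin d → ℝ) (u : (Fin d → ℝ) →ᵇ B) :
    mult (fun l => G (l - a)) (modu a u) = modu a (mult G u) := by
  obtain ⟨f, hf, hf'⟩ := hG
  have h : Integrable fun t => chr a t * f t :=
    hf.bdd_mul (c := 1) (by fun_prop) (Eventually.of_forall fun t => by simp)
  rw [mult_eq hf hf', ← cv_chr_mul hf, mult_eq h fun l => by rw [fourierT_chr_mul, hf']]

/-- Shifting a symbol conjugates its operator by an isometric modulation, so one constant serves all
shifts. -/
lemma norm_mult_shift_le (hG : FL1 G) (a : Fin d → ℝ) (u : (Fin d → ℝ) →ᵇ B) :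
    ‖mult (fun l => G (l - a)) u‖ ≤ ‖(mult G : ((Fin d → ℝ) →ᵇ B) →L[ℂ] _)‖ * ‖u‖ := by
  have := mult_modu hG a (modu (-a) u)
  rw [modu_modu, add_neg_cancel, modu_zero] at this
  rw [this, norm_modu]
  exact (ContinuousLinearMap.le_opNorm _ _).trans_eq (by rw [norm_modu])

lemma tendsto_mult_dil (hG : FL1 G) (h1 : G 0 = 1) (u : (Fin d → ℝ) →ᵇ B) (s : Fin d → ℝ) :
    Tendsto (fun n : ℕ => mult (fun l => G (((n : ℝ) + 1)⁻¹ • l)) u s) atTop (𝓝 (u s)) := by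
  obtain ⟨f, hf, hf'⟩ := hG
  have : ∀ n : ℕ, (mult (fun l => G (((n : ℝ) + 1)⁻¹ • l)) : ((Fin d → ℝ) →ᵇ B) →L[ℂ] _) =
      cv (dil ((n : ℝ) + 1) f) := fun n =>
    mult_eq (integrable_dil (by positivity) hf) fun l => by
      rw [fourierT_dil (by positivity), hf']
  simp_rw [this]
  exact tendsto_cv_dil hf (by rw [hf', h1]) u s

/-- Two functions coincide as soon as they have the same image under the dilates of a multiplier
whose symbol is one at the origin. -/
lemma eq_of_mult_dil_eq (hG : FL1 G) (h1 : G 0 = 1) {u v : (Fin d → ℝ) →ᵇ B}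
    (h : ∀ n : ℕ, mult (fun l => G (((n : ℝ) + 1)⁻¹ • l)) u =
      mult (fun l => G (((n : ℝ) + 1)⁻¹ • l)) v) : u = v := by
  ext s
  have h2 := tendsto_mult_dil hG h1 u s
  simp_rw [h] at h2
  exact tendsto_nhds_unique h2 (tendsto_mult_dil hG h1 v s)

end Mult

/-! ### Uniform continuity and norm convergence of approximate identities. -/

section UniformContinuity

/-- The modulus of continuity in `L¹`. -/
def modL1 (f : (Fin d → ℝ) → ℂ) (a : Fin d → ℝ) : ℝ := ∫ t, ‖f (t + a) - f t‖

/-- This is the continuity of the translation action on `L¹`. -/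
lemma continuous_modL1 {f : (Fin d → ℝ) → ℂ} (hf : Integrable f) : Continuous (modL1 f) := by
  have : Fact ((1 : ENNReal) ≠ ⊤) := ⟨by simp⟩
  have hfm : MemLp f 1 volume := memLp_one_iff_integrable.2 hf
  set F := hfm.toLp f with hF
  have hc : Continuous fun a : Fin d → ℝ => (DomAddAct.mk a +ᵥ F) - F :=
    ((DomAddAct.continuous_mk.vadd continuous_const)).sub continuous_const
  have e : ∀ a : Fin d → ℝ, ‖(DomAddAct.mk a +ᵥ F) - F‖ = modL1 f a := by
    intro a
    have hm : AEStronglyMeasurable (fun t => ‖f (t + a) - f t‖) volume :=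
      ((hf.comp_add_right a).aestronglyMeasurable.sub hf.aestronglyMeasurable).norm
    rw [hF, DomAddAct.mk_vadd_toLp, ← MemLp.toLp_sub, Lp.norm_toLp,
      eLpNorm_one_eq_lintegral_enorm, modL1,
      integral_eq_lintegral_of_nonneg_ae (Eventually.of_forall fun t => norm_nonneg _) hm]
    congr 1
    refine lintegral_congr fun t => ?_
    simp [add_comm]
  exact (funext e : _ = modL1 f) ▸ hc.norm

@[simp] lemma modL1_zero (f : (Fin d → ℝ) → ℂ) : modL1 f 0 = 0 := by simp [modL1]

lemma modL1_le {f : (Fin d → ℝ) → ℂ} (hf : Integrable f) (a : Fin d → ℝ) :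
    modL1 f a ≤ 2 * ∫ t, ‖f t‖ := by
  have h := integral_add_right_eq_self (μ := (volume : Measure (Fin d → ℝ))) (fun t => ‖f t‖) a
  calc modL1 f a ≤ ∫ t, (‖f (t + a)‖ + ‖f t‖) :=
        integral_mono ((hf.comp_add_right a).sub hf).norm
          ((hf.comp_add_right a).norm.add hf.norm) fun t => norm_sub_le _ _
    _ = 2 * ∫ t, ‖f t‖ := by
        rw [integral_add (hf.comp_add_right a).norm hf.norm, h, two_mul]

lemma modL1_nonneg (f : (Fin d → ℝ) → ℂ) (a : Fin d → ℝ) : 0 ≤ modL1 f a :=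
  integral_nonneg fun _ => norm_nonneg _

lemma norm_trans_cv_sub_le {f : (Fin d → ℝ) → ℂ} (hf : Integrable f) (a : Fin d → ℝ)
    (u : (Fin d → ℝ) →ᵇ B) : ‖trans a (cv f u) - cv f u‖ ≤ modL1 f a * ‖u‖ := by
  have h1 := hf.comp_add_right a
  rw [← cv_translate hf, ← sub_apply, ← cv_sub h1 hf]
  exact (ContinuousLinearMap.le_opNorm _ _).trans
    (mul_le_mul_of_nonneg_right (norm_cv_le (h1.sub hf)) (norm_nonneg _))

/-- Bounded uniformly continuous functions, in terms of translations. -/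
def IsBUC (u : (Fin d → ℝ) →ᵇ B) : Prop := Continuous fun t => trans t u

lemma isBUC_of_tendsto {u : (Fin d → ℝ) →ᵇ B} (h : Tendsto (fun t => trans t u) (𝓝 0) (𝓝 u)) :
    IsBUC u := by
  refine continuous_iff_continuousAt.2 fun t => ?_
  have h1 : Tendsto (fun s => s - t) (𝓝 t) (𝓝 0) := by
    have : Continuous fun s : Fin d → ℝ => s - t := by fun_prop
    simpa using this.tendsto t
  have h2 := ((trans (B := B) t).continuous.tendsto u).comp (h.comp h1)
  refine h2.congr fun s => ?_
  simp [trans_trans]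

lemma IsBUC.tendsto {u : (Fin d → ℝ) →ᵇ B} (h : IsBUC u) :
    Tendsto (fun t => trans t u) (𝓝 0) (𝓝 u) := by
  simpa using Continuous.tendsto h 0

lemma IsBUC.mul {u v : (Fin d → ℝ) →ᵇ B} (hu : IsBUC u) (hv : IsBUC v) : IsBUC (u * v) :=
  Continuous.mul hu hv

lemma IsBUC.add {u v : (Fin d → ℝ) →ᵇ B} (hu : IsBUC u) (hv : IsBUC v) : IsBUC (u + v) := by
  unfold IsBUC; simp_rw [map_add]; exact Continuous.add hu hv

lemma isBUC_zero : IsBUC (0 : (Fin d → ℝ) →ᵇ B) := by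
  unfold IsBUC; simp_rw [map_zero]; exact continuous_const

lemma isBUC_of_limit {u : ℕ → (Fin d → ℝ) →ᵇ B} {v : (Fin d → ℝ) →ᵇ B} (hu : ∀ n, IsBUC (u n))
    (h : Tendsto u atTop (𝓝 v)) : IsBUC v := by
  have : TendstoUniformly (fun n t => trans t (u n)) (fun t => trans t v) atTop := by
    rw [Metric.tendstoUniformly_iff]
    intro ε hε
    filter_upwards [Metric.tendsto_nhds.1 h ε hε] with n hn t
    rwa [dist_eq_norm, ← map_sub, norm_trans, ← dist_eq_norm, dist_comm]
  exact this.continuous (Eventually.of_forall hu).frequently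

lemma isBUC_mult {G : (Fin d → ℝ) → ℂ} (hG : FL1 G) (u : (Fin d → ℝ) →ᵇ B) :
    IsBUC (mult G u) := by
  obtain ⟨f, hf, hf'⟩ := hG
  rw [mult_eq hf hf']
  refine isBUC_of_tendsto ?_
  rw [tendsto_iff_norm_sub_tendsto_zero]
  have h := ((continuous_modL1 hf).tendsto 0).mul_const ‖u‖
  rw [modL1_zero, zero_mul] at h
  exact squeeze_zero (fun _ => norm_nonneg _) (fun t => norm_trans_cv_sub_le hf t u) h

/-- The error is at most the average of `‖trans (-t/(n+1)) u - u‖` against `|f|`, which tends to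
zero by dominated convergence. Without uniform continuity only the pointwise version
`tendsto_mult_dil` is available. -/
lemma tendsto_mult_dil_of_isBUC {G : (Fin d → ℝ) → ℂ} (hG : FL1 G) (h1 : G 0 = 1)
    {u : (Fin d → ℝ) →ᵇ B} (hu : IsBUC u) :
    Tendsto (fun n : ℕ => mult (fun l => G (((n : ℝ) + 1)⁻¹ • l)) u) atTop (𝓝 u) := by
  obtain ⟨f, hf, hf'⟩ := hG
  have : ∀ n : ℕ, (mult (fun l => G (((n : ℝ) + 1)⁻¹ • l)) : ((Fin d → ℝ) →ᵇ B) →L[ℂ] _) =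
      cv (dil ((n : ℝ) + 1) f) := fun n =>
    mult_eq (integrable_dil (by positivity) hf) fun l => by
      rw [fourierT_dil (by positivity), hf']
  simp_rw [this]
  rw [tendsto_iff_norm_sub_tendsto_zero]
  have hI : ∫ t, f t = 1 := by
    have := hf' 0
    simpa [fourierT_eq, h1] using this
  have hcont : ∀ n : ℕ, Continuous fun t : Fin d → ℝ => ‖trans (-(((n : ℝ) + 1)⁻¹ • t)) u - u‖ :=
    fun n => ((Continuous.comp hu (by fun_prop)).sub continuous_const).norm
  have hbd : ∀ t : Fin d → ℝ, ‖trans t u - u‖ ≤ 2 * ‖u‖ := fun t => by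
    refine (norm_sub_le _ _).trans ?_
    rw [norm_trans, two_mul]
  have hint : ∀ n : ℕ, Integrable fun t => ‖f t‖ * ‖trans (-(((n : ℝ) + 1)⁻¹ • t)) u - u‖ :=
    fun n => hf.norm.mul_bdd (c := 2 * ‖u‖) (hcont n).aestronglyMeasurable
      (Eventually.of_forall fun t => by rw [norm_norm]; exact hbd _)
  have hlim : Tendsto (fun n : ℕ => ∫ t, ‖f t‖ * ‖trans (-(((n : ℝ) + 1)⁻¹ • t)) u - u‖) atTop
      (𝓝 (∫ _ : Fin d → ℝ, (0 : ℝ))) := by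
    refine tendsto_integral_of_dominated_convergence (fun t => ‖f t‖ * (2 * ‖u‖))
      (fun n => (hint n).aestronglyMeasurable) (hf.norm.mul_const _)
      (fun n => Eventually.of_forall fun t => ?_) (Eventually.of_forall fun t => ?_)
    · rw [norm_mul, norm_norm, norm_norm]
      exact mul_le_mul_of_nonneg_left (hbd _) (norm_nonneg _)
    · have h2 : Tendsto (fun n : ℕ => -(((n : ℝ) + 1)⁻¹ • t)) atTop (𝓝 0) := by
        simpa using (tendsto_inv_smul (r := t)).neg
      have h3 := tendsto_iff_norm_sub_tendsto_zero.1 (hu.tendsto.comp h2)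
      simpa using h3.const_mul ‖f t‖
  rw [integral_zero] at hlim
  refine squeeze_zero (fun _ => norm_nonneg _) (fun n => ?_) hlim
  refine (BoundedContinuousFunction.norm_le (integral_nonneg fun t : Fin d → ℝ => by positivity)).2
    fun s => ?_
  have hi2 := integrable_smul_bcf (integrable_dil (n := (n : ℝ) + 1) (by positivity) hf) u s
  have hm : Integrable fun t => f t • u (s - ((n : ℝ) + 1)⁻¹ • t) := by
    refine Integrable.mono' (hf.norm.mul_const ‖u‖) ?_ (Eventually.of_forall fun t => ?_)
    · refine hf.aestronglyMeasurable.smul ?_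
      have : Continuous fun t : Fin d → ℝ => u (s - ((n : ℝ) + 1)⁻¹ • t) := by fun_prop
      exact this.aestronglyMeasurable
    · rw [norm_smul]
      exact mul_le_mul_of_nonneg_left (u.norm_coe_le_norm _) (norm_nonneg _)
  have e : (cv (dil ((n : ℝ) + 1) f) u - u) s =
      ∫ t : Fin d → ℝ, f t • (u (s - ((n : ℝ) + 1)⁻¹ • t) - u s) := by
    simp_rw [smul_sub]
    rw [integral_sub hm (hf.smul_const _), integral_smul_const, hI, one_smul,
      ← cv_dil_apply (n := (n : ℝ) + 1) (by positivity) hf]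
    rfl
  rw [e]
  refine norm_integral_le_of_norm_le (hint n) (Eventually.of_forall fun t => ?_)
  rw [norm_smul]
  refine mul_le_mul_of_nonneg_left ?_ (norm_nonneg _)
  have := (trans (-(((n : ℝ) + 1)⁻¹ • t)) u - u).norm_coe_le_norm s
  simpa [sub_eq_add_neg] using this

end UniformContinuity

/-! ### Symbols on the line: test functions, two-sided exponentials, the triangle. -/

section OneDim

/-- `G` is the Fourier transform of an integrable function on the line. -/
def FLine (G : ℝ → ℂ) : Prop :=
  ∃ f : ℝ → ℂ, Integrable f ∧ ∀ l, ∫ t, f t * Complex.exp (-(Complex.I * ((t * l : ℝ) : ℂ))) = G l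

/-- Fourier inversion on the line, in the normalisation used here. -/
lemma integral_inverse_line {h : ℝ → ℂ} (hc : Continuous h) (hi : Integrable h)
    (hG : Integrable fun t : ℝ => ∫ l : ℝ, h l * Complex.exp (Complex.I * ((l * t : ℝ) : ℂ)))
    (l : ℝ) :
    ∫ t : ℝ, (((2 * Real.pi : ℝ) : ℂ)⁻¹ *
      ∫ l : ℝ, h l * Complex.exp (Complex.I * ((l * t : ℝ) : ℂ))) *
        Complex.exp (-(Complex.I * ((t * l : ℝ) : ℂ))) = h l := by
  set G : ℝ → ℂ := fun t => ∫ l : ℝ, h l * Complex.exp (Complex.I * ((l * t : ℝ) : ℂ)) with hGdef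
  change ∫ t : ℝ, (((2 * Real.pi : ℝ) : ℂ)⁻¹ * G t) *
    Complex.exp (-(Complex.I * ((t * l : ℝ) : ℂ))) = h l
  have hF : ∀ w, FourierTransform.fourier h w = G (-(2 * Real.pi) * w) := by
    intro w
    rw [Real.fourier_real_eq_integral_exp_smul]
    refine integral_congr_ae (Eventually.of_forall fun v => ?_)
    simp only [smul_eq_mul]
    rw [mul_comm]
    congr 2
    push_cast; ring
  have hFi : Integrable (FourierTransform.fourier h) := by
    have : FourierTransform.fourier h = fun w => G (-(2 * Real.pi) * w) := funext hF
    rw [this]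
    exact hG.comp_mul_left' (by simp [Real.pi_ne_zero])
  have hinv := congrFun (hc.fourierInv_fourier_eq hi hFi) l
  rw [Real.fourierInv_eq'] at hinv
  rw [← hinv]
  have h3 := Measure.integral_comp_mul_left (fun t => G t *
    Complex.exp (-(Complex.I * ((t * l : ℝ) : ℂ)))) (-(2 * Real.pi))
  have h4 : ∀ t, (((2 * Real.pi : ℝ) : ℂ)⁻¹ * G t) *
        Complex.exp (-(Complex.I * ((t * l : ℝ) : ℂ))) = ((2 * Real.pi : ℝ) : ℂ)⁻¹ *
        (G t * Complex.exp (-(Complex.I * ((t * l : ℝ) : ℂ)))) := fun t => by ring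
  simp_rw [h4]
  rw [integral_const_mul]
  have h5 : |(-(2 * Real.pi))⁻¹| = (2 * Real.pi)⁻¹ := by
    rw [abs_inv, abs_neg, abs_of_pos (by positivity)]
  rw [h5] at h3
  rw [← Complex.ofReal_inv, ← Complex.real_smul, ← h3]
  refine integral_congr_ae (Eventually.of_forall fun w => ?_)
  simp only [smul_eq_mul]
  rw [hF, mul_comm]
  congr 2
  simp; ring

lemma fLine_of_inverse {h : ℝ → ℂ} (hc : Continuous h) (hi : Integrable h)
    (hG : Integrable fun t : ℝ => ∫ l : ℝ, h l * Complex.exp (Complex.I * ((l * t : ℝ) : ℂ))) :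
    FLine h :=
  ⟨_, hG.const_mul _, integral_inverse_line hc hi hG⟩

lemma fLine_of_contDiff {h : ℝ → ℂ} (hs : HasCompactSupport h) (hd : ContDiff ℝ ∞ h) : FLine h := by
  refine fLine_of_inverse hd.continuous (hd.continuous.integrable_of_hasCompactSupport hs) ?_
  have h1 : Integrable (FourierTransform.fourier h) := by
    have h2 := (FourierTransform.fourier (hs.toSchwartzMap hd)).integrable (μ := volume)
    rwa [SchwartzMap.fourier_coe] at h2
  have h3 := h1.comp_mul_left' (R := -(2 * Real.pi)⁻¹) (by simp [Real.pi_ne_zero])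
  refine h3.congr (Eventually.of_forall fun t => ?_)
  simp only
  rw [Real.fourier_real_eq_integral_exp_smul]
  refine integral_congr_ae (Eventually.of_forall fun v => ?_)
  simp only [smul_eq_mul]
  rw [mul_comm]
  congr 2
  have : (Real.pi : ℂ) ≠ 0 := by exact_mod_cast Real.pi_ne_zero
  push_cast; field_simp

/-- The two-sided exponential `exp(-pλ)` for `λ ≥ 0`, `exp(qλ)` for `λ ≤ 0`. -/
def twoExp (p q : ℝ) (l : ℝ) : ℂ := if 0 ≤ l then Real.exp (-p * l) else Real.exp (q * l)

lemma continuous_twoExp (p q : ℝ) : Continuous (twoExp p q) := by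
  unfold twoExp
  refine Continuous.if_le (by fun_prop) (by fun_prop) (by fun_prop) (by fun_prop) ?_
  rintro l rfl; simp

/-- The transform is `(p + q) / ((p - it)(q + it))`, which decays quadratically. Quotients of the
exponential symbols are built from these functions. -/
lemma fLine_twoExp {p q : ℝ} (hp : 0 < p) (hq : 0 < q) : FLine (twoExp p q) := by
  have hre1 : ∀ t : ℝ, (-p + Complex.I * t : ℂ).re < 0 := fun t => by simpa using hp
  have hre2 : ∀ t : ℝ, 0 < (q + Complex.I * t : ℂ).re := fun t => by simpa using hq
  have hon1 : ∀ t : ℝ, Set.EqOn (fun l : ℝ => Complex.exp ((-p + Complex.I * t) * l))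
      (fun l : ℝ => twoExp p q l * Complex.exp (Complex.I * ((l * t : ℝ) : ℂ))) (Set.Ioi 0) := by
    intro t l hl
    simp only [twoExp, if_pos (le_of_lt (Set.mem_Ioi.1 hl))]
    rw [Complex.ofReal_exp, ← Complex.exp_add]
    congr 1; push_cast; ring
  have hon2 : ∀ t : ℝ, Set.EqOn (fun l : ℝ => Complex.exp ((q + Complex.I * t) * l))
      (fun l : ℝ => twoExp p q l * Complex.exp (Complex.I * ((l * t : ℝ) : ℂ))) (Set.Iic 0) := by
    intro t l hl
    rcases (Set.mem_Iic.1 hl).lt_or_eq with h | rfl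
    · simp only [twoExp, if_neg (not_le.2 h)]
      rw [Complex.ofReal_exp, ← Complex.exp_add]
      congr 1; push_cast; ring
    · simp [twoExp]
  have hI1 : ∀ t : ℝ, IntegrableOn
      (fun l : ℝ => twoExp p q l * Complex.exp (Complex.I * ((l * t : ℝ) : ℂ))) (Set.Ioi 0) :=
    fun t => (integrableOn_exp_mul_complex_Ioi (hre1 t) 0).congr_fun (hon1 t) measurableSet_Ioi
  have hI2 : ∀ t : ℝ, IntegrableOn
      (fun l : ℝ => twoExp p q l * Complex.exp (Complex.I * ((l * t : ℝ) : ℂ))) (Set.Iic 0) :=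
    fun t => (integrableOn_exp_mul_complex_Iic (hre2 t) 0).congr_fun (hon2 t) measurableSet_Iic
  have hval : ∀ t : ℝ, ∫ l : ℝ, twoExp p q l * Complex.exp (Complex.I * ((l * t : ℝ) : ℂ)) =
      (p + q) / ((p - Complex.I * t) * (q + Complex.I * t)) := by
    intro t
    rw [← intervalIntegral.integral_Iic_add_Ioi (hI2 t) (hI1 t),
      ← setIntegral_congr_fun measurableSet_Ioi (hon1 t),
      ← setIntegral_congr_fun measurableSet_Iic (hon2 t), integral_exp_mul_complex_Ioi (hre1 t),
      integral_exp_mul_complex_Iic (hre2 t)]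
    have n1 : (p - Complex.I * t : ℂ) ≠ 0 := fun h => by
      have := congrArg Complex.re h; simp at this; exact hp.ne' this
    have n2 : (q + Complex.I * t : ℂ) ≠ 0 := fun h => by
      have := congrArg Complex.re h; simp at this; exact hq.ne' this
    have n3 : (-p + Complex.I * t : ℂ) ≠ 0 := fun h => by
      have := congrArg Complex.re h; simp at this; exact hp.ne' this
    simp only [Complex.ofReal_zero, mul_zero, Complex.exp_zero]
    field_simp
    ring
  refine fLine_of_inverse (continuous_twoExp p q) ?_ ?_
  · have h := (hI2 0).union (hI1 0)
    rw [Set.Iic_union_Ioi, integrableOn_univ] at h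
    simpa using h
  · simp_rw [hval]
    -- Both factors of the denominator have modulus at least `√(m² + t²)`.
    set m := min p q with hm
    have hm0 : 0 < m := lt_min hp hq
    have hi : Integrable fun t : ℝ => (p + q) / m ^ 2 * (1 + (t / m) ^ 2)⁻¹ :=
      (integrable_inv_one_add_sq.comp_div hm0.ne').const_mul _
    refine Integrable.mono' hi ?_ (Eventually.of_forall fun t => ?_)
    · refine Measurable.aestronglyMeasurable ?_
      fun_prop
    · have e1 : m ^ 2 + t ^ 2 ≤ ‖(p - Complex.I * t : ℂ)‖ ^ 2 := by
        rw [← Complex.normSq_eq_norm_sq, Complex.normSq_apply]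
        simp
        nlinarith [min_le_left p q]
      have e2 : m ^ 2 + t ^ 2 ≤ ‖(q + Complex.I * t : ℂ)‖ ^ 2 := by
        rw [← Complex.normSq_eq_norm_sq, Complex.normSq_apply]
        simp
        nlinarith [min_le_right p q]
      have e0 : 0 < m ^ 2 + t ^ 2 := by positivity
      have e3 : m ^ 2 + t ^ 2 ≤ ‖(p - Complex.I * t : ℂ)‖ * ‖(q + Complex.I * t : ℂ)‖ := by
        refine abs_le_of_sq_le_sq' ?_ (by positivity) |>.2
        rw [mul_pow]
        nlinarith
      rw [norm_div, norm_mul]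
      have e4 : ‖(p + q : ℂ)‖ = p + q := by
        rw [← Complex.ofReal_add, Complex.norm_real, Real.norm_of_nonneg (by positivity)]
      have e5 : (p + q) / m ^ 2 * (1 + (t / m) ^ 2)⁻¹ = (p + q) / (m ^ 2 + t ^ 2) := by
        field_simp
      rw [e4, e5]
      gcongr

lemma continuous_triangle : Continuous triangle := by unfold triangle; fun_prop

lemma triangle_eq_zero {l : ℝ} (h : 1 ≤ |l|) : triangle l = 0 := by
  rw [triangle, max_eq_right]; linarith

lemma triangle_eq {l : ℝ} (h : |l| ≤ 1) : triangle l = 1 - |l| := by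
  rw [triangle, max_eq_left]; linarith

lemma hasCompactSupport_triangle : HasCompactSupport fun l => (triangle l : ℂ) := by
  refine HasCompactSupport.intro (isCompact_Icc (a := (-1 : ℝ)) (b := 1)) fun l hl => ?_
  rw [triangle_eq_zero, Complex.ofReal_zero]
  by_contra h
  exact hl (abs_le.1 (not_le.1 h).le)

lemma integral_triangle_exp (t : ℝ) (ht : t ≠ 0) :
    ∫ l : ℝ, (triangle l : ℂ) * Complex.exp (Complex.I * ((l * t : ℝ) : ℂ)) =
      (Complex.exp (Complex.I * t) + Complex.exp (-(Complex.I * t)) - 2) / (Complex.I * t) ^ 2 := by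
  have hc : Continuous fun l : ℝ => (triangle l : ℂ) * Complex.exp (Complex.I * ((l * t : ℝ) : ℂ)) := by
    have := continuous_triangle; fun_prop
  have hit : (Complex.I * t : ℂ) ≠ 0 := by simp [ht]
  have htc : (t : ℂ) ≠ 0 := by exact_mod_cast ht
  have h1 : ∫ l : ℝ, (triangle l : ℂ) * Complex.exp (Complex.I * ((l * t : ℝ) : ℂ)) =
      ∫ l in (-1 : ℝ)..1, (triangle l : ℂ) * Complex.exp (Complex.I * ((l * t : ℝ) : ℂ)) := by
    rw [intervalIntegral.integral_of_le (by norm_num), setIntegral_eq_integral_of_forall_compl_eq_zero]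
    intro l hl
    rw [triangle_eq_zero, Complex.ofReal_zero, zero_mul]
    by_contra h
    have := abs_lt.1 (not_le.1 h)
    exact hl ⟨this.1, this.2.le⟩
  rw [h1, ← intervalIntegral.integral_add_adjacent_intervals (b := 0) (hc.intervalIntegrable _ _)
    (hc.intervalIntegrable _ _)]
  have hexp : ∀ l : ℝ, HasDerivAt (fun l : ℝ => Complex.exp (Complex.I * ((l * t : ℝ) : ℂ)))
      (Complex.exp (Complex.I * ((l * t : ℝ) : ℂ)) * (Complex.I * t)) l := by
    intro l
    have : HasDerivAt (fun l : ℝ => Complex.I * ((l * t : ℝ) : ℂ)) (Complex.I * t) l := by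
      have h := ((hasDerivAt_id l).mul_const t).ofReal_comp.const_mul Complex.I
      simpa using h
    exact this.cexp
  have hid : ∀ l : ℝ, HasDerivAt (fun l : ℝ => (l : ℂ)) 1 l := fun l => by
    simpa using (hasDerivAt_id l).ofReal_comp
  have a1 : ∫ l in (-1 : ℝ)..0, (triangle l : ℂ) * Complex.exp (Complex.I * ((l * t : ℝ) : ℂ)) =
      1 / (Complex.I * t) - 1 / (Complex.I * t) ^ 2
        + Complex.exp (-(Complex.I * t)) / (Complex.I * t) ^ 2 := by
    have : ∀ l ∈ Set.uIcc (-1 : ℝ) 0, HasDerivAt (fun l : ℝ =>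
        (1 + (l : ℂ)) * Complex.exp (Complex.I * ((l * t : ℝ) : ℂ)) / (Complex.I * t)
          - Complex.exp (Complex.I * ((l * t : ℝ) : ℂ)) / (Complex.I * t) ^ 2)
        ((triangle l : ℂ) * Complex.exp (Complex.I * ((l * t : ℝ) : ℂ))) l := by
      intro l hl
      rw [Set.uIcc_of_le (by norm_num)] at hl
      have e : (triangle l : ℂ) = 1 + l := by
        rw [triangle_eq (abs_le.2 ⟨hl.1, hl.2.trans zero_le_one⟩), abs_of_nonpos hl.2]
        push_cast; ring
      convert! ((((hid l).const_add 1).mul (hexp l)).div_const (Complex.I * t)).sub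
        ((hexp l).div_const ((Complex.I * t) ^ 2)) using 1
      rw [e]; field_simp; ring
    rw [intervalIntegral.integral_eq_sub_of_hasDerivAt this (hc.intervalIntegrable _ _)]
    simp
  have a2 : ∫ l in (0 : ℝ)..1, (triangle l : ℂ) * Complex.exp (Complex.I * ((l * t : ℝ) : ℂ)) =
      Complex.exp (Complex.I * t) / (Complex.I * t) ^ 2 - 1 / (Complex.I * t)
        - 1 / (Complex.I * t) ^ 2 := by
    have : ∀ l ∈ Set.uIcc (0 : ℝ) 1, HasDerivAt (fun l : ℝ =>
        (1 - (l : ℂ)) * Complex.exp (Complex.I * ((l * t : ℝ) : ℂ)) / (Complex.I * t)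
          + Complex.exp (Complex.I * ((l * t : ℝ) : ℂ)) / (Complex.I * t) ^ 2)
        ((triangle l : ℂ) * Complex.exp (Complex.I * ((l * t : ℝ) : ℂ))) l := by
      intro l hl
      rw [Set.uIcc_of_le (by norm_num)] at hl
      have e : (triangle l : ℂ) = 1 - l := by
        rw [triangle_eq (abs_le.2 ⟨by linarith [hl.1], hl.2⟩), abs_of_nonneg hl.1]
        push_cast; ring
      convert! ((((hid l).const_sub 1).mul (hexp l)).div_const (Complex.I * t)).add
        ((hexp l).div_const ((Complex.I * t) ^ 2)) using 1
      rw [e]; field_simp; ring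
    rw [intervalIntegral.integral_eq_sub_of_hasDerivAt this (hc.intervalIntegrable _ _)]
    simp; ring
  rw [a1, a2]; field_simp; ring

lemma integrable_triangle : Integrable fun l => (triangle l : ℂ) :=
  (Complex.continuous_ofReal.comp continuous_triangle).integrable_of_hasCompactSupport
    hasCompactSupport_triangle

lemma integrable_integral_triangle_exp : Integrable fun t : ℝ =>
    ∫ l : ℝ, (triangle l : ℂ) * Complex.exp (Complex.I * ((l * t : ℝ) : ℂ)) := by
  set C := ∫ l : ℝ, ‖(triangle l : ℂ)‖ with hC
  have hC0 : 0 ≤ C := integral_nonneg fun _ => norm_nonneg _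
  -- For `|t| ≤ 1` the bound `C` and `1 + t² ≤ 2` give `2C`; for `|t| > 1` the bound `4 / t²` and `1
  -- + t² ≤ 2t²` give `8`.
  refine Integrable.mono' (integrable_inv_one_add_sq.const_mul (2 * C + 8)) ?_
    (Eventually.of_forall fun t => ?_)
  · refine Continuous.aestronglyMeasurable ?_
    refine continuous_of_dominated (bound := fun l => ‖(triangle l : ℂ)‖) (fun t => ?_)
      (fun t => ?_) integrable_triangle.norm ?_
    · have := continuous_triangle
      exact Continuous.aestronglyMeasurable (by fun_prop)
    · refine Eventually.of_forall fun l => ?_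
      rw [norm_mul, mul_comm Complex.I, Complex.norm_exp_ofReal_mul_I, mul_one]
    · exact Eventually.of_forall fun l => by fun_prop
  · rw [← div_eq_mul_inv, le_div_iff₀ (by positivity)]
    rcases le_or_gt |t| 1 with h | h
    · have h1 : ‖∫ l : ℝ, (triangle l : ℂ) * Complex.exp (Complex.I * ((l * t : ℝ) : ℂ))‖ ≤ C := by
        refine norm_integral_le_of_norm_le integrable_triangle.norm (Eventually.of_forall fun l => ?_)
        rw [norm_mul, mul_comm Complex.I, Complex.norm_exp_ofReal_mul_I, mul_one]
      have h2 : t ^ 2 ≤ 1 := by rw [← sq_abs]; nlinarith [abs_nonneg t]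
      nlinarith [norm_nonneg (∫ l : ℝ, (triangle l : ℂ) * Complex.exp (Complex.I * ((l * t : ℝ) : ℂ)))]
    · have ht : t ≠ 0 := by rintro rfl; simp at h; linarith
      rw [integral_triangle_exp t ht, norm_div]
      have h1 : ‖Complex.exp (Complex.I * t) + Complex.exp (-(Complex.I * t)) - 2‖ ≤ 4 := by
        refine (norm_sub_le _ _).trans ?_
        have e1 : ‖Complex.exp (Complex.I * t)‖ = 1 := by
          rw [mul_comm, Complex.norm_exp_ofReal_mul_I]
        have e2 : ‖Complex.exp (-(Complex.I * t))‖ = 1 := by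
          have := Complex.norm_exp_ofReal_mul_I (-t)
          rw [← this]; congr 2; push_cast; ring
        have := norm_add_le (Complex.exp (Complex.I * t)) (Complex.exp (-(Complex.I * t)))
        rw [e1, e2] at this
        have e3 : ‖(2 : ℂ)‖ = 2 := by simp
        rw [e3]; linarith
      have h2 : ‖(Complex.I * t : ℂ) ^ 2‖ = t ^ 2 := by
        rw [norm_pow, norm_mul, Complex.norm_I, one_mul, Complex.norm_real, Real.norm_eq_abs, sq_abs]
      rw [h2, div_mul_eq_mul_div, div_le_iff₀ (by positivity)]
      have h3 : 1 ≤ t ^ 2 := by rw [← sq_abs]; nlinarith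
      nlinarith

lemma integrable_phi : Integrable phi := integrable_integral_triangle_exp.const_mul _

lemma fourier_phi (l : ℝ) :
    ∫ t : ℝ, phi t * Complex.exp (-(Complex.I * ((t * l : ℝ) : ℂ))) = triangle l :=
  integral_inverse_line (Complex.continuous_ofReal.comp continuous_triangle) integrable_triangle
    integrable_integral_triangle_exp l

end OneDim

/-! ### Tensor products and the symbol of `φ_a`. -/

section Tensor

lemma fl1_prod {G : Fin d → ℝ → ℂ} (h : ∀ k, FLine (G k)) : FL1 fun l => ∏ k, G k (l k) := by
  choose f hf hf' using h
  refine ⟨fun t => ∏ k, f k (t k), Integrable.fintype_prod hf, fun l => ?_⟩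
  rw [fourierT_eq]
  have : ∀ t : Fin d → ℝ, (∏ k, f k (t k)) * chr (-l) t =
      ∏ k, (f k (t k) * Complex.exp (-(Complex.I * ((t k * l k : ℝ) : ℂ)))) := by
    intro t
    rw [Finset.prod_mul_distrib, ← Complex.exp_sum, chr]
    congr 2
    push_cast
    rw [Finset.mul_sum]
    refine Finset.sum_congr rfl fun k _ => ?_
    simp; ring
  simp_rw [this]
  rw [integral_fintype_prod_volume_eq_prod
    (fun k t => f k t * Complex.exp (-(Complex.I * ((t * l k : ℝ) : ℂ))))]
  exact Finset.prod_congr rfl fun k _ => hf' k (l k)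

/-- The symbol of `φ_0`. -/
def tri (l : Fin d → ℝ) : ℂ := ∏ k, (triangle (l k) : ℂ)

lemma phiD_eq (a : Fin d → ℝ) : phiD a = fun s => chr a s * ∏ k, phi (s k) := by
  ext s; rw [phiD, chr, mul_comm]

lemma integrable_prod_phi : Integrable fun s : Fin d → ℝ => ∏ k, phi (s k) :=
  Integrable.fintype_prod fun _ => integrable_phi

lemma integrable_phiD (a : Fin d → ℝ) : Integrable (phiD a) := by
  rw [phiD_eq]
  exact integrable_prod_phi.bdd_mul (c := 1) (by fun_prop) (Eventually.of_forall fun t => by simp)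

lemma fourierT_prod_phi (l : Fin d → ℝ) : fourierT (fun s => ∏ k, phi (s k)) l = tri l := by
  rw [fourierT_eq]
  have : ∀ t : Fin d → ℝ, (∏ k, phi (t k)) * chr (-l) t =
      ∏ k, (phi (t k) * Complex.exp (-(Complex.I * ((t k * l k : ℝ) : ℂ)))) := by
    intro t
    rw [Finset.prod_mul_distrib, ← Complex.exp_sum, chr]
    congr 2
    push_cast
    rw [Finset.mul_sum]
    refine Finset.sum_congr rfl fun k _ => ?_
    simp; ring
  simp_rw [this]
  rw [integral_fintype_prod_volume_eq_prod
    (fun k t => phi t * Complex.exp (-(Complex.I * ((t * l k : ℝ) : ℂ))))]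
  exact Finset.prod_congr rfl fun k _ => fourier_phi (l k)

lemma fourierT_phiD (a l : Fin d → ℝ) : fourierT (phiD a) l = tri (l - a) := by
  rw [phiD_eq, fourierT_chr_mul, fourierT_prod_phi]

lemma fl1_tri : FL1 (tri : (Fin d → ℝ) → ℂ) := ⟨_, integrable_prod_phi, fourierT_prod_phi⟩

lemma coeffNorm_eq (a : Fin d → ℝ) (u : (Fin d → ℝ) →ᵇ B) :
    coeffNorm a u = ‖mult (fun l => tri (l - a)) u‖ₑ := by
  have h : ∀ s, mult (fun l => tri (l - a)) u s = conv (phiD a) u s := fun s => by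
    rw [← mult_fourierT (integrable_phiD a), funext (fourierT_phiD a)]
  simp only [coeffNorm, ← h]
  set v := mult (fun l => tri (l - a)) u
  refine le_antisymm (iSup_le fun s => ?_) ?_
  · exact enorm_le_iff_norm_le.2 (v.norm_coe_le_norm s)
  · by_cases htop : (⨆ s, ‖v s‖ₑ) = ⊤
    · rw [htop]; exact le_top
    · rw [← ofReal_norm, ENNReal.ofReal_le_iff_le_toReal htop]
      refine (BoundedContinuousFunction.norm_le ENNReal.toReal_nonneg).2 fun s => ?_
      rw [← toReal_enorm]
      exact ENNReal.toReal_mono htop (le_iSup (fun s => ‖v s‖ₑ) s)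

end Tensor

/-! ### Smooth cut-off symbols. -/

section Plateau

/-- A smooth bump function on the line, equal to one on `[-R, R]`. -/
def bumpLine (R : ℝ) : ContDiffBump (0 : ℝ) where
  rIn := max R 0 + 1
  rOut := max R 0 + 2
  rIn_pos := by positivity
  rIn_lt_rOut := by linarith

/-- A smooth compactly supported function equal to one on a neighbourhood of `[-R, R]^d`. -/
def plat (R : ℝ) (l : Fin d → ℝ) : ℂ := ∏ k, (bumpLine R (l k) : ℂ)

lemma plat_eq_one {R : ℝ} {l : Fin d → ℝ} (h : ∀ k, |l k| ≤ R + 1) : plat R l = 1 := by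
  refine Finset.prod_eq_one fun k _ => ?_
  rw [(bumpLine R).one_of_mem_closedBall, Complex.ofReal_one]
  rw [mem_closedBall_zero_iff, Real.norm_eq_abs]
  exact (h k).trans (by simp [bumpLine])

lemma plat_eq_zero {R : ℝ} {l : Fin d → ℝ} {k : Fin d} (h : max R 0 + 2 ≤ |l k|) :
    plat R l = 0 := by
  refine Finset.prod_eq_zero (Finset.mem_univ k) ?_
  rw [(bumpLine R).zero_of_le_dist, Complex.ofReal_zero]
  simpa [bumpLine] using h

lemma hasCompactSupport_plat (R : ℝ) : HasCompactSupport (plat R : (Fin d → ℝ) → ℂ) := by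
  refine HasCompactSupport.intro (isCompact_univ_pi fun _ : Fin d =>
    isCompact_Icc (a := -(max R 0 + 2)) (b := max R 0 + 2)) fun l hl => ?_
  simp only [Set.mem_univ_pi, not_forall] at hl
  obtain ⟨k, hk⟩ := hl
  refine plat_eq_zero (k := k) ?_
  by_contra h
  exact hk (abs_le.1 (not_le.1 h).le)

/-- The cut-off is itself a product, so the symbol is a tensor product of test functions on the
line. -/
lemma fl1_smooth_mul_plat (R : ℝ) {g : Fin d → ℝ → ℂ} (hg : ∀ k, ContDiff ℝ ∞ (g k)) :
    FL1 fun l => (∏ k, g k (l k)) * plat R l := by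
  simp only [plat, ← Finset.prod_mul_distrib]
  refine fl1_prod (G := fun k l => g k l * (bumpLine R l : ℂ)) fun k => fLine_of_contDiff ?_ ?_
  · exact HasCompactSupport.mul_left
      ((bumpLine R).hasCompactSupport.comp_left (g := Complex.ofReal) Complex.ofReal_zero)
  · exact (hg k).mul (Complex.ofRealCLM.contDiff.comp (bumpLine R).contDiff)

lemma fl1_plat (R : ℝ) : FL1 (plat R : (Fin d → ℝ) → ℂ) := by
  simpa using fl1_smooth_mul_plat (d := d) R (g := fun _ _ => 1) fun _ => contDiff_const

lemma expFun_eq (α l : Fin d → ℝ) : expFun α l = ∏ k, (Real.exp (α k * l k) : ℂ) := by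
  rw [expFun, Real.exp_sum, Complex.ofReal_prod]

lemma fl1_expFun_mul_plat (R : ℝ) (α : Fin d → ℝ) :
    FL1 (expFun α * plat R : (Fin d → ℝ) → ℂ) := by
  have := fl1_smooth_mul_plat (d := d) R (g := fun k t => (Real.exp (α k * t) : ℂ)) fun k =>
    Complex.ofRealCLM.contDiff.comp (Real.contDiff_exp.comp (contDiff_const.mul contDiff_id))
  simp only [← expFun_eq] at this
  exact this

/-- The quotient of a plateau function by the standard Gaussian. -/
def platDivGauss (R : ℝ) (l : Fin d → ℝ) : ℂ :=
  (∏ k, (Real.exp (1 / 2 * l k ^ 2) : ℂ)) * plat R l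

lemma fl1_platDivGauss (R : ℝ) : FL1 (platDivGauss R : (Fin d → ℝ) → ℂ) :=
  fl1_smooth_mul_plat (d := d) R (g := fun _ t => (Real.exp (1 / 2 * t ^ 2) : ℂ)) fun _ =>
    Complex.ofRealCLM.contDiff.comp
      (Real.contDiff_exp.comp (contDiff_const.mul (contDiff_id.pow 2)))

end Plateau

/-! ### The entire family of multipliers `exp(z α·l - |l|²/2)`. -/

section GaussianSymbol

lemma gaussian_eq (α : Fin d → ℝ) (z : ℂ) (t : Fin d → ℝ) :
    gaussian α z t = Complex.exp (z * (Complex.I * (∑ k, α k * t k : ℝ))) * gauss0 t := by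
  rw [gaussian, gauss0, ← Complex.exp_add, add_comm]
  congr 2
  push_cast
  rw [Finset.mul_sum, Finset.mul_sum]
  exact Finset.sum_congr rfl fun k _ => by ring

@[fun_prop] lemma continuous_gauss0 : Continuous (gauss0 : (Fin d → ℝ) → ℂ) := by
  unfold gauss0; fun_prop

/-- `exp(C|a|) ≤ exp(Ca) + exp(-Ca)`, and each summand times the Gaussian is the modulus of
`gaussian α z` at an imaginary `z`. -/
lemma integrable_exp_mul_gauss0 (α : Fin d → ℝ) (C : ℝ) :
    Integrable fun t : Fin d → ℝ => Real.exp (C * |∑ k, α k * t k|) * ‖gauss0 t‖ := by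
  refine Integrable.mono' ((integrable_gaussian α (-(C * Complex.I))).norm.add
    (integrable_gaussian α (C * Complex.I)).norm) ?_ (Eventually.of_forall fun t => ?_)
  · exact Continuous.aestronglyMeasurable (by fun_prop)
  · have h1 : ∀ c : ℝ, ‖gaussian α (c * Complex.I) t‖ =
        Real.exp (-(c * ∑ k, α k * t k)) * ‖gauss0 t‖ := by
      intro c
      rw [gaussian_eq, norm_mul, Complex.norm_exp]
      congr 2
      have : (c : ℂ) * Complex.I * (Complex.I * (∑ k, α k * t k : ℝ)) =
          ((-(c * ∑ k, α k * t k) : ℝ) : ℂ) := by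
        push_cast
        linear_combination (c : ℂ) * (∑ k, (α k : ℂ) * t k) * Complex.I_mul_I
      rw [this, Complex.ofReal_re]
    have h2 := h1 (-C)
    rw [Complex.ofReal_neg, neg_mul, neg_mul, neg_neg] at h2
    rw [Pi.add_apply, h2, h1, ← add_mul, norm_mul, norm_norm, Real.norm_of_nonneg (by positivity)]
    refine mul_le_mul_of_nonneg_right ?_ (norm_nonneg _)
    rcases abs_choice (∑ k, α k * t k) with h | h <;> rw [h]
    · linarith [Real.exp_pos (-(C * ∑ k, α k * t k))]
    · rw [mul_neg]; linarith [Real.exp_pos (C * ∑ k, α k * t k)]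

lemma norm_exp_sub_one_sub_id_le' (x : ℂ) :
    ‖Complex.exp x - 1 - x‖ ≤ ‖x‖ ^ 2 * Real.exp ‖x‖ := by
  have := Complex.norm_exp_sub_sum_le_norm_mul_exp x 2
  simpa [Finset.sum_range_succ, sub_sub] using this

lemma sq_le_two_mul_exp {x : ℝ} (hx : 0 ≤ x) : x ^ 2 ≤ 2 * Real.exp x := by
  have := Real.quadratic_le_exp_of_nonneg hx
  linarith

lemma norm_gaussian_le (α : Fin d → ℝ) (z : ℂ) (t : Fin d → ℝ) :
    ‖gaussian α z t‖ ≤ Real.exp (‖z‖ * |∑ k, α k * t k|) * ‖gauss0 t‖ := by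
  rw [gaussian_eq, norm_mul]
  refine mul_le_mul_of_nonneg_right ?_ (norm_nonneg _)
  refine (Complex.norm_exp_le_exp_norm _).trans (Real.exp_le_exp.2 ?_)
  rw [norm_mul, norm_mul, Complex.norm_I, one_mul, Complex.norm_real, Real.norm_eq_abs]

/-- The derivative in `z` of the kernel `gaussian α z`. -/
def gaussianDeriv (α : Fin d → ℝ) (z : ℂ) (t : Fin d → ℝ) : ℂ :=
  Complex.I * (∑ k, α k * t k : ℝ) * gaussian α z t

lemma integrable_gaussianDeriv (α : Fin d → ℝ) (z : ℂ) : Integrable (gaussianDeriv α z) := by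
  refine Integrable.mono' (integrable_exp_mul_gauss0 α (1 + ‖z‖)) ?_
    (Eventually.of_forall fun t => ?_)
  · refine Continuous.aestronglyMeasurable ?_
    unfold gaussianDeriv gaussian; fun_prop
  · rw [gaussianDeriv, norm_mul, norm_mul, Complex.norm_I, one_mul, Complex.norm_real,
      Real.norm_eq_abs, add_mul, one_mul, Real.exp_add, mul_assoc]
    exact mul_le_mul (by linarith [Real.add_one_le_exp |∑ k, α k * t k|]) (norm_gaussian_le α z t)
      (norm_nonneg _) (by positivity)

lemma norm_gaussian_taylor_le (α : Fin d → ℝ) (z h : ℂ) (hh : ‖h‖ ≤ 1) (t : Fin d → ℝ) :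
    ‖gaussian α (z + h) t - gaussian α z t - h * gaussianDeriv α z t‖ ≤
      ‖h‖ ^ 2 * (2 * (Real.exp ((2 + ‖z‖) * |∑ k, α k * t k|) * ‖gauss0 t‖)) := by
  set a : ℝ := ∑ k, α k * t k with ha
  have e : gaussian α (z + h) t - gaussian α z t - h * gaussianDeriv α z t =
      (Complex.exp (h * (Complex.I * a)) - 1 - h * (Complex.I * a)) * gaussian α z t := by
    rw [gaussianDeriv, gaussian_eq, gaussian_eq, ← ha, add_mul, Complex.exp_add]; ring
  have hn : ‖h * (Complex.I * a)‖ = ‖h‖ * |a| := by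
    rw [norm_mul, norm_mul, Complex.norm_I, one_mul, Complex.norm_real, Real.norm_eq_abs]
  rw [e, norm_mul]
  have h1 := norm_exp_sub_one_sub_id_le' (h * (Complex.I * a))
  rw [hn] at h1
  have h2 : ‖h‖ * |a| ≤ |a| := mul_le_of_le_one_left (abs_nonneg _) hh
  have h3 : (‖h‖ * |a|) ^ 2 * Real.exp (‖h‖ * |a|) ≤ ‖h‖ ^ 2 * (2 * Real.exp (2 * |a|)) := by
    rw [mul_pow, mul_assoc]
    refine mul_le_mul_of_nonneg_left ?_ (by positivity)
    rw [two_mul |a|, Real.exp_add, ← mul_assoc]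
    exact mul_le_mul (sq_le_two_mul_exp (abs_nonneg a)) (Real.exp_le_exp.2 h2) (by positivity)
      (by positivity)
  refine (mul_le_mul (h1.trans h3) (norm_gaussian_le α z t) (norm_nonneg _)
    (by positivity)).trans_eq ?_
  rw [add_mul, Real.exp_add]; ring

lemma differentiable_smul_fun {F : Type*} [NormedAddCommGroup F] [NormedSpace ℂ F] {c : ℂ → ℂ}
    {f : ℂ → F} (hc : Differentiable ℂ c) (hf : Differentiable ℂ f) :
    Differentiable ℂ fun z => c z • f z := hc.smul hf

lemma differentiable_one_sub {F : Type*} [NormedAddCommGroup F] [NormedSpace ℂ F]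
    {f : ℂ → F} (hf : Differentiable ℂ f) : Differentiable ℂ fun z => f (1 - z) :=
  hf.comp (differentiable_id.const_sub 1)

lemma hasDerivAt_of_norm_sub_le {F : Type*} [NormedAddCommGroup F] [NormedSpace ℂ F] {f : ℂ → F}
    {f' : F} {z : ℂ} (C : ℝ)
    (hf : ∀ h : ℂ, ‖h‖ ≤ 1 → ‖f (z + h) - f z - h • f'‖ ≤ C * ‖h‖ ^ 2) : HasDerivAt f f' z := by
  rw [hasDerivAt_iff_isLittleO_nhds_zero]
  have hO : (fun h : ℂ => f (z + h) - f z - h • f') =O[𝓝 0] fun h => h ^ 2 := by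
    refine Asymptotics.IsBigO.of_bound C ?_
    filter_upwards [Metric.closedBall_mem_nhds (0 : ℂ) one_pos] with h hh
    rw [norm_pow]
    exact hf h (mem_closedBall_zero_iff.1 hh)
  refine hO.trans_isLittleO ?_
  simpa using (Asymptotics.isLittleO_pow_pow (𝕜 := ℂ) (m := 1) (n := 2) (by norm_num))

/-- The operator norm is at most the `L¹` norm of the kernel, so an integrable bound for the
second-order Taylor remainder of the kernel suffices. -/
lemma hasDerivAt_cv_gaussian (α : Fin d → ℝ) (z : ℂ) :
    HasDerivAt (fun z => (cv (gaussian α z) : ((Fin d → ℝ) →ᵇ B) →L[ℂ] _))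
      (cv (gaussianDeriv α z)) z := by
  refine hasDerivAt_of_norm_sub_le (F := ((Fin d → ℝ) →ᵇ B) →L[ℂ] ((Fin d → ℝ) →ᵇ B))
    (∫ t : Fin d → ℝ, 2 * (Real.exp ((2 + ‖z‖) * |∑ k, α k * t k|) * ‖gauss0 t‖)) fun h hh => ?_
  have i1 := integrable_gaussian α (z + h)
  have i2 := integrable_gaussian α z
  have i3 := integrable_gaussianDeriv α z
  have e : (cv (gaussian α (z + h)) : ((Fin d → ℝ) →ᵇ B) →L[ℂ] _) -
    cv (gaussian α z) - h • cv (gaussianDeriv α z) =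
      cv (fun t => gaussian α (z + h) t - gaussian α z t - h * gaussianDeriv α z t) := by
    rw [cv_sub (f := fun t => gaussian α (z + h) t - gaussian α z t) (i1.sub i2)
      (i3.const_mul h), cv_sub i1 i2, cv_smul h i3]
  refine (congrArg norm e).trans_le ?_
  refine (norm_cv_le ((i1.sub i2).sub (i3.const_mul h))).trans ?_
  rw [mul_comm, ← integral_const_mul]
  refine integral_mono ((i1.sub i2).sub (i3.const_mul h)).norm
    (((integrable_exp_mul_gauss0 α (2 + ‖z‖)).const_mul 2).const_mul _) fun t => ?_
  exact norm_gaussian_taylor_le α z h hh t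

/-- The symbol `exp(z α·l - |l|²/2)`. -/
def gsym (α : Fin d → ℝ) (z : ℂ) (l : Fin d → ℝ) : ℂ :=
  Complex.exp (z * (∑ k, α k * l k : ℝ)) * gauss0 l

/-- The factor relating `gsym` and the Fourier transform of `gaussian`. -/
def gsymFactor (α : Fin d → ℝ) (z : ℂ) : ℂ :=
  (gaussianConst d)⁻¹ * Complex.exp ((1 / 2) * z ^ 2 * ∑ k, (α k : ℂ) ^ 2)

lemma fourierT_gsymFactor_mul (α : Fin d → ℝ) (z : ℂ) (l : Fin d → ℝ) :
    fourierT (fun t => gsymFactor α z * gaussian α z t) l = gsym α z l := by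
  rw [fourierT_const_mul, fourierT_gaussian, gsymFactor, gsym, gauss0, ← Complex.exp_add]
  have := gaussianConst_ne_zero d
  rw [mul_mul_mul_comm, inv_mul_cancel₀ this, one_mul, ← Complex.exp_add]
  congr 1; ring

lemma fl1_gsym (α : Fin d → ℝ) (z : ℂ) : FL1 (gsym α z) :=
  ⟨_, (integrable_gaussian α z).const_mul _, fourierT_gsymFactor_mul α z⟩

lemma fl1_gauss0 : FL1 (gauss0 : (Fin d → ℝ) → ℂ) := by
  have : (gauss0 : (Fin d → ℝ) → ℂ) = gsym 0 0 := by ext l; simp [gsym]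
  rw [this]; exact fl1_gsym 0 0

lemma mult_gsym (α : Fin d → ℝ) (z : ℂ) :
    (mult (gsym α z) : ((Fin d → ℝ) →ᵇ B) →L[ℂ] _) = gsymFactor α z • cv (gaussian α z) := by
  rw [← cv_smul _ (integrable_gaussian α z)]
  exact mult_eq ((integrable_gaussian α z).const_mul _) (fourierT_gsymFactor_mul α z)

/-- The Gaussian factor turns `exp(z α·l)`, which is no multiplier on its own in general, into a
family that is entire in operator norm. -/
lemma differentiable_mult_gsym (α : Fin d → ℝ) :
    Differentiable ℂ fun z => (mult (gsym α z) : ((Fin d → ℝ) →ᵇ B) →L[ℂ] _) := by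
  have : (fun z => (mult (gsym α z) : ((Fin d → ℝ) →ᵇ B) →L[ℂ] _)) =
      fun z => gsymFactor α z • cv (gaussian α z) := funext (mult_gsym α)
  rw [this]
  have h1 : Differentiable ℂ (gsymFactor α) := by unfold gsymFactor; fun_prop
  exact differentiable_smul_fun (F := ((Fin d → ℝ) →ᵇ B) →L[ℂ] ((Fin d → ℝ) →ᵇ B)) h1 fun z =>
    HasDerivAt.differentiableAt (F := ((Fin d → ℝ) →ᵇ B) →L[ℂ] ((Fin d → ℝ) →ᵇ B))
      (hasDerivAt_cv_gaussian α z)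

lemma gsym_add_mul_I (α : Fin d → ℝ) (z : ℂ) (τ : ℝ) (l : Fin d → ℝ) :
    gsym α (z + τ * Complex.I) l = chr l (τ • α) * gsym α z l := by
  rw [gsym, gsym, chr, ← mul_assoc, ← Complex.exp_add]
  congr 2
  push_cast
  rw [add_mul, add_comm]
  congr 1
  simp only [Pi.smul_apply, smul_eq_mul, Complex.ofReal_mul, Finset.mul_sum]
  exact Finset.sum_congr rfl fun k _ => by ring

/-- Imaginary increments of `z` multiply the symbol by a character, that is, they translate. This is
the model for the field `cov` of `IsExt`. -/
lemma mult_gsym_add_mul_I (α : Fin d → ℝ) (z : ℂ) (τ : ℝ) (u : (Fin d → ℝ) →ᵇ B) :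
    mult (gsym α (z + τ * Complex.I)) u = trans (τ • α) (mult (gsym α z) u) := by
  rw [← mult_chr_mul (fl1_gsym α z), ← funext (gsym_add_mul_I α z τ)]

lemma gsym_zero (α : Fin d → ℝ) : gsym α 0 = gauss0 := by ext l; simp [gsym]

lemma gsym_one (α : Fin d → ℝ) : gsym α 1 = expFun α * gauss0 := by
  ext l; simp [gsym, expFun]

lemma gauss0_mul_platDivGauss (R : ℝ) :
    (gauss0 * platDivGauss R : (Fin d → ℝ) → ℂ) = plat R := by
  ext l
  have h : (∏ k, (Real.exp (1 / 2 * l k ^ 2) : ℂ)) * gauss0 l = 1 := by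
    rw [← Complex.ofReal_prod, ← Real.exp_sum, gauss0, Complex.ofReal_exp, ← Complex.exp_add]
    convert! Complex.exp_zero using 2
    push_cast
    rw [Finset.mul_sum, ← Finset.sum_add_distrib]
    exact Finset.sum_eq_zero fun k _ => by ring
  simp only [Pi.mul_apply, platDivGauss]
  linear_combination plat R l * h

/-- Dilated plateau functions. -/
def platDil (n : ℕ) (l : Fin d → ℝ) : ℂ := plat 0 (((n : ℝ) + 1)⁻¹ • l)

lemma fl1_platDil (n : ℕ) : FL1 (platDil n : (Fin d → ℝ) → ℂ) :=
  (fl1_plat 0).dil (n := (n : ℝ) + 1) (by positivity)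

lemma plat_zero_zero : plat 0 (0 : Fin d → ℝ) = 1 := plat_eq_one fun k => by simp

lemma platDil_eq_zero {n : ℕ} {l : Fin d → ℝ} {k : Fin d} (h : 2 * ((n : ℝ) + 1) ≤ |l k|) :
    platDil n l = 0 := by
  refine plat_eq_zero (k := k) ?_
  have : 0 < (n : ℝ) + 1 := by positivity
  simp only [max_self, zero_add, Pi.smul_apply, smul_eq_mul, abs_mul, abs_inv, abs_of_pos this]
  rw [inv_mul_eq_div, le_div_iff₀ this]
  exact h

lemma platDil_mul_plat (n : ℕ) :
    (platDil n * plat (2 * ((n : ℝ) + 1)) : (Fin d → ℝ) → ℂ) = platDil n := by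
  ext l
  rw [Pi.mul_apply]
  by_cases h : ∃ k, 2 * ((n : ℝ) + 1) ≤ |l k|
  · obtain ⟨k, hk⟩ := h
    rw [platDil_eq_zero hk, zero_mul]
  · push Not at h
    rw [plat_eq_one fun k => (h k).le.trans (by linarith), mul_one]

lemma eq_of_mult_platDil_eq {u v : (Fin d → ℝ) →ᵇ B}
    (h : ∀ n : ℕ, mult (platDil n) u = mult (platDil n) v) : u = v :=
  eq_of_mult_dil_eq (fl1_plat 0) plat_zero_zero h

/-- The Gaussian has no zeros, so on the bounded support of each `platDil n` it can be divided out
by `platDivGauss`. -/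
lemma mult_gauss0_injective {u v : (Fin d → ℝ) →ᵇ B} (h : mult gauss0 u = mult gauss0 v) :
    u = v := by
  refine eq_of_mult_platDil_eq fun n => ?_
  have key : ∀ u : (Fin d → ℝ) →ᵇ B, mult (platDil n) u =
      mult (platDil n * platDivGauss (2 * ((n : ℝ) + 1))) (mult gauss0 u) := by
    intro u
    rw [← mult_mul ((fl1_platDil n).mul (fl1_platDivGauss _)) fl1_gauss0, mul_assoc,
      mul_comm (platDivGauss _), gauss0_mul_platDivGauss, platDil_mul_plat]
  rw [key, key, h]

end GaussianSymbol

/-! ### Holomorphic extension of translates to a strip. -/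

section Extension

/-- `Φ` extends `τ ↦ trans (τ • α) (Φ 0)` (on the imaginary axis) holomorphically to the strip
`0 ≤ Re z ≤ 1`. -/
structure IsExt (α : Fin d → ℝ) (Φ : ℂ → (Fin d → ℝ) →ᵇ B) : Prop where
  holo : DifferentiableOn ℂ Φ (Complex.re ⁻¹' Set.Ioo 0 1)
  cont : ContinuousOn Φ (Complex.re ⁻¹' Set.Icc 0 1)
  cov : ∀ z ∈ Complex.re ⁻¹' Set.Icc 0 1, ∀ τ : ℝ,
    Φ (z + τ * Complex.I) = trans (τ • α) (Φ z)
  -- Continuity under translation in all directions, not only along `α`, makes the cut-offs of `Φ z`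
  -- converge in norm.
  buc : ∀ z ∈ Complex.re ⁻¹' Set.Icc 0 1, IsBUC (Φ z)

/-- `v` is the boundary value at `Re z = 1` of a holomorphic extension of the translates of `w`
in the direction `α`. -/
def Ext (α : Fin d → ℝ) (w v : (Fin d → ℝ) →ᵇ B) : Prop :=
  ∃ Φ : ℂ → (Fin d → ℝ) →ᵇ B, IsExt α Φ ∧ Φ 0 = w ∧ Φ 1 = v

variable {α : Fin d → ℝ} {Φ Ψ : ℂ → (Fin d → ℝ) →ᵇ B}

lemma zero_mem_strip : (0 : ℂ) ∈ Complex.re ⁻¹' Set.Icc 0 1 := by simp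
lemma one_mem_strip : (1 : ℂ) ∈ Complex.re ⁻¹' Set.Icc 0 1 := by simp

lemma closure_open_strip : closure (Complex.re ⁻¹' Set.Ioo 0 1) = Complex.re ⁻¹' Set.Icc 0 1 := by
  rw [Complex.closure_preimage_re, closure_Ioo (by norm_num)]

lemma isOpen_open_strip : IsOpen (Complex.re ⁻¹' Set.Ioo (0 : ℝ) 1) :=
  isOpen_Ioo.preimage Complex.continuous_re

lemma open_strip_subset : Complex.re ⁻¹' Set.Ioo 0 1 ⊆ Complex.re ⁻¹' Set.Icc (0 : ℝ) 1 :=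
  Set.preimage_mono Set.Ioo_subset_Icc_self

lemma IsExt.eq_trans (h : IsExt α Φ) {z : ℂ} (hz : z ∈ Complex.re ⁻¹' Set.Icc 0 1) :
    Φ z = trans (z.im • α) (Φ z.re) := by
  have := h.cov z.re (by simpa using hz) z.im
  rwa [Complex.re_add_im] at this

/-- Three lines theorem. By covariance `‖Φ z‖` depends only on `Re z`: this gives boundedness on the
strip by compactness of `[0, 1]`, and reduces each boundary line to a single point. -/
lemma IsExt.norm_le (h : IsExt α Φ) {z : ℂ} (hz : z ∈ Complex.re ⁻¹' Set.Icc 0 1) {M : ℝ}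
    (h0 : ‖Φ 0‖ ≤ M) (h1 : ‖Φ 1‖ ≤ M) : ‖Φ z‖ ≤ M := by
  have hn : ∀ z ∈ Complex.re ⁻¹' Set.Icc 0 1, ‖Φ z‖ = ‖Φ z.re‖ := fun z hz => by
    rw [h.eq_trans hz, norm_trans]
  have hbd : BddAbove ((norm ∘ Φ) '' Complex.HadamardThreeLines.verticalClosedStrip 0 1) := by
    have hc : ContinuousOn (fun x : ℝ => ‖Φ x‖) (Set.Icc 0 1) :=
      (h.cont.comp Complex.continuous_ofReal.continuousOn fun x hx => by simpa using hx).norm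
    obtain ⟨C, hC⟩ := isCompact_Icc.bddAbove_image hc
    refine ⟨C, ?_⟩
    rintro _ ⟨z, hz, rfl⟩
    have hz' : z.re ∈ Set.Icc (0 : ℝ) 1 := hz
    exact (hn z hz).trans_le (hC ⟨z.re, hz', rfl⟩)
  -- A strictly positive bound is needed to combine the two real powers, and `M` may be zero.
  refine le_of_forall_pos_le_add fun ε hε => ?_
  have hM : 0 < M + ε := add_pos_of_nonneg_of_pos ((norm_nonneg _).trans h0) hε
  have hd : DiffContOnCl ℂ Φ (Complex.HadamardThreeLines.verticalStrip 0 1) :=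
    ⟨h.holo, by
      have := h.cont
      rwa [← closure_open_strip] at this⟩
  have := Complex.HadamardThreeLines.norm_le_interp_of_mem_verticalClosedStrip₀₁' Φ hz hd hbd
    (a := M + ε) (b := M + ε) ?_ ?_
  · rwa [← Real.rpow_add hM, sub_add_cancel, Real.rpow_one] at this
  · intro w hw
    have hw' : w.re = 0 := hw
    rw [hn w (by simp [hw']), hw', Complex.ofReal_zero]; linarith
  · intro w hw
    have hw' : w.re = 1 := hw
    rw [hn w (by simp [hw']), hw', Complex.ofReal_one]; linarith

lemma IsExt.mul (h : IsExt α Φ) (h' : IsExt α Ψ) : IsExt α fun z => Φ z * Ψ z where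
  holo := h.holo.mul h'.holo
  cont := h.cont.mul h'.cont
  cov z hz τ := by rw [h.cov z hz, h'.cov z hz, trans_mul]
  buc z hz := (h.buc z hz).mul (h'.buc z hz)

lemma IsExt.add (h : IsExt α Φ) (h' : IsExt α Ψ) : IsExt α fun z => Φ z + Ψ z where
  holo := h.holo.add h'.holo
  cont := h.cont.add h'.cont
  cov z hz τ := by rw [h.cov z hz, h'.cov z hz, map_add]
  buc z hz := (h.buc z hz).add (h'.buc z hz)

lemma IsExt.clm (h : IsExt α Φ) (T : ((Fin d → ℝ) →ᵇ B) →L[ℂ] ((Fin d → ℝ) →ᵇ B))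
    (hT : ∀ t u, T (trans t u) = trans t (T u)) : IsExt α fun z => T (Φ z) where
  holo := T.differentiable.comp_differentiableOn h.holo
  cont := T.continuous.comp_continuousOn h.cont
  cov z hz τ := by rw [h.cov z hz, hT]
  buc z hz := by
    unfold IsBUC
    simp_rw [← hT]
    exact T.continuous.comp (h.buc z hz)

lemma Ext.mul {w v w' v' : (Fin d → ℝ) →ᵇ B} (h : Ext α w v) (h' : Ext α w' v') :
    Ext α (w * w') (v * v') := by
  obtain ⟨Φ, hΦ, rfl, rfl⟩ := h
  obtain ⟨Ψ, hΨ, rfl, rfl⟩ := h'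
  exact ⟨_, hΦ.mul hΨ, rfl, rfl⟩

lemma IsExt.restrict (h : IsExt α Φ) {θ : ℝ} (h0 : 0 < θ) (h1 : θ ≤ 1) :
    IsExt (θ • α) fun z => Φ (θ * z) := by
  have hm : Set.MapsTo (fun z : ℂ => (θ : ℂ) * z) (Complex.re ⁻¹' Set.Icc 0 1)
      (Complex.re ⁻¹' Set.Icc 0 1) := fun z hz => by
    simp only [Set.mem_preimage, Set.mem_Icc, Complex.re_ofReal_mul] at hz ⊢
    exact ⟨mul_nonneg h0.le hz.1, mul_le_one₀ h1 hz.1 hz.2⟩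
  have hm' : Set.MapsTo (fun z : ℂ => (θ : ℂ) * z) (Complex.re ⁻¹' Set.Ioo 0 1)
      (Complex.re ⁻¹' Set.Ioo 0 1) := fun z hz => by
    simp only [Set.mem_preimage, Set.mem_Ioo, Complex.re_ofReal_mul] at hz ⊢
    exact ⟨mul_pos h0 hz.1, by nlinarith [hz.1, hz.2]⟩
  refine ⟨h.holo.comp (by fun_prop) hm', h.cont.comp (by fun_prop) hm, fun z hz τ => ?_,
    fun z hz => h.buc _ (hm hz)⟩
  have := h.cov _ (hm hz) (θ * τ)
  rw [smul_smul, mul_comm τ θ, ← this]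
  congr 1; push_cast; ring

/-- The new boundary value is `Φ θ`, and the three lines theorem bounds it by the same `M`:
narrowing the strip costs nothing. -/
lemma Ext.restrict {w v : (Fin d → ℝ) →ᵇ B} (h : Ext α w v) {θ M : ℝ} (h0 : 0 < θ) (h1 : θ ≤ 1)
    (hw : ‖w‖ ≤ M) (hv : ‖v‖ ≤ M) : ∃ v', Ext (θ • α) w v' ∧ ‖v'‖ ≤ M := by
  obtain ⟨Φ, hΦ, rfl, rfl⟩ := h
  refine ⟨Φ θ, ⟨_, hΦ.restrict h0 h1, by simp, by simp⟩, hΦ.norm_le ?_ hw hv⟩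
  exact ⟨by simpa using h0.le, by simpa using h1⟩

lemma isExt_mult_gsym (α : Fin d → ℝ) (u : (Fin d → ℝ) →ᵇ B) :
    IsExt α fun z => mult (gsym α z) u where
  holo := ((differentiable_mult_gsym α).clm_apply (differentiable_const u)).differentiableOn
  cont := ((differentiable_mult_gsym α).clm_apply (differentiable_const u)).continuous.continuousOn
  cov z _ τ := mult_gsym_add_mul_I α z τ u
  buc z _ := isBUC_mult (fl1_gsym α z) u

/-- A function with spectrum in a fixed cube extends in every direction. -/
lemma exists_ext_of_mult_plat_eq (R : ℝ) (α : Fin d → ℝ) : ∃ C : ℝ, 1 ≤ C ∧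
    ∀ u : (Fin d → ℝ) →ᵇ B, mult (plat R) u = u → ∃ v, Ext α u v ∧ ‖v‖ ≤ C * ‖u‖ := by
  set T : ((Fin d → ℝ) →ᵇ B) →L[ℂ] ((Fin d → ℝ) →ᵇ B) := mult (gsym α 1)
  set S : ((Fin d → ℝ) →ᵇ B) →L[ℂ] ((Fin d → ℝ) →ᵇ B) := mult (platDivGauss R)
  refine ⟨max 1 (‖T‖ * ‖S‖), le_max_left _ _, fun u hu => ⟨T (S u), ?_, ?_⟩⟩
  -- `S` divides by the Gaussian on the cube, so the Gaussian family applied to `S u` starts at `u`.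
  · refine ⟨_, isExt_mult_gsym α (S u), ?_, rfl⟩
    simp only [S]
    rw [gsym_zero, ← mult_mul fl1_gauss0 (fl1_platDivGauss R), gauss0_mul_platDivGauss, hu]
  · calc ‖T (S u)‖ ≤ ‖T‖ * ‖S u‖ := T.le_opNorm _
      _ ≤ ‖T‖ * (‖S‖ * ‖u‖) := by gcongr; exact S.le_opNorm u
      _ = ‖T‖ * ‖S‖ * ‖u‖ := by ring
      _ ≤ _ := by gcongr; exact le_max_right _ _

/-- In `mult (gsym α (1 - z)) (Φ z)` the translations caused by an imaginary increment of `z`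
cancel. A holomorphic function that is constant in the imaginary direction is constant; compare `z =
0` with `z = 1`. -/
lemma IsExt.mult_gsym_eq (h : IsExt α Φ) :
    mult (gsym α 1) (Φ 0) = mult (gsym α 0) (Φ 1) := by
  set G : ℂ → (Fin d → ℝ) →ᵇ B := fun z => mult (gsym α (1 - z)) (Φ z) with hG
  have hop : Differentiable ℂ fun z : ℂ =>
      (mult (gsym α (1 - z)) : ((Fin d → ℝ) →ᵇ B) →L[ℂ] _) :=
    differentiable_one_sub (F := ((Fin d → ℝ) →ᵇ B) →L[ℂ] ((Fin d → ℝ) →ᵇ B))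
      (differentiable_mult_gsym α)
  have hGd : DifferentiableOn ℂ G (Complex.re ⁻¹' Set.Ioo 0 1) :=
    hop.differentiableOn.clm_apply h.holo
  have hGc : ContinuousOn G (Complex.re ⁻¹' Set.Icc 0 1) :=
    hop.continuous.continuousOn.clm_apply h.cont
  have hinv : ∀ z ∈ Complex.re ⁻¹' Set.Icc 0 1, ∀ τ : ℝ, G (z + τ * Complex.I) = G z := by
    intro z hz τ
    simp only [hG]
    have e : (1 - (z + τ * Complex.I) : ℂ) = (1 - z) + ((-τ : ℝ) : ℂ) * Complex.I := by
      push_cast; ring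
    rw [h.cov z hz, e, mult_gsym_add_mul_I, mult_trans (fl1_gsym _ _), trans_trans, ← add_smul,
      neg_add_cancel, zero_smul, trans_zero]
  have hderiv : Set.EqOn (deriv G) 0 (Complex.re ⁻¹' Set.Ioo 0 1) := by
    intro z hz
    have h1 := (hGd.differentiableAt (isOpen_open_strip.mem_nhds hz)).hasDerivAt
    have h2 : HasDerivAt (fun τ : ℝ => z + τ * Complex.I) Complex.I 0 := by
      simpa using (((hasDerivAt_id (0 : ℝ)).ofReal_comp).mul_const Complex.I).const_add z
    have h3 : HasDerivAt (fun τ : ℝ => G (z + τ * Complex.I)) (Complex.I • deriv G z) 0 := by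
      have h1' : HasDerivAt G (deriv G z) (z + ((0 : ℝ) : ℂ) * Complex.I) := by simpa using h1
      exact h1'.scomp (0 : ℝ) h2
    have h4 : (fun τ : ℝ => G (z + τ * Complex.I)) = fun _ => G z :=
      funext (hinv z (open_strip_subset hz))
    rw [h4] at h3
    have h5 := h3.unique (hasDerivAt_const (0 : ℝ) (G z))
    simpa using h5
  have hpre : IsPreconnected (Complex.re ⁻¹' Set.Ioo (0 : ℝ) 1) :=
    ((convex_Ioo (0 : ℝ) 1).linear_preimage Complex.reLm).isPreconnected
  have hmid : (1 / 2 : ℂ) ∈ Complex.re ⁻¹' Set.Ioo (0 : ℝ) 1 := by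
    simp only [Set.mem_preimage, Set.mem_Ioo]; norm_num
  have hconst : Set.EqOn G (fun _ => G (1 / 2)) (Complex.re ⁻¹' Set.Ioo 0 1) := fun z hz =>
    isOpen_open_strip.is_const_of_deriv_eq_zero hpre hGd hderiv hz hmid
  have hall := hconst.of_subset_closure hGc continuousOn_const open_strip_subset
    closure_open_strip.ge
  have h0 := hall zero_mem_strip
  have h1 := hall one_mem_strip
  simp only [hG, sub_zero, sub_self] at h0 h1
  rw [h0, h1]

/-- Shift of contour: if `ψ = e_α φ` then `ψ ⋆ w = φ ⋆ v` for every extension `(w, v)`. -/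
lemma Ext.mult_eq {w v : (Fin d → ℝ) →ᵇ B} (h : Ext α w v) {φ ψ : (Fin d → ℝ) → ℂ}
    (hφ : FL1 φ) (hψ : FL1 ψ) (he : ψ = expFun α * φ) : mult ψ w = mult φ v := by
  obtain ⟨Φ, hΦ, rfl, rfl⟩ := h
  have key := hΦ.mult_gsym_eq
  rw [gsym_zero] at key
  refine mult_gauss0_injective ?_
  rw [mult_comm fl1_gauss0 hφ, ← key, ← mult_mul fl1_gauss0 hψ, ← mult_mul hφ (fl1_gsym α 1),
    gsym_one, he]
  congr 2; ring

/-- By `IsExt.norm_le` applied to differences, convergence at the two points `0` and `1` forces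
uniform convergence on the whole closed strip. -/
lemma exists_isExt_of_tendsto {Φ : ℕ → ℂ → (Fin d → ℝ) →ᵇ B} (h : ∀ n, IsExt α (Φ n))
    {w v : (Fin d → ℝ) →ᵇ B} (h0 : Tendsto (fun n => Φ n 0) atTop (𝓝 w))
    (h1 : Tendsto (fun n => Φ n 1) atTop (𝓝 v)) : Ext α w v := by
  have hc : UniformCauchySeqOn Φ atTop (Complex.re ⁻¹' Set.Icc 0 1) := by
    rw [Metric.uniformCauchySeqOn_iff]
    intro ε hε
    obtain ⟨N0, hN0⟩ := Metric.cauchySeq_iff.1 h0.cauchySeq (ε / 2) (by positivity)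
    obtain ⟨N1, hN1⟩ := Metric.cauchySeq_iff.1 h1.cauchySeq (ε / 2) (by positivity)
    refine ⟨max N0 N1, fun m hm n hn z hz => ?_⟩
    have hd := (h m).add ((h n).clm (-ContinuousLinearMap.id ℂ _) fun _ _ => rfl)
    rw [dist_eq_norm]
    have e0 := (hN0 m (le_trans (le_max_left _ _) hm) n (le_trans (le_max_left _ _) hn)).le
    have e1 := (hN1 m (le_trans (le_max_right _ _) hm) n (le_trans (le_max_right _ _) hn)).le
    rw [dist_eq_norm, sub_eq_add_neg] at e0 e1
    have := hd.norm_le hz (M := ε / 2) e0 e1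
    rw [sub_eq_add_neg]
    exact lt_of_le_of_lt this (by linarith)
  have hlim : ∀ z, ∃ y, z ∈ Complex.re ⁻¹' Set.Icc (0 : ℝ) 1 →
      Tendsto (fun n => Φ n z) atTop (𝓝 y) := fun z => by
    by_cases hz : z ∈ Complex.re ⁻¹' Set.Icc (0 : ℝ) 1
    · obtain ⟨y, hy⟩ := cauchySeq_tendsto_of_complete (hc.cauchySeq hz)
      exact ⟨y, fun _ => hy⟩
    · exact ⟨0, fun h => absurd h hz⟩
  choose Ψ hΨ using hlim
  have hu : TendstoUniformlyOn Φ Ψ atTop (Complex.re ⁻¹' Set.Icc 0 1) :=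
    hc.tendstoUniformlyOn_of_tendsto fun z hz => hΨ z hz
  refine ⟨Ψ, ⟨?_, ?_, fun z hz τ => ?_, fun z hz => ?_⟩, ?_, ?_⟩
  · exact (hu.mono open_strip_subset).tendstoLocallyUniformlyOn.differentiableOn
      (Eventually.of_forall fun n => (h n).holo) isOpen_open_strip
  · exact hu.continuousOn (Eventually.of_forall fun n => (h n).cont).frequently
  · have hz' : z + τ * Complex.I ∈ Complex.re ⁻¹' Set.Icc (0 : ℝ) 1 := by simpa using hz
    refine tendsto_nhds_unique (hΨ _ hz') ?_
    simp_rw [fun n => (h n).cov z hz τ]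
    exact ((trans (B := B) (τ • α)).continuous.tendsto _).comp (hΨ z hz)
  · exact isBUC_of_limit (fun n => (h n).buc z hz) (hΨ z hz)
  · exact tendsto_nhds_unique (hΨ 0 zero_mem_strip) h0
  · exact tendsto_nhds_unique (hΨ 1 one_mem_strip) h1

lemma Ext.of_tendsto {w v : ℕ → (Fin d → ℝ) →ᵇ B} (h : ∀ n, Ext α (w n) (v n))
    {w' v' : (Fin d → ℝ) →ᵇ B} (h0 : Tendsto w atTop (𝓝 w')) (h1 : Tendsto v atTop (𝓝 v')) :
    Ext α w' v' := by
  choose Φ hΦ hΦ0 hΦ1 using h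
  exact exists_isExt_of_tendsto hΦ (by simpa only [hΦ0] using h0) (by simpa only [hΦ1] using h1)

lemma trans_inverse (t : Fin d → ℝ) {u : (Fin d → ℝ) →ᵇ B} (hu : IsUnit u) :
    IsUnit (trans t u) ∧ Ring.inverse (trans t u) = trans t (Ring.inverse u) := by
  obtain ⟨U, rfl⟩ := hu
  rw [Ring.inverse_unit]
  have h1 : trans t (U : (Fin d → ℝ) →ᵇ B) * trans t (↑U⁻¹ : (Fin d → ℝ) →ᵇ B) = 1 := by
    rw [← trans_mul, U.mul_inv, trans_one]
  have h2 : trans t (↑U⁻¹ : (Fin d → ℝ) →ᵇ B) * trans t (U : (Fin d → ℝ) →ᵇ B) = 1 := by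
    rw [← trans_mul, U.inv_mul, trans_one]
  exact ⟨⟨⟨_, _, h1, h2⟩, rfl⟩, Ring.inverse_unit (⟨_, _, h1, h2⟩ : ((Fin d → ℝ) →ᵇ B)ˣ)⟩

lemma continuousAt_inverse {R : Type*} [NormedRing R] [HasSummableGeomSeries R] {u : R}
    (hu : IsUnit u) : ContinuousAt Ring.inverse u := by
  obtain ⟨U, rfl⟩ := hu
  exact NormedRing.inverse_continuousAt U

/-- Inverses of extendable functions extend to a narrower strip. -/
lemma Ext.inverse {w v : (Fin d → ℝ) →ᵇ B} (h : Ext α w v) (hw : IsUnit w) :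
    ∀ᶠ θ : ℝ in 𝓝[>] 0, ∃ y', Ext (θ • α) (Ring.inverse w) y' ∧
      ‖y'‖ ≤ ‖Ring.inverse w‖ + 1 := by
  obtain ⟨Φ, hΦ, rfl, rfl⟩ := h
  have hc : Tendsto (fun x : ℝ => Φ x) (𝓝[Set.Icc 0 1] 0) (𝓝 (Φ 0)) := by
    have h1 : ContinuousOn (fun x : ℝ => Φ x) (Set.Icc 0 1) :=
      hΦ.cont.comp Complex.continuous_ofReal.continuousOn fun x hx => by simpa using hx
    simpa [ContinuousWithinAt] using h1 0 (by simp)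
  have hU : ∀ᶠ x : ℝ in 𝓝[Set.Icc 0 1] 0, IsUnit (Φ x) :=
    hc.eventually (Units.isOpen.mem_nhds hw)
  have hN : ∀ᶠ x : ℝ in 𝓝[Set.Icc 0 1] 0,
      ‖Ring.inverse (Φ x)‖ < ‖Ring.inverse (Φ 0)‖ + 1 :=
    (((continuousAt_inverse hw).tendsto.comp hc).norm).eventually (gt_mem_nhds (by linarith))
  -- Invertibility and the norm bound hold on a real interval near zero; covariance then carries
  -- invertibility to the strip above it.
  obtain ⟨δ, hδ, hδ'⟩ := Metric.mem_nhdsWithin_iff.1 (hU.and hN)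
  have hsmall : ∀ᶠ θ : ℝ in 𝓝[>] 0, 0 < θ ∧ θ < min δ 1 :=
    Ioo_mem_nhdsGT (lt_min hδ one_pos)
  filter_upwards [hsmall] with θ hθ
  have hθδ := lt_of_lt_of_le hθ.2 (min_le_left _ _)
  have hθ1 := (lt_of_lt_of_le hθ.2 (min_le_right _ _)).le
  have hgood : ∀ x ∈ Set.Icc (0 : ℝ) 1, IsUnit (Φ (θ * x : ℝ)) ∧
      ‖Ring.inverse (Φ (θ * x : ℝ))‖ < ‖Ring.inverse (Φ 0)‖ + 1 := by
    intro x hx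
    refine hδ' ⟨?_, mul_nonneg hθ.1.le hx.1, mul_le_one₀ hθ1 hx.1 hx.2⟩
    rw [mem_ball_zero_iff, Real.norm_eq_abs, abs_of_nonneg (mul_nonneg hθ.1.le hx.1)]
    exact (mul_le_of_le_one_right hθ.1.le hx.2).trans_lt hθδ
  have hΨ := hΦ.restrict hθ.1 hθ1
  have hunit : ∀ z ∈ Complex.re ⁻¹' Set.Icc (0 : ℝ) 1, IsUnit (Φ (θ * z)) := by
    intro z hz
    have e := hΨ.eq_trans hz
    rw [e]
    refine (trans_inverse _ ?_).1
    have := (hgood z.re hz).1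
    push_cast at this; exact this
  refine ⟨Ring.inverse (Φ θ), ⟨fun z => Ring.inverse (Φ (θ * z)), ⟨?_, ?_, ?_, ?_⟩, by simp, by simp⟩,
    ?_⟩
  · intro z hz
    exact ((differentiableAt_inverse (𝕜 := ℂ) (hunit z (open_strip_subset hz))).comp_differentiableWithinAt
      z (hΨ.holo z hz))
  · intro z hz
    exact ContinuousAt.comp_continuousWithinAt (f := fun z : ℂ => Φ (θ * z))
      (continuousAt_inverse (hunit z hz)) (hΨ.cont z hz)
  · intro z hz τ
    have := hΨ.cov z hz τ
    rw [this, (trans_inverse _ (hunit z hz)).2]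
  · intro z hz
    have hb := hΨ.buc z hz
    unfold IsBUC at hb ⊢
    simp_rw [← (trans_inverse _ (hunit z hz)).2]
    exact continuous_iff_continuousAt.2 fun t =>
      ContinuousAt.comp (f := fun t => trans t (Φ (θ * z)))
        (continuousAt_inverse (trans_inverse t (hunit z hz)).1) hb.continuousAt
  · have := (hgood 1 (by simp)).2
    simpa using this.le

end Extension

/-! ### Localisation of the Beurling spectrum. -/

lemma modL1_dil {n : ℝ} (hn : 0 < n) (f : (Fin d → ℝ) → ℂ) (a : Fin d → ℝ) :
    modL1 (dil n f) a = modL1 f (n • a) := by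
  have h := Measure.integral_comp_smul (volume : Measure (Fin d → ℝ))
    (fun t => ‖f (t + n • a) - f t‖) n
  simp only [Module.finrank_fin_fun] at h
  have h2 : ∀ t : Fin d → ℝ, ‖dil n f (t + a) - dil n f t‖ =
      n ^ d * ‖f (n • t + n • a) - f (n • t)‖ := fun t => by
    rw [dil, dil, ← mul_sub, norm_mul, Complex.norm_real, Real.norm_of_nonneg (by positivity),
      smul_add]
  simp only [modL1, h2]
  rw [integral_const_mul, h, abs_of_pos (by positivity), smul_eq_mul, ← mul_assoc,
    mul_inv_cancel₀ (by positivity), one_mul]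

lemma norm_cv_sub_mult_le {f p : (Fin d → ℝ) → ℂ} (hf : Integrable f) (hp : Integrable p)
    (h1 : ∫ t, f t = 1) (v : (Fin d → ℝ) →ᵇ B) :
    ‖cv p v - cv f (cv p v)‖ ≤ (∫ t : Fin d → ℝ, ‖f t‖ * modL1 p (-t)) * ‖v‖ := by
  have hint : Integrable fun t : Fin d → ℝ => ‖f t‖ * modL1 p (-t) :=
    hf.norm.mul_bdd (c := 2 * ∫ t, ‖p t‖)
      ((continuous_modL1 hp).comp continuous_neg).aestronglyMeasurable
      (Eventually.of_forall fun t => by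
        rw [Real.norm_of_nonneg (modL1_nonneg _ _)]; exact modL1_le hp _)
  refine (BoundedContinuousFunction.norm_le (mul_nonneg (integral_nonneg fun t : Fin d → ℝ =>
    mul_nonneg (norm_nonneg _) (modL1_nonneg _ _)) (norm_nonneg _))).2 fun s => ?_
  have e1 : (cv p v - cv f (cv p v)) s = ∫ t, f t • (cv p v s - cv p v (s - t)) := by
    rw [BoundedContinuousFunction.sub_apply, cv_apply hf]
    simp only [smul_sub]
    rw [integral_sub (hf.smul_const _) (integrable_smul_bcf hf _ s), integral_smul_const, h1,
      one_smul]
  rw [e1, ← integral_mul_const]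
  refine norm_integral_le_of_norm_le (hint.mul_const _) (Eventually.of_forall fun t => ?_)
  rw [norm_smul, mul_assoc]
  refine mul_le_mul_of_nonneg_left ?_ (norm_nonneg _)
  refine le_trans ?_ (norm_trans_cv_sub_le hp (-t) v)
  rw [norm_sub_rev]
  have := (trans (-t) (cv p v) - cv p v).norm_coe_le_norm s
  rwa [BoundedContinuousFunction.sub_apply, trans_apply, ← sub_eq_add_neg] at this

/-- The smooth cutoff around `γ` at scale `ε`. -/
def bumpAt (γ : Fin d → ℝ) (ε : ℝ) (l : Fin d → ℝ) : ℂ := plat 0 (ε⁻¹ • (l - γ))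

lemma fl1_bumpAt (γ : Fin d → ℝ) {ε : ℝ} (h : 0 < ε) : FL1 (bumpAt γ ε) :=
  ((fl1_plat 0).dil h).shift γ

lemma bumpAt_eq_one {γ l : Fin d → ℝ} {ε : ℝ} (hε : 0 < ε) (h : ∀ k, |l k - γ k| ≤ ε) :
    bumpAt γ ε l = 1 := by
  refine plat_eq_one fun k => ?_
  rw [Pi.smul_apply, smul_eq_mul, abs_mul, abs_inv, abs_of_pos hε, zero_add, inv_mul_eq_div,
    div_le_one hε]
  exact h k

lemma bumpAt_eq_zero {γ l : Fin d → ℝ} {ε : ℝ} (hε : 0 < ε) {k : Fin d}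
    (h : 2 * ε ≤ |l k - γ k|) : bumpAt γ ε l = 0 := by
  refine plat_eq_zero (k := k) ?_
  rw [Pi.smul_apply, smul_eq_mul, abs_mul, abs_inv, abs_of_pos hε, max_self, zero_add,
    inv_mul_eq_div, le_div_iff₀ hε]
  exact h

/-- A local division by `F` without inverting it. The low-frequency part `w` of `u` is reproduced by
a wide kernel and so varies slowly; hence `F` acts on it as `F 0 = 1` up to an error smaller than
`‖w‖` unless `w = 0`. But `F` kills `w`. -/
lemma exists_bumpAt_zero_mult_eq_zero {F : (Fin d → ℝ) → ℂ} (hF : FL1 F) (h1 : F 0 = 1)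
    {u : (Fin d → ℝ) →ᵇ B} (hu : mult F u = 0) : ∃ ε : ℝ, 0 < ε ∧ mult (bumpAt 0 ε) u = 0 := by
  obtain ⟨f, hf, hf'⟩ := hF
  obtain ⟨p, hp, hp'⟩ := fl1_plat (d := d) 0
  have hI : ∫ t, f t = 1 := by simpa [fourierT_eq, h1] using hf' 0
  have hpos : ∀ n : ℕ, 0 < ((n : ℝ) + 1)⁻¹ := fun n => by positivity
  have hlim : Tendsto (fun n : ℕ => ∫ t : Fin d → ℝ, ‖f t‖ * modL1 p (((n : ℝ) + 1)⁻¹ • -t)) atTop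
      (𝓝 (∫ _ : Fin d → ℝ, (0 : ℝ))) := by
    refine tendsto_integral_of_dominated_convergence (fun t => ‖f t‖ * (2 * ∫ t, ‖p t‖))
      (fun n => ?_) (hf.norm.mul_const _) (fun n => Eventually.of_forall fun t => ?_)
      (Eventually.of_forall fun t => ?_)
    · have : Continuous fun t : Fin d → ℝ => modL1 p (((n : ℝ) + 1)⁻¹ • -t) :=
        (continuous_modL1 hp).comp (by fun_prop)
      exact hf.norm.aestronglyMeasurable.mul this.aestronglyMeasurable
    · rw [norm_mul, norm_norm, Real.norm_of_nonneg (modL1_nonneg _ _)]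
      exact mul_le_mul_of_nonneg_left (modL1_le hp _) (norm_nonneg _)
    · have h3 := ((continuous_modL1 hp).tendsto 0).comp (tendsto_inv_smul (r := -t))
      rw [modL1_zero] at h3
      simpa using h3.const_mul ‖f t‖
  rw [integral_zero] at hlim
  obtain ⟨n, hn⟩ := (hlim.eventually_lt_const one_pos).exists
  set ε := ((n : ℝ) + 1)⁻¹ with hε
  have hε0 : 0 < ε := hpos n
  -- At half the scale, the bump is supported where `bumpAt 0 ε` equals one.
  refine ⟨ε / 2, by positivity, ?_⟩
  set w := mult (bumpAt 0 (ε / 2)) u with hw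
  have hb : FL1 (bumpAt (0 : Fin d → ℝ) ε) := fl1_bumpAt 0 hε0
  have hb2 : FL1 (bumpAt (0 : Fin d → ℝ) (ε / 2)) := fl1_bumpAt 0 (by positivity)
  have hF : FL1 F := ⟨f, hf, hf'⟩
  have hbb : bumpAt (0 : Fin d → ℝ) ε * bumpAt 0 (ε / 2) = bumpAt 0 (ε / 2) := by
    ext l
    rw [Pi.mul_apply]
    by_cases h : ∃ k, 2 * (ε / 2) ≤ |l k - (0 : Fin d → ℝ) k|
    · obtain ⟨k, hk⟩ := h
      rw [bumpAt_eq_zero (by positivity) hk, mul_zero]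
    · push Not at h
      rw [bumpAt_eq_one hε0 fun k => (h k).le.trans (by linarith), one_mul]
  have hw1 : mult (bumpAt 0 ε) w = w := by rw [hw, ← mult_mul hb hb2, hbb]
  have hw2 : mult F w = 0 := by rw [hw, mult_comm hF hb2, hu, map_zero]
  have hcv : (mult (bumpAt 0 ε) : ((Fin d → ℝ) →ᵇ B) →L[ℂ] _) = cv (dil ε p) :=
    mult_eq (integrable_dil hε0 hp) fun l => by
      rw [fourierT_dil hε0, hp', bumpAt, sub_zero]
  have hcf : (mult F : ((Fin d → ℝ) →ᵇ B) →L[ℂ] _) = cv f := mult_eq hf hf'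
  have hle := norm_cv_sub_mult_le hf (integrable_dil hε0 hp) hI w
  rw [← hcv, ← hcf, hw1, hw2, sub_zero] at hle
  simp only [modL1_dil hε0] at hle
  by_contra hne
  have : 0 < ‖w‖ := norm_pos_iff.2 hne
  nlinarith

lemma notMem_beurlingSpectrum_iff {u : (Fin d → ℝ) →ᵇ B} {γ : Fin d → ℝ} :
    γ ∉ beurlingSpectrum u ↔ ∃ F, FL1 F ∧ F γ ≠ 0 ∧ mult F u = 0 := by
  simp only [beurlingSpectrum, Set.mem_ofPred_eq, not_not]
  constructor
  · rintro ⟨f, hf, h1, h2⟩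
    refine ⟨fourierT f, ⟨f, hf, fun _ => rfl⟩, h1, ?_⟩
    ext s
    rw [mult_fourierT hf, h2]; rfl
  · rintro ⟨F, ⟨f, hf, hf'⟩, h1, h2⟩
    obtain rfl : fourierT f = F := funext hf'
    refine ⟨f, hf, h1, fun s => ?_⟩
    rw [← mult_fourierT hf, h2]; rfl

lemma exists_bumpAt_mult_eq_zero {u : (Fin d → ℝ) →ᵇ B} {γ : Fin d → ℝ}
    (h : γ ∉ beurlingSpectrum u) : ∃ ε : ℝ, 0 < ε ∧ mult (bumpAt γ ε) u = 0 := by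
  obtain ⟨F, hF, h1, h2⟩ := notMem_beurlingSpectrum_iff.1 h
  have key : ∀ {G : (Fin d → ℝ) → ℂ}, FL1 G → ∀ v : (Fin d → ℝ) →ᵇ B,
      mult (fun l => G (l - γ)) v = modu γ (mult G (modu (-γ) v)) := fun {G} hG v => by
    rw [← mult_modu hG, modu_modu, add_neg_cancel, modu_zero]
  have hG : FL1 fun l => (F γ)⁻¹ * F (l + γ) := by
    have : FL1 fun l => F (l + γ) := by simpa only [sub_neg_eq_add] using hF.shift (-γ)
    exact this.smul (F γ)⁻¹
  have hz : mult (fun l => (F γ)⁻¹ * F (l + γ)) (modu (-γ) u) = 0 := by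
    have := key hG u
    simp only [sub_add_cancel] at this
    have h3 : mult (fun l => (F γ)⁻¹ * F l) u = 0 := by
      have := mult_smul (B := B) (F γ)⁻¹ hF
      have h4 := congrArg (fun T => T u) this
      change mult ((F γ)⁻¹ • F) u = 0
      rw [h4]
      ext s
      change (F γ)⁻¹ • (mult F u s) = 0
      rw [h2]; simp
    rw [h3] at this
    have h5 := congrArg (modu (-γ)) this
    rw [modu_modu, neg_add_cancel, modu_zero, map_zero] at h5
    exact h5.symm
  obtain ⟨ε, hε, he⟩ := exists_bumpAt_zero_mult_eq_zero hG (by simp [h1]) hz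
  refine ⟨ε, hε, ?_⟩
  have := key (fl1_bumpAt 0 hε) u
  rw [he, map_zero] at this
  rw [← this]
  congr 2
  ext l
  simp [bumpAt]

lemma isClosed_beurlingSpectrum (u : (Fin d → ℝ) →ᵇ B) : IsClosed (beurlingSpectrum u) := by
  rw [← isOpen_compl_iff, isOpen_iff_mem_nhds]
  intro γ hγ
  obtain ⟨F, hF, h1, h2⟩ := notMem_beurlingSpectrum_iff.1 hγ
  filter_upwards [hF.continuous.continuousAt.eventually_ne h1] with l hl
  exact notMem_beurlingSpectrum_iff.2 ⟨F, hF, hl, h2⟩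

lemma beurlingSpectrum_mult_platDil_subset (n : ℕ) (u : (Fin d → ℝ) →ᵇ B) :
    beurlingSpectrum (mult (platDil n) u) ⊆
      Set.univ.pi fun _ => Set.Icc (-(2 * ((n : ℝ) + 1))) (2 * ((n : ℝ) + 1)) := by
  intro γ hγ
  simp only [Set.mem_pi, Set.mem_univ, true_implies, ← abs_le, Set.mem_Icc]
  by_contra! h
  obtain ⟨k, hk⟩ := h
  refine notMem_beurlingSpectrum_iff.2 ?_ hγ
  set ε := (|γ k| - 2 * ((n : ℝ) + 1)) / 2 with hε
  have hε0 : 0 < ε := by rw [hε]; linarith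
  refine ⟨bumpAt γ ε, fl1_bumpAt γ hε0, ?_, ?_⟩
  · rw [bumpAt_eq_one hε0 fun k => by simpa using hε0.le]; exact one_ne_zero
  · have : bumpAt γ ε * platDil n = 0 := by
      ext l
      rw [Pi.mul_apply, Pi.zero_apply]
      by_cases hl : 2 * ((n : ℝ) + 1) ≤ |l k|
      · rw [platDil_eq_zero hl, mul_zero]
      · rw [bumpAt_eq_zero hε0 (k := k), zero_mul]
        push Not at hl
        have := abs_sub_abs_le_abs_sub (γ k) (l k)
        rw [abs_sub_comm] at this
        linarith
    rw [← mult_mul (fl1_bumpAt γ hε0) (fl1_platDil n), this, mult_zero]; rfl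

lemma isCompact_beurlingSpectrum_mult_platDil (n : ℕ) (u : (Fin d → ℝ) →ᵇ B) :
    IsCompact (beurlingSpectrum (mult (platDil n) u)) :=
  (isCompact_univ_pi fun _ => isCompact_Icc).of_isClosed_subset (isClosed_beurlingSpectrum _)
    (beurlingSpectrum_mult_platDil_subset n u)

/-- Split `Q = Q b + Q (1 - b)` with `b` one of the bumps: the first part kills `u`, and the second
vanishes where `b = 1`, so the remaining bumps handle it. -/
lemma mult_eq_zero_of_finset {u : (Fin d → ℝ) →ᵇ B} (ε : (Fin d → ℝ) → ℝ)
    (S : Finset (Fin d → ℝ)) (hε : ∀ γ ∈ S, 0 < ε γ) (h : ∀ γ ∈ S, mult (bumpAt γ (ε γ)) u = 0) :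
    ∀ {Q : (Fin d → ℝ) → ℂ}, FL1 Q → (∀ l, Q l ≠ 0 → ∃ γ ∈ S, bumpAt γ (ε γ) l = 1) →
      mult Q u = 0 := by
  classical
  induction S using Finset.induction_on with
  | empty =>
    intro Q _ hQ
    have : Q = 0 := by
      ext l
      by_contra hne
      simpa using hQ l hne
    rw [this, mult_zero]; rfl
  | insert γ S _ ih =>
    intro Q hQ hQ'
    have hb := fl1_bumpAt γ (hε γ (Finset.mem_insert_self _ _))
    have h0 : mult (Q * bumpAt γ (ε γ)) u = 0 := by
      rw [mult_mul hQ hb, h γ (Finset.mem_insert_self _ _), map_zero]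
    have h1 := ih (fun γ hγ => hε γ (Finset.mem_insert_of_mem hγ))
      (fun γ hγ => h γ (Finset.mem_insert_of_mem hγ)) (hQ.sub (hQ.mul hb)) fun l hl => by
        have h2 : Q l * (1 - bumpAt γ (ε γ) l) ≠ 0 := by
          rw [mul_sub, mul_one]; exact hl
        obtain ⟨γ', h3, h4⟩ := hQ' l (left_ne_zero_of_mul h2)
        rcases Finset.mem_insert.1 h3 with rfl | h3
        · simp [h4] at h2
        · exact ⟨γ', h3, h4⟩
    rw [mult_sub hQ (hQ.mul hb), sub_apply, h0, sub_zero] at h1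
    exact h1

lemma mult_eq_zero_of_isCompact {u : (Fin d → ℝ) →ᵇ B} {Q : (Fin d → ℝ) → ℂ} (hQ : FL1 Q)
    {K : Set (Fin d → ℝ)} (hK : IsCompact K) (hKu : Disjoint K (beurlingSpectrum u))
    (h : ∀ l, Q l ≠ 0 → l ∈ K) : mult Q u = 0 := by
  have hex : ∀ γ : Fin d → ℝ, ∃ ε : ℝ, 0 < ε ∧ (γ ∈ K → mult (bumpAt γ ε) u = 0) := fun γ => by
    by_cases hγ : γ ∈ K
    · obtain ⟨ε, h1, h2⟩ := exists_bumpAt_mult_eq_zero (Set.disjoint_left.1 hKu hγ)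
      exact ⟨ε, h1, fun _ => h2⟩
    · exact ⟨1, one_pos, fun h => absurd h hγ⟩
  choose ε hε hε' using hex
  obtain ⟨S, hS, hcov⟩ := hK.elim_nhds_subcover (fun γ => Metric.ball γ (ε γ)) fun γ _ =>
    Metric.ball_mem_nhds γ (hε γ)
  refine mult_eq_zero_of_finset ε S (fun γ _ => hε γ) (fun γ hγ => hε' γ (hS γ hγ)) hQ
    fun l hl => ?_
  obtain ⟨γ, h1, h2⟩ := Set.mem_iUnion₂.1 (hcov (h l hl))
  refine ⟨γ, h1, bumpAt_eq_one (hε γ) fun k => ?_⟩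
  rw [← Real.dist_eq]
  exact (dist_le_pi_dist l γ k).trans (Metric.mem_ball.1 h2).le

/-- The symbol `platDil n * (1 - G)` is supported in a compact set that misses the spectrum, so `u`
and `mult G u` have the same cut-offs. -/
lemma mult_eq_self_of_eventually {u : (Fin d → ℝ) →ᵇ B} {G : (Fin d → ℝ) → ℂ} (hG : FL1 G)
    (h : ∀ᶠ l in nhdsSet (beurlingSpectrum u), G l = 1) : mult G u = u := by
  obtain ⟨U, hU, hsub, hU1⟩ := eventually_nhdsSet_iff_exists.1 h
  refine eq_of_mult_platDil_eq fun n => ?_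
  have hn := fl1_platDil (d := d) n
  have h0 : mult (platDil n - platDil n * G) u = 0 := by
    refine mult_eq_zero_of_isCompact (hn.sub (hn.mul hG))
      (K := (Set.univ.pi fun _ => Set.Icc (-(2 * ((n : ℝ) + 1))) (2 * ((n : ℝ) + 1))) \ U)
      ((isCompact_univ_pi fun _ => isCompact_Icc).diff hU)
      (Set.disjoint_left.2 fun l hl hl' => hl.2 (hsub hl')) fun l hl => ?_
    have h2 : platDil n l * (1 - G l) ≠ 0 := by
      rw [mul_sub, mul_one]; exact hl
    refine ⟨?_, fun hlU => by simp [hU1 l hlU] at h2⟩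
    simp only [Set.mem_pi, Set.mem_univ, true_implies, ← abs_le, Set.mem_Icc]
    intro k
    by_contra! hk
    exact left_ne_zero_of_mul h2 (platDil_eq_zero hk.le)
  rw [mult_sub hn (hn.mul hG), sub_apply, mult_mul hn hG, sub_eq_zero] at h0
  exact h0.symm

/-! ### The domain of `h ⋄` in terms of extensions. -/

lemma Ext.isBUC_left {α : Fin d → ℝ} {w v : (Fin d → ℝ) →ᵇ B} (h : Ext α w v) : IsBUC w := by
  obtain ⟨Φ, hΦ, rfl, rfl⟩ := h
  exact hΦ.buc 0 zero_mem_strip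

lemma Ext.isBUC_right {α : Fin d → ℝ} {w v : (Fin d → ℝ) →ᵇ B} (h : Ext α w v) : IsBUC v := by
  obtain ⟨Φ, hΦ, rfl, rfl⟩ := h
  exact hΦ.buc 1 one_mem_strip

lemma eventually_plat_eq_one {K : Set (Fin d → ℝ)} (hK : Bornology.IsBounded K) :
    ∃ R : ℝ, ∀ R' ≥ R, ∀ᶠ l in nhdsSet K, plat R' l = 1 := by
  obtain ⟨R, hR⟩ := hK.subset_ball 0
  refine ⟨R, fun R' hR' => eventually_nhdsSet_iff_exists.2 ⟨Metric.ball 0 R, Metric.isOpen_ball, hR,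
    fun l hl => plat_eq_one fun k => ?_⟩⟩
  rw [mem_ball_zero_iff] at hl
  have := norm_le_pi_norm l k
  rw [Real.norm_eq_abs] at this
  linarith

lemma fl1_expFun_mul_platDil (n : ℕ) (α : Fin d → ℝ) : FL1 (expFun α * platDil n) := by
  rw [← platDil_mul_plat n, mul_comm (platDil n), ← mul_assoc]
  exact (fl1_expFun_mul_plat _ α).mul (fl1_platDil n)

lemma isDiamondComp_iff {h : (Fin d → ℝ) → ℂ} {x y : (Fin d → ℝ) →ᵇ B} :
    IsDiamondComp h x y ↔ IsCompact (beurlingSpectrum x) ∧ ∃ Φ, FL1 Φ ∧ FL1 (h * Φ) ∧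
      HasCompactSupport Φ ∧ (∀ᶠ l in nhdsSet (beurlingSpectrum x), Φ l = 1) ∧
      y = mult (h * Φ) x := by
  refine and_congr_right fun _ => ⟨?_, ?_⟩
  · rintro ⟨φ, ψ, hφ, hψ, hc, h1, h2, h3⟩
    refine ⟨fourierT φ, ⟨φ, hφ, fun _ => rfl⟩, ⟨ψ, hψ, h2⟩, hc, h1, ?_⟩
    ext s
    rw [h3, ← mult_fourierT hψ, funext h2]; rfl
  · rintro ⟨Φ, ⟨φ, hφ, hφ'⟩, ⟨ψ, hψ, hψ'⟩, hc, h1, h2⟩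
    obtain rfl : fourierT φ = Φ := funext hφ'
    refine ⟨φ, ψ, hφ, hψ, hc, h1, hψ', fun s => ?_⟩
    rw [h2, ← funext hψ', mult_fourierT hψ]

/-- Compact spectrum provides some extension, with boundary value `v`. The contour shift gives `e_α
⋄ u = mult Φ v`, and `mult Φ v = v` because the cut-offs of `v` are multipliers applied to `u`,
which `Φ` fixes. -/
lemma IsDiamondComp.ext {α : Fin d → ℝ} {u v : (Fin d → ℝ) →ᵇ B}
    (h : IsDiamondComp (expFun α) u v) : Ext α u v := by
  obtain ⟨hc, Φ, hΦ, hΨ, -, h1, rfl⟩ := isDiamondComp_iff.1 h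
  obtain ⟨R, hR⟩ := eventually_plat_eq_one hc.isBounded
  obtain ⟨C, -, hC⟩ := exists_ext_of_mult_plat_eq (B := B) R α
  obtain ⟨v, hv, -⟩ := hC u (mult_eq_self_of_eventually (fl1_plat R) (hR R le_rfl))
  have hu : mult Φ u = u := mult_eq_self_of_eventually hΦ h1
  rw [hv.mult_eq hΦ hΨ rfl]
  have : mult Φ v = v := eq_of_mult_platDil_eq fun n => by
    have hn := fl1_platDil (d := d) n
    have hen := fl1_expFun_mul_platDil n α
    rw [mult_comm hn hΦ, ← hv.mult_eq hn hen rfl, mult_comm hΦ hen, hu]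
  rwa [this]

lemma exists_ext_of_mem_diamondDomain {α : Fin d → ℝ} {x : (Fin d → ℝ) →ᵇ B}
    (h : x ∈ diamondDomain (expFun α)) : ∃ y, Ext α x y := by
  obtain ⟨u, v, y, h, hu, hv⟩ := h
  exact ⟨y, Ext.of_tendsto (fun n => (h n).ext) hu hv⟩

/-- The cut-offs of `x` are the approximants: they have compact spectrum, their images are the
cut-offs of `y`, and both sequences converge in norm by uniform continuity. -/
lemma mem_diamondDomain_of_mult_platDil_eq {h : (Fin d → ℝ) → ℂ} (hh : ∀ R, FL1 (h * plat R))
    {x y : (Fin d → ℝ) →ᵇ B} (hx : IsBUC x) (hy : IsBUC y)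
    (hxy : ∀ n, mult (h * platDil n) x = mult (platDil n) y) : x ∈ diamondDomain h := by
  refine ⟨fun n => mult (platDil n) x, fun n => mult (platDil n) y, y, fun n => ?_,
    tendsto_mult_dil_of_isBUC (fl1_plat 0) plat_zero_zero hx,
    tendsto_mult_dil_of_isBUC (fl1_plat 0) plat_zero_zero hy⟩
  have hc := isCompact_beurlingSpectrum_mult_platDil n x
  obtain ⟨R, hR⟩ := eventually_plat_eq_one hc.isBounded
  refine isDiamondComp_iff.2 ⟨hc, plat (max R (2 * ((n : ℝ) + 1))), fl1_plat _, hh _,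
    hasCompactSupport_plat _, hR _ (le_max_left _ _), ?_⟩
  change mult (platDil n) y = mult _ (mult (platDil n) x)
  rw [← hxy, ← mult_mul (hh _) (fl1_platDil n)]
  congr 2
  ext l
  simp only [Pi.mul_apply]
  by_cases hl : ∃ k, 2 * ((n : ℝ) + 1) ≤ |l k|
  · obtain ⟨k, hk⟩ := hl
    rw [platDil_eq_zero hk, mul_zero, mul_zero]
  · push Not at hl
    rw [plat_eq_one fun k => (hl k).le.trans ((le_max_right R _).trans (by linarith)), mul_one]

lemma Ext.mem_diamondDomain {α : Fin d → ℝ} {x y : (Fin d → ℝ) →ᵇ B} (h : Ext α x y) :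
    x ∈ diamondDomain (expFun α) :=
  mem_diamondDomain_of_mult_platDil_eq (fun R => fl1_expFun_mul_plat R α) h.isBUC_left
    h.isBUC_right fun n => h.mult_eq (fl1_platDil n) (fl1_expFun_mul_platDil n α) rfl

lemma diamondDomain_subset_of_eq_mul {h h' M : (Fin d → ℝ) → ℂ} (hM : FL1 M) (he : h' = M * h) :
    (diamondDomain h : Set ((Fin d → ℝ) →ᵇ B)) ⊆ diamondDomain h' := by
  rintro x ⟨u, v, y, huv, hu, hv⟩
  refine ⟨u, fun n => mult M (v n), mult M y, fun n => ?_, hu, ((mult M).continuous.tendsto y).comp hv⟩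
  obtain ⟨hc, Φ, hΦ, hΨ, hcs, h1, h2⟩ := isDiamondComp_iff.1 (huv n)
  have h3 : h' * Φ = M * (h * Φ) := by rw [he, mul_assoc]
  exact isDiamondComp_iff.2 ⟨hc, Φ, hΦ, h3 ▸ hM.mul hΨ, hcs, h1, by
    change mult M (v n) = _
    rw [h2, h3, mult_mul hM hΨ]⟩

lemma FLine.sub {G H : ℝ → ℂ} (hG : FLine G) (hH : FLine H) : FLine fun l => G l - H l := by
  obtain ⟨f, hf, hf'⟩ := hG
  obtain ⟨g, hg, hg'⟩ := hH
  have hb : ∀ {f : ℝ → ℂ}, Integrable f → ∀ l : ℝ,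
      Integrable fun t : ℝ => f t * Complex.exp (-(Complex.I * ((t * l : ℝ) : ℂ))) := fun hf l =>
    hf.mul_bdd (c := 1) (Continuous.aestronglyMeasurable (by fun_prop))
      (Eventually.of_forall fun t => by simp [Complex.norm_exp])
  refine ⟨fun t => f t - g t, hf.sub hg, fun l => ?_⟩
  simp only [sub_mul]
  rw [integral_sub (hb hf l) (hb hg l), hf', hg']

lemma FLine.const_mul {G : ℝ → ℂ} (hG : FLine G) (c : ℂ) : FLine fun l => c * G l := by
  obtain ⟨f, hf, hf'⟩ := hG
  refine ⟨fun t => c * f t, hf.const_mul c, fun l => ?_⟩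
  simp only [mul_assoc]
  rw [integral_const_mul, hf']

/-! ### Two-sided exponentials against the sign patterns. -/

/-- The sign encoded by a boolean. -/
def sgn (b : Bool) : ℝ := bif b then 1 else -1

@[simp] lemma sgn_true : sgn true = 1 := rfl
@[simp] lemma sgn_false : sgn false = -1 := rfl

lemma absExpFun_eq (α l : Fin d → ℝ) :
    absExpFun α l = ∏ k, (Real.exp (α k * |l k|) : ℂ) := by
  rw [absExpFun, Real.exp_sum]; push_cast; rfl

/-- Half the exponent is used so that the quotient decays on both sides, with rates `a/2` and
`3a/2`; with the full exponent it would equal one on a half-line. -/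
lemma exp_sgn_half_eq (b : Bool) (a l : ℝ) :
    (Real.exp (sgn b * a / 2 * l) : ℂ) =
      (bif b then twoExp (a / 2) (3 * a / 2) l else twoExp (3 * a / 2) (a / 2) l) *
        (Real.exp (a * |l|) : ℂ) := by
  rcases le_or_gt 0 l with h | h <;> cases b <;>
    simp only [twoExp, cond_true, cond_false, h, not_le.2, if_true, if_false, abs_of_nonneg,
      abs_of_neg, sgn_true, sgn_false, ← Complex.ofReal_mul, ← Real.exp_add] <;>
    congr 2 <;> ring

lemma diamondDomain_absExpFun_subset {α : Fin d → ℝ} (hα : ∀ k, 0 < α k) (e : Fin d → Bool) :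
    (diamondDomain (absExpFun α) : Set ((Fin d → ℝ) →ᵇ B)) ⊆
      diamondDomain (expFun fun k => sgn (e k) * α k / 2) := by
  refine diamondDomain_subset_of_eq_mul
    (M := fun l => ∏ k, (bif e k then twoExp (α k / 2) (3 * α k / 2) (l k) else
      twoExp (3 * α k / 2) (α k / 2) (l k))) ?_ ?_
  · refine fl1_prod (G := fun k l => bif e k then twoExp (α k / 2) (3 * α k / 2) l else
      twoExp (3 * α k / 2) (α k / 2) l) fun k => ?_
    have := hα k
    cases e k
    · exact fLine_twoExp (by positivity) (by positivity)
    · exact fLine_twoExp (by positivity) (by positivity)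
  · ext l
    rw [Pi.mul_apply, absExpFun_eq, expFun_eq, ← Finset.prod_mul_distrib]
    exact Finset.prod_congr rfl fun k _ => exp_sgn_half_eq (e k) (α k) (l k)

/-- A partition of `exp (b / 2 * |l|)` into multiples of `exp (b * l)` and `exp (-b * l)`. -/
def expPart (b : ℝ) (e : Bool) (l : ℝ) : ℂ :=
  twoExp (b / 2) (b / 2) l - 1 / 2 *
    (bif e then twoExp (5 * b / 2) (b / 2) l else twoExp (b / 2) (5 * b / 2) l)

lemma fLine_expPart {b : ℝ} (hb : 0 < b) (e : Bool) : FLine (expPart b e) := by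
  refine (fLine_twoExp (by positivity) (by positivity)).sub (FLine.const_mul ?_ _)
  cases e
  · exact fLine_twoExp (by positivity) (by positivity)
  · exact fLine_twoExp (by positivity) (by positivity)

/-- For `l ≥ 0` the corrections contribute `-½ exp(-3bl/2)` and `+½ exp(-3bl/2)`, and symmetrically
for `l < 0`. The rate `5b/2` is chosen for this cancellation. -/
lemma sum_expPart (b l : ℝ) :
    ∑ e : Bool, expPart b e l * (Real.exp (sgn e * b * l) : ℂ) =
      (Real.exp (b / 2 * |l|) : ℂ) := by
  rw [Fintype.sum_bool]
  rcases le_or_gt 0 l with h | h <;>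
    simp only [expPart, twoExp, cond_true, cond_false, h, not_le.2, if_true, if_false,
      abs_of_nonneg, abs_of_neg, sgn_true, sgn_false, sub_mul, mul_assoc, ← Complex.ofReal_mul,
      ← Real.exp_add] <;> ring_nf

lemma absExpFun_half_eq (b l : Fin d → ℝ) :
    absExpFun (fun k => b k / 2) l =
      ∑ e : Fin d → Bool, (∏ k, expPart (b k) (e k) (l k)) *
        expFun (fun k => sgn (e k) * b k) l := by
  simp only [absExpFun_eq, expFun_eq, ← Finset.prod_mul_distrib, ← sum_expPart]
  rw [Finset.prod_univ_sum, Fintype.piFinset_univ]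

/-- By `absExpFun_half_eq`, the image is the sum over sign patterns of the bounded multipliers `P e`
applied to the boundary values `y e`. -/
lemma mem_diamondDomain_absExpFun {b : Fin d → ℝ} (hb : ∀ k, 0 < b k)
    {x : (Fin d → ℝ) →ᵇ B} {y : (Fin d → Bool) → (Fin d → ℝ) →ᵇ B}
    (h : ∀ e, Ext (fun k => sgn (e k) * b k) x (y e)) :
    x ∈ diamondDomain (absExpFun fun k => b k / 2) := by
  set P : (Fin d → Bool) → (Fin d → ℝ) → ℂ := fun e l => ∏ k, expPart (b k) (e k) (l k)
  have hP : ∀ e, FL1 (P e) := fun e => fl1_prod fun k => fLine_expPart (hb k) (e k)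
  have he : ∀ F : (Fin d → ℝ) → ℂ, (absExpFun fun k => b k / 2) * F =
      ∑ e, P e * ((expFun fun k => sgn (e k) * b k) * F) := fun F => by
    ext l
    simp only [Pi.mul_apply, Finset.sum_apply, absExpFun_half_eq, Finset.sum_mul, mul_assoc, P]
  refine mem_diamondDomain_of_mult_platDil_eq (y := ∑ e, mult (P e) (y e)) (fun R => ?_)
    (h fun _ => true).isBUC_left ?_ fun n => ?_
  · rw [he]
    exact FL1.sum _ fun e _ => (hP e).mul (fl1_expFun_mul_plat _ _)
  · exact Finset.sum_induction _ IsBUC (fun _ _ => IsBUC.add) isBUC_zero fun e _ =>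
      isBUC_mult (hP e) _
  · rw [he, mult_sum _ fun e _ => (hP e).mul (fl1_expFun_mul_platDil n _), map_sum]
    rw [sum_apply]
    refine Finset.sum_congr rfl fun e _ => ?_
    rw [mult_mul (hP e) (fl1_expFun_mul_platDil n _),
      (h e).mult_eq (fl1_platDil n) (fl1_expFun_mul_platDil n _) rfl,
      mult_comm (hP e) (fl1_platDil n)]

lemma exists_mem_diamondDomain_inverse {α : Fin d → ℝ} {x : (Fin d → ℝ) →ᵇ B} (hx : IsUnit x)
    (h : x ∈ diamondDomain (expFun α)) :
    ∃ θ : ℝ, 0 < θ ∧ Ring.inverse x ∈ diamondDomain (expFun (θ • α)) := by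
  obtain ⟨v, hv⟩ := exists_ext_of_mem_diamondDomain h
  obtain ⟨θ, ⟨y, hy, -⟩, hθ⟩ := ((hv.inverse hx).and self_mem_nhdsWithin).exists
  exact ⟨θ, hθ, hy.mem_diamondDomain⟩

theorem inverse_mem_expClassPos {x : (Fin d → ℝ) →ᵇ B} (hx : IsUnit x) (h : x ∈ expClassPos) :
    Ring.inverse x ∈ expClassPos := by
  obtain ⟨α, hα, h⟩ := h
  obtain ⟨θ, hθ, hy⟩ := exists_mem_diamondDomain_inverse hx h
  exact ⟨θ • α, fun k => mul_pos hθ (hα k), hy⟩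

theorem inverse_mem_expClassNeg {x : (Fin d → ℝ) →ᵇ B} (hx : IsUnit x) (h : x ∈ expClassNeg) :
    Ring.inverse x ∈ expClassNeg := by
  obtain ⟨α, hα, h⟩ := h
  obtain ⟨θ, hθ, hy⟩ := exists_mem_diamondDomain_inverse hx h
  exact ⟨θ • α, fun k => mul_neg_of_pos_of_neg hθ (hα k), hy⟩

theorem inverse_mem_expClass {x : (Fin d → ℝ) →ᵇ B} (hx : IsUnit x) (h : x ∈ expClass) :
    Ring.inverse x ∈ expClass := by
  obtain ⟨α, hα, h⟩ := h
  have hv : ∀ e : Fin d → Bool, ∃ v, Ext (fun k => sgn (e k) * α k / 2) x v := fun e =>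
    exists_ext_of_mem_diamondDomain (diamondDomain_absExpFun_subset hα e h)
  choose v hv using hv
  -- There are finitely many sign patterns, so one `θ` serves all of them.
  have hev := (eventually_all.2 fun e => (hv e).inverse hx).and self_mem_nhdsWithin
  obtain ⟨θ, hθ', hθ⟩ := hev.exists
  have hθ : 0 < θ := hθ
  choose y hy using hθ'
  refine ⟨_, fun k => ?_, mem_diamondDomain_absExpFun (b := fun k => θ * α k / 2) (y := y)
    (fun k => by have := hα k; positivity) fun e => ?_⟩
  · have := hα k
    positivity
  · convert (hy e).1 using 2
    simp only [Pi.smul_apply, smul_eq_mul]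
    ring

/-! ### Weights on lattice sequences. -/

lemma tsum_pi_prod_eq_pow (d : ℕ) (f : ℤ → ℝ≥0∞) :
    ∑' n : Fin d → ℤ, ∏ k, f (n k) = (∑' n, f n) ^ d := by
  induction d with
  | zero => simp
  | succ d ih =>
    rw [← (Fin.consEquiv fun _ : Fin (d + 1) => ℤ).tsum_eq, ENNReal.tsum_prod']
    simp only [Fin.consEquiv, Equiv.coe_fn_mk, Fin.prod_univ_succ, Fin.cons_zero, Fin.cons_succ]
    simp_rw [ENNReal.tsum_mul_left]
    rw [ENNReal.tsum_mul_right, ih, pow_succ']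

/-- The sequence `n ↦ exp (-h |n|₁)`. -/
def expSeq (h : ℝ) (n : Fin d → ℤ) : ℝ≥0∞ := ∏ k, ENNReal.ofReal (Real.exp (-h * |(n k : ℝ)|))

lemma tsum_exp_neg_abs_lt_top {h : ℝ} (hh : 0 < h) :
    ∑' n : ℤ, ENNReal.ofReal (Real.exp (-h * |(n : ℝ)|)) < ⊤ := by
  set r := ENNReal.ofReal (Real.exp (-h)) with hr
  have hr1 : r < 1 := by
    rw [hr, ENNReal.ofReal_lt_one, Real.exp_lt_one_iff]; linarith
  have he : ∀ n : ℤ, ENNReal.ofReal (Real.exp (-h * |(n : ℝ)|)) = r ^ n.natAbs := fun n => by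
    rw [hr, ← ENNReal.ofReal_pow (Real.exp_nonneg _), ← Real.exp_nat_mul, Nat.cast_natAbs,
      Int.cast_abs, mul_comm]
  have hinj : Function.Injective fun n : ℤ => (n.natAbs, decide (0 ≤ n)) := fun m n h => by
    simp only [Prod.mk.injEq, decide_eq_decide] at h
    omega
  calc ∑' n : ℤ, ENNReal.ofReal (Real.exp (-h * |(n : ℝ)|))
      = ∑' n : ℤ, r ^ (n.natAbs, decide (0 ≤ n)).1 := tsum_congr he
    _ ≤ ∑' p : ℕ × Bool, r ^ p.1 :=
        ENNReal.tsum_comp_le_tsum_of_injective hinj fun p : ℕ × Bool => r ^ p.1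
    _ = 2 * (1 - r)⁻¹ := by
        rw [ENNReal.tsum_prod']
        simp only [tsum_fintype, Finset.sum_const, Finset.card_univ, Fintype.card_bool,
          nsmul_eq_mul]
        rw [ENNReal.tsum_mul_left, ENNReal.tsum_geometric]; simp
    _ < ⊤ := by
        refine ENNReal.mul_lt_top (by simp) ?_
        rw [ENNReal.inv_lt_top, tsub_pos_iff_lt]
        exact hr1

lemma tsum_expSeq_lt_top {h : ℝ} (hh : 0 < h) : ∑' n : Fin d → ℤ, expSeq h n < ⊤ := by
  simp only [expSeq]
  rw [tsum_pi_prod_eq_pow d fun n : ℤ => ENNReal.ofReal (Real.exp (-h * |(n : ℝ)|))]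
  exact ENNReal.pow_lt_top (tsum_exp_neg_abs_lt_top hh)

/-- Convolution of sequences on the integer lattice. -/
def seqConv (b c : (Fin d → ℤ) → ℝ≥0∞) (m : Fin d → ℤ) : ℝ≥0∞ := ∑' n, b n * c (m - n)

lemma tsum_seqConv (b c : (Fin d → ℤ) → ℝ≥0∞) :
    ∑' m, seqConv b c m = (∑' n, b n) * ∑' n, c n := by
  simp only [seqConv]
  rw [ENNReal.tsum_comm, ← ENNReal.tsum_mul_right]
  refine tsum_congr fun n => ?_
  rw [ENNReal.tsum_mul_left, show ∑' i, c (i - n) = _ from (Equiv.subRight n).tsum_eq c]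

/-- The properties of the weights on sequences `(Fin d → ℤ) → ℝ≥0∞` that make the associated
class of functions inverse closed. -/
structure IsWeight (N : ((Fin d → ℤ) → ℝ≥0∞) → ℝ≥0∞) : Prop where
  mono : ∀ {b c}, b ≤ c → N b ≤ N c
  tsum_le : ∀ {ι : Type} (b : ι → (Fin d → ℤ) → ℝ≥0∞), N (fun n => ∑' i, b i n) ≤ ∑' i, N (b i)
  const_mul_le : ∀ (C : ℝ≥0∞) b, N (fun n => C * b n) ≤ C * N b
  le : ∀ b, ∑' n, b n ≤ N b
  -- In each term one factor enters only through its `ℓ¹` sum; this is why smallness in `ℓ¹`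
  -- suffices later.
  conv_le : ∃ K : ℝ≥0, ∀ b c, N (seqConv b c) ≤ K * (N b * ∑' n, c n + (∑' n, b n) * N c)
  expSeq_lt_top : ∀ h > 0, N (expSeq h) < ⊤

lemma isWeight_tsum : IsWeight fun b : (Fin d → ℤ) → ℝ≥0∞ => ∑' n, b n where
  mono h := ENNReal.tsum_le_tsum h
  tsum_le b := (ENNReal.tsum_comm).le
  const_mul_le C b := ENNReal.tsum_mul_left.le
  le b := le_rfl
  conv_le := ⟨1, fun b c => by
    rw [tsum_seqConv, ENNReal.coe_one, one_mul]
    exact le_self_add⟩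
  expSeq_lt_top h hh := tsum_expSeq_lt_top hh

/-- The least majorant of a sequence that is radially decreasing for the maximum norm. -/
def radMaj (b : (Fin d → ℤ) → ℝ≥0∞) (k : Fin d → ℤ) : ℝ≥0∞ :=
  ⨆ n : Fin d → ℤ, ⨆ _ : ‖k‖ ≤ ‖n‖, b n

lemma le_radMaj {b : (Fin d → ℤ) → ℝ≥0∞} {k n : Fin d → ℤ} (h : ‖k‖ ≤ ‖n‖) : b n ≤ radMaj b k :=
  le_iSup₂_of_le n h le_rfl

/-- Componentwise division by two, rounding towards zero. -/
def halve (k : Fin d → ℤ) (i : Fin d) : ℤ := (k i).tdiv 2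

lemma two_mul_norm_halve_le (k : Fin d → ℤ) : 2 * ‖halve k‖ ≤ ‖k‖ := by
  have : ‖halve k‖ ≤ ‖k‖ / 2 := by
    refine (pi_norm_le_iff_of_nonneg (by positivity)).2 fun i => ?_
    have h1 := norm_le_pi_norm k i
    have h2 : 2 * ‖halve k i‖ ≤ ‖k i‖ := by
      rw [Int.norm_eq_abs, Int.norm_eq_abs]
      have : 2 * |halve k i| ≤ |k i| := by
        rw [halve, Int.abs_eq_natAbs, Int.abs_eq_natAbs, Int.natAbs_tdiv]
        have := Nat.div_mul_le_self (k i).natAbs 2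
        change 2 * (((k i).natAbs / 2 : ℕ) : ℤ) ≤ _
        omega
      exact_mod_cast this
    linarith
  linarith

/-- A lattice point is determined by its half and its remainders in `{-1, 0, 1}`, so `halve` is at
most `3^d` to one. -/
lemma tsum_halve_le (f : (Fin d → ℤ) → ℝ≥0∞) :
    ∑' k, f (halve k) ≤ 3 ^ d * ∑' k, f k := by
  have hinj : Function.Injective fun k : Fin d → ℤ =>
      (halve k, fun i => (⟨(k i).tmod 2, Finset.mem_Icc.2 (by
        rcases Int.tmod_two_eq (k i) with h | h | h <;> omega)⟩ : Finset.Icc (-1 : ℤ) 1)) :=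
    fun m n h => by
      simp only [Prod.mk.injEq] at h
      ext i
      have h1 : (m i).tdiv 2 = (n i).tdiv 2 := congrFun h.1 i
      have h2 : (m i).tmod 2 = (n i).tmod 2 := congrArg Subtype.val (congrFun h.2 i)
      rw [← Int.mul_tdiv_add_tmod (m i) 2, h1, h2, Int.mul_tdiv_add_tmod]
  refine (ENNReal.tsum_comp_le_tsum_of_injective hinj
    fun p : (Fin d → ℤ) × (Fin d → Finset.Icc (-1 : ℤ) 1) => f p.1).trans ?_
  rw [ENNReal.tsum_prod', ← ENNReal.tsum_mul_left]
  refine ENNReal.tsum_le_tsum fun k => ?_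
  simp

/-- Since `2‖halve k‖ ≤ ‖m‖`, at least one of `n` and `m - n` has norm at least `‖halve k‖`. -/
lemma seqConv_le_of_norm_le {b c : (Fin d → ℤ) → ℝ≥0∞} {k m : Fin d → ℤ} (h : ‖k‖ ≤ ‖m‖) :
    seqConv b c m ≤ radMaj b (halve k) * ∑' n, c n + (∑' n, b n) * radMaj c (halve k) := by
  have h1 : ∀ n, b n * c (m - n) ≤
      radMaj b (halve k) * c (m - n) + b n * radMaj c (halve k) := fun n => by
    by_cases hn : ‖halve k‖ ≤ ‖n‖
    · exact (mul_le_mul_left (le_radMaj hn) _).trans le_self_add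
    · refine (mul_le_mul_right (le_radMaj ?_) _).trans le_add_self
      have h2 := two_mul_norm_halve_le k
      have h3 := norm_add_le (m - n) n
      rw [sub_add_cancel] at h3
      push Not at hn
      linarith
  refine (ENNReal.tsum_le_tsum h1).trans ?_
  rw [ENNReal.tsum_add, ENNReal.tsum_mul_left, ENNReal.tsum_mul_right,
    show ∑' i, c (m - i) = _ from (Equiv.subLeft m).tsum_eq c]

lemma norm_le_sum_abs (n : Fin d → ℤ) : ‖n‖ ≤ ∑ k, |(n k : ℝ)| := by
  refine (pi_norm_le_iff_of_nonneg (by positivity)).2 fun i => ?_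
  rw [Int.norm_eq_abs]
  exact Finset.single_le_sum (f := fun k => |(n k : ℝ)|) (fun k _ => abs_nonneg _)
    (Finset.mem_univ i)

lemma sum_abs_le_mul_norm (n : Fin d → ℤ) : ∑ k, |(n k : ℝ)| ≤ d * ‖n‖ := by
  have : ∀ k ∈ Finset.univ, |(n k : ℝ)| ≤ ‖n‖ := fun k _ => by
    rw [← Int.norm_eq_abs]; exact norm_le_pi_norm n k
  simpa using Finset.sum_le_card_nsmul _ _ _ this

lemma expSeq_eq (h : ℝ) (n : Fin d → ℤ) :
    expSeq h n = ENNReal.ofReal (Real.exp (-h * ∑ k, |(n k : ℝ)|)) := by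
  rw [expSeq, ← ENNReal.ofReal_prod_of_nonneg fun _ _ => Real.exp_nonneg _, ← Real.exp_sum,
    Finset.mul_sum]

lemma isWeight_beurling : IsWeight fun b : (Fin d → ℤ) → ℝ≥0∞ => ∑' k, radMaj b k where
  mono h := ENNReal.tsum_le_tsum fun k => iSup₂_mono fun n _ => h n
  tsum_le b := by
    rw [ENNReal.tsum_comm]
    exact ENNReal.tsum_le_tsum fun k => iSup₂_le fun n hn =>
      ENNReal.tsum_le_tsum fun i => le_radMaj hn
  const_mul_le C b := by
    rw [← ENNReal.tsum_mul_left]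
    exact ENNReal.tsum_le_tsum fun k => iSup₂_le fun n hn => mul_le_mul_right (le_radMaj hn) _
  le b := ENNReal.tsum_le_tsum fun k => le_radMaj le_rfl
  conv_le := ⟨3 ^ d, fun b c => by
    calc ∑' k, radMaj (seqConv b c) k
        ≤ ∑' k, (radMaj b (halve k) * ∑' n, c n + (∑' n, b n) * radMaj c (halve k)) :=
          ENNReal.tsum_le_tsum fun k => iSup₂_le fun m hm => seqConv_le_of_norm_le hm
      _ = (∑' k, radMaj b (halve k)) * ∑' n, c n + (∑' n, b n) * ∑' k, radMaj c (halve k) := by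
          rw [ENNReal.tsum_add, ENNReal.tsum_mul_left, ENNReal.tsum_mul_right]
      _ ≤ (3 ^ d * ∑' k, radMaj b k) * ∑' n, c n +
            (∑' n, b n) * (3 ^ d * ∑' k, radMaj c k) := by
          gcongr
          · exact tsum_halve_le _
          · exact tsum_halve_le _
      _ = _ := by push_cast; ring⟩
  expSeq_lt_top h hh := by
    -- The lost factor compares the `ℓ¹` norm with the maximum norm; `d + 1` in place of `d` covers
    -- dimension zero.
    have hd : 0 < h / (d + 1) := by positivity
    refine lt_of_le_of_lt (ENNReal.tsum_le_tsum fun k => iSup₂_le fun n hn => ?_)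
      (tsum_expSeq_lt_top (d := d) hd)
    rw [expSeq_eq, expSeq_eq]
    refine ENNReal.ofReal_le_ofReal (Real.exp_le_exp.2 ?_)
    have h1 : ∑ k, |(n k : ℝ)| ≥ ‖k‖ := hn.trans (norm_le_sum_abs n)
    have h2 := sum_abs_le_mul_norm k
    have h3 : h / (d + 1) * ∑ i, |(k i : ℝ)| ≤ h / (d + 1) * ((d + 1) * ‖k‖) := by
      gcongr
      nlinarith [norm_nonneg k]
    have h4 : h / (d + 1) * (((d : ℝ) + 1) * ‖k‖) = h * ‖k‖ := by field_simp
    nlinarith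

/-! ### The lattice partition of unity and the lattice parts. -/

lemma sum_triangle_sub_eq_one (S : Finset ℤ) (l : ℝ) (h : ∀ n : ℤ, |l - n| < 1 → n ∈ S) :
    ∑ n ∈ S, triangle (l - n) = 1 := by
  classical
  set T : Finset ℤ := {⌊l⌋, ⌊l⌋ + 1} with hT
  have h0 := Int.floor_le l
  have h1 := Int.lt_floor_add_one l
  have hzero : ∀ n : ℤ, n ∉ T → triangle (l - n) = 0 := fun n hn => by
    refine triangle_eq_zero ?_
    by_contra! hlt
    rw [abs_lt] at hlt
    have h2 : (n : ℝ) < (⌊l⌋ + 2 : ℤ) := by push_cast; linarith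
    have h3 : ((⌊l⌋ - 1 : ℤ) : ℝ) < n := by push_cast; linarith
    have h2 := Int.cast_lt.1 h2
    have h3 := Int.cast_lt.1 h3
    simp only [hT, Finset.mem_insert, Finset.mem_singleton] at hn
    omega
  have e1 : ∑ n ∈ S, triangle (l - n) = ∑ n ∈ S ∪ T, triangle (l - n) :=
    Finset.sum_subset Finset.subset_union_left fun n _ hn => triangle_eq_zero (by
      by_contra! hlt; exact hn (h n hlt))
  have e2 : ∑ n ∈ T, triangle (l - n) = ∑ n ∈ S ∪ T, triangle (l - n) :=
    Finset.sum_subset Finset.subset_union_right fun n _ hn => hzero n hn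
  rw [e1, ← e2, hT, Finset.sum_pair (by simp), triangle_eq, triangle_eq, abs_of_nonneg,
    abs_of_nonpos] <;> push_cast
  · ring
  · linarith
  · linarith
  · rw [abs_le]; constructor <;> linarith
  · rw [abs_le]; constructor <;> linarith

/-- The point of `ℝ^d` given by a lattice point. -/
def latPt (n : Fin d → ℤ) (k : Fin d) : ℝ := n k

lemma latPt_sub (m n : Fin d → ℤ) : latPt (m - n) = latPt m - latPt n := by
  ext k; simp [latPt]

lemma latPt_add (m n : Fin d → ℤ) : latPt (m + n) = latPt m + latPt n := by
  ext k; simp [latPt]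

lemma sum_tri_sub_eq_one (S : Finset ℤ) (l : Fin d → ℝ)
    (h : ∀ k, ∀ n : ℤ, |l k - n| < 1 → n ∈ S) :
    ∑ n ∈ Fintype.piFinset fun _ : Fin d => S, tri (l - latPt n) = 1 := by
  simp only [tri, Pi.sub_apply, latPt]
  rw [← Finset.prod_univ_sum (fun _ => S) fun k (n : ℤ) => (triangle (l k - n) : ℂ)]
  refine Finset.prod_eq_one fun k _ => ?_
  rw [← Complex.ofReal_sum, sum_triangle_sub_eq_one S (l k) (h k), Complex.ofReal_one]

lemma tri_eq_zero {l : Fin d → ℝ} {k : Fin d} (h : 1 ≤ |l k|) : tri l = 0 :=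
  Finset.prod_eq_zero (Finset.mem_univ k) (by rw [triangle_eq_zero h, Complex.ofReal_zero])

/-- The part of `u` with spectrum near the lattice point `n`. -/
def latPart (n : Fin d → ℤ) : ((Fin d → ℝ) →ᵇ B) →L[ℂ] ((Fin d → ℝ) →ᵇ B) :=
  mult fun l => tri (l - latPt n)

lemma coeffNorm_latPt (n : Fin d → ℤ) (u : (Fin d → ℝ) →ᵇ B) :
    coeffNorm (latPt n) u = ‖latPart n u‖ₑ := coeffNorm_eq _ u

/-- The series converges absolutely. Its sum is identified by cut-offs: under `platDil m` only
finitely many parts survive, and there the triangles add up to one. -/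
lemma hasSum_latPart {u : (Fin d → ℝ) →ᵇ B} (h : ∑' n, ‖latPart n u‖ₑ ≠ ⊤) :
    HasSum (fun n => latPart n u) u := by
  have hs : Summable fun n => latPart n u := (tsum_enorm_ne_top_iff_summable_norm.1 h).of_norm
  have : ∑' n, latPart n u = u := by
    refine eq_of_mult_platDil_eq fun m => ?_
    have hm := fl1_platDil (d := d) m
    have ht : ∀ n : Fin d → ℤ, FL1 fun l => tri (l - latPt n) := fun n => fl1_tri.shift _
    -- `platDil m` is supported in `|l k| ≤ 2m + 2`, and each triangle has radius one.
    set S : Finset ℤ := Finset.Icc (-(2 * m + 3)) (2 * m + 3)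
    have hz : ∀ n ∉ Fintype.piFinset fun _ : Fin d => S, mult (platDil m) (latPart n u) = 0 := by
      intro n hn
      rw [Fintype.mem_piFinset] at hn
      push Not at hn
      obtain ⟨k, hk⟩ := hn
      rw [latPart, ← mult_mul hm (ht n)]
      have : (platDil m * fun l => tri (l - latPt n)) = (0 : (Fin d → ℝ) → ℂ) := by
        ext l
        rw [Pi.mul_apply, Pi.zero_apply]
        by_cases hl : 2 * ((m : ℝ) + 1) ≤ |l k|
        · rw [platDil_eq_zero hl, zero_mul]
        · rw [tri_eq_zero (k := k), mul_zero]
          push Not at hl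
          have h1 : ((2 * m + 4 : ℤ) : ℝ) ≤ |(n k : ℝ)| := by
            rw [← Int.cast_abs, Int.cast_le]
            by_contra! hlt
            rw [abs_lt] at hlt
            exact hk (Finset.mem_Icc.2 ⟨by omega, by omega⟩)
          push_cast at h1
          have h2 := abs_sub_abs_le_abs_sub (n k : ℝ) (l k)
          rw [abs_sub_comm] at h2
          simp only [Pi.sub_apply, latPt]
          linarith
      rw [this, mult_zero]; rfl
    rw [(mult (platDil m)).map_tsum hs, tsum_eq_sum hz]
    have e1 : ∀ n, mult (platDil m) (latPart n u) =
        mult (platDil m * fun l => tri (l - latPt n)) u := fun n => (mult_mul hm (ht n) u).symm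
    simp only [e1]
    rw [← sum_apply, ← mult_sum _ fun n _ => hm.mul (ht n)]
    congr 2
    ext l
    rw [← Finset.mul_sum, Pi.mul_apply, Finset.sum_apply]
    by_cases hl : ∃ k, 2 * ((m : ℝ) + 1) ≤ |l k|
    · obtain ⟨k, hk⟩ := hl
      rw [platDil_eq_zero hk, zero_mul]
    · push Not at hl
      rw [sum_tri_sub_eq_one S l, mul_one]
      intro k n hn
      have h1 := hl k
      rw [abs_lt] at h1 hn
      have h2 : (n : ℝ) < (2 * m + 3 : ℤ) := by push_cast; linarith
      have h3 : ((-(2 * m + 3) : ℤ) : ℝ) < n := by push_cast; linarith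
      exact Finset.mem_Icc.2 ⟨(Int.cast_lt.1 h3).le, (Int.cast_lt.1 h2).le⟩
  rw [← this]
  convert hs.hasSum using 1
  ext1 n
  rw [this]

lemma enorm_mult_shift_le {G : (Fin d → ℝ) → ℂ} (hG : FL1 G) (a : Fin d → ℝ)
    (u : (Fin d → ℝ) →ᵇ B) : ‖mult (fun l => G (l - a)) u‖ₑ ≤
      ‖(mult G : ((Fin d → ℝ) →ᵇ B) →L[ℂ] _)‖ₑ * ‖u‖ₑ := by
  rw [← ofReal_norm, ← ofReal_norm, ← ofReal_norm u, ← ENNReal.ofReal_mul (norm_nonneg _)]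
  exact ENNReal.ofReal_le_ofReal (norm_mult_shift_le hG a u)

/-- The lattice points of maximum norm at most two. -/
def nearPts (d : ℕ) : Finset (Fin d → ℤ) := Fintype.piFinset fun _ => Finset.Icc (-2) 2

/-- The support of `tri (· - b)` is within distance two of `a`, where the shifted triangles indexed
by `nearPts` add up to one. This compares integrals over unit cubes with values at lattice points.
-/
lemma coeffNorm_le_sum {a b : Fin d → ℝ} (h : ∀ k, |a k - b k| ≤ 1) (u : (Fin d → ℝ) →ᵇ B) :
    coeffNorm b u ≤ ‖(mult tri : ((Fin d → ℝ) →ᵇ B) →L[ℂ] _)‖ₑ *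
      ∑ j ∈ nearPts d, coeffNorm (a + latPt j) u := by
  have ht : ∀ c : Fin d → ℝ, FL1 fun l => tri (l - c) := fun c => fl1_tri.shift c
  have e : (fun l => tri (l - b)) =
      (fun l => tri (l - b)) * ∑ j ∈ nearPts d, fun l => tri (l - (a + latPt j)) := by
    ext l
    rw [Pi.mul_apply, Finset.sum_apply]
    by_cases hl : ∃ k, 1 ≤ |(l - b) k|
    · obtain ⟨k, hk⟩ := hl
      rw [tri_eq_zero hk, zero_mul]
    · push Not at hl
      simp only [← sub_sub]
      rw [nearPts, sum_tri_sub_eq_one, mul_one]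
      intro k n hn
      have h1 := hl k
      have h2 := h k
      simp only [Pi.sub_apply] at h1 hn
      rw [abs_lt] at h1 hn
      rw [abs_le] at h2
      have h2 : (n : ℝ) < (3 : ℤ) := by push_cast; linarith
      have h3 : ((-3 : ℤ) : ℝ) < n := by push_cast; linarith
      have := Int.cast_lt.1 h2
      have := Int.cast_lt.1 h3
      exact Finset.mem_Icc.2 ⟨by omega, by omega⟩
  simp only [coeffNorm_eq]
  rw [e, mult_mul (ht b) (FL1.sum _ fun j _ => ht _)]
  refine (enorm_mult_shift_le fl1_tri b _).trans (mul_le_mul_right ?_ _)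
  rw [mult_sum _ fun j _ => ht _, sum_apply]
  exact enorm_sum_le _ _

/-- A supremum of continuous functions of `a` is lower semicontinuous. -/
lemma measurable_coeffNorm (u : (Fin d → ℝ) →ᵇ B) : Measurable fun a => coeffNorm a u := by
  suffices h : ∀ s, Continuous fun a => conv (phiD a) u s from
    (lowerSemicontinuous_iSup fun s => (h s).enorm.lowerSemicontinuous).measurable
  intro s
  have : ∀ a, conv (phiD a) u s = ∫ t, phiD a t • u (s - t) := fun a => by
    rw [← cv_apply_conv (integrable_phiD a), cv_apply (integrable_phiD a)]
  simp only [this]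
  simp only [phiD_eq]
  refine continuous_of_dominated (bound := fun t : Fin d → ℝ => ‖∏ k, phi (t k)‖ * ‖u‖)
    (fun a => ?_) (fun a => Eventually.of_forall fun t => ?_)
    (integrable_prod_phi.norm.mul_const _) (Eventually.of_forall fun t => ?_)
  · have := (integrable_smul_bcf (integrable_phiD a) u s).aestronglyMeasurable
    simpa only [phiD_eq] using this
  · rw [norm_smul, norm_mul, norm_chr, one_mul]
    exact mul_le_mul_of_nonneg_left (u.norm_coe_le_norm _) (norm_nonneg _)
  · have : Continuous fun a => chr a t := continuous_chr_left t
    fun_prop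

/-- The half-open unit cube at a lattice point. -/
def latCube (n : Fin d → ℤ) : Set (Fin d → ℝ) := {a | ∀ k, ⌊a k⌋ = n k}

lemma latCube_eq (n : Fin d → ℤ) :
    latCube n = Set.univ.pi fun k => Set.Ico (n k : ℝ) (n k + 1) := by
  ext a
  simp [latCube, Int.floor_eq_iff]

lemma measurableSet_latCube (n : Fin d → ℤ) : MeasurableSet (latCube n) := by
  rw [latCube_eq]
  exact MeasurableSet.univ_pi fun _ => measurableSet_Ico

lemma volume_latCube (n : Fin d → ℤ) : volume (latCube n) = 1 := by
  rw [latCube_eq, volume_pi_pi]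
  simp

lemma lintegral_eq_tsum_latCube (f : (Fin d → ℝ) → ℝ≥0∞) :
    ∫⁻ a, f a = ∑' n, ∫⁻ a in latCube n, f a := by
  rw [← lintegral_iUnion measurableSet_latCube]
  · have : ⋃ n : Fin d → ℤ, latCube n = Set.univ :=
      Set.eq_univ_of_forall fun a => Set.mem_iUnion.2 ⟨fun k => ⌊a k⌋, fun _ => rfl⟩
    rw [this, Measure.restrict_univ]
  · intro m n hmn
    refine Set.disjoint_left.2 fun a ha hb => hmn ?_
    ext k
    rw [← ha k, hb k]

lemma abs_sub_latPt_le {n : Fin d → ℤ} {a : Fin d → ℝ} (ha : a ∈ latCube n) (k : Fin d) :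
    |a k - latPt n k| ≤ 1 := by
  have h1 := Int.floor_le (a k)
  have h2 := Int.lt_floor_add_one (a k)
  rw [ha k] at h1 h2
  rw [abs_le, latPt]
  constructor <;> linarith

/-- On each unit cube the integrand and the lattice value dominate each other up to a finite sum of
shifts, by `coeffNorm_le_sum` in both directions. -/
lemma wienerNorm_lt_top_iff (u : (Fin d → ℝ) →ᵇ B) :
    wienerNorm u < ⊤ ↔ ∑' n, ‖latPart n u‖ₑ < ⊤ := by
  set C : ℝ≥0∞ := ‖(mult tri : ((Fin d → ℝ) →ᵇ B) →L[ℂ] _)‖ₑ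
  have hC : C < ⊤ := enorm_lt_top
  simp only [← coeffNorm_latPt]
  constructor
  · intro h
    have h1 : ∀ n : Fin d → ℤ, coeffNorm (latPt n) u ≤
        ∫⁻ a in latCube n, C * ∑ j ∈ nearPts d, coeffNorm (a + latPt j) u := fun n => by
      calc coeffNorm (latPt n) u = ∫⁻ a in latCube n, coeffNorm (latPt n) u := by
            rw [setLIntegral_const, volume_latCube, mul_one]
        _ ≤ _ := setLIntegral_mono' (measurableSet_latCube n) fun a ha =>
            coeffNorm_le_sum (abs_sub_latPt_le ha) u
    refine lt_of_le_of_lt (ENNReal.tsum_le_tsum h1) ?_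
    have hm : ∀ j : Fin d → ℤ, Measurable fun a => coeffNorm (a + latPt j) u := fun j =>
      (measurable_coeffNorm u).comp (measurable_id.add_const _)
    rw [← lintegral_eq_tsum_latCube, lintegral_const_mul _ (Finset.measurable_fun_sum _
      fun j _ => hm j), lintegral_finsetSum _ fun j _ => hm j]
    refine ENNReal.mul_lt_top hC (ENNReal.sum_lt_top.2 fun j _ => ?_)
    rw [lintegral_add_right_eq_self fun a => coeffNorm a u]
    exact h
  · intro h
    have h1 : ∀ n : Fin d → ℤ, ∫⁻ a in latCube n, coeffNorm a u ≤
        C * ∑ j ∈ nearPts d, coeffNorm (latPt (n + j)) u := fun n => by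
      calc ∫⁻ a in latCube n, coeffNorm a u
          ≤ ∫⁻ a in latCube n, C * ∑ j ∈ nearPts d, coeffNorm (latPt (n + j)) u :=
            setLIntegral_mono' (measurableSet_latCube n) fun a ha => by
              simp only [latPt_add]
              exact coeffNorm_le_sum (fun k => by
                rw [abs_sub_comm]; exact abs_sub_latPt_le ha k) u
        _ = _ := by rw [setLIntegral_const, volume_latCube, mul_one]
    rw [wienerNorm, lintegral_eq_tsum_latCube]
    refine lt_of_le_of_lt (ENNReal.tsum_le_tsum h1) ?_
    rw [ENNReal.tsum_mul_left, Summable.tsum_finsetSum fun _ _ => ENNReal.summable]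
    refine ENNReal.mul_lt_top hC (ENNReal.sum_lt_top.2 fun j _ => ?_)
    rw [show ∑' n, coeffNorm (latPt (n + j)) u = _ from
      (Equiv.addRight j).tsum_eq fun n => coeffNorm (latPt n) u]
    exact h

lemma beurlingNorm_eq (u : (Fin d → ℝ) →ᵇ B) :
    beurlingNorm u = ∑' k, radMaj (fun n => ‖latPart n u‖ₑ) k := by
  simp only [← coeffNorm_latPt]
  rfl

lemma enorm_mul_le_mul {R : Type*} [NormedRing R] (u v : R) : ‖u * v‖ₑ ≤ ‖u‖ₑ * ‖v‖ₑ := by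
  rw [← ofReal_norm, ← ofReal_norm, ← ofReal_norm v, ← ENNReal.ofReal_mul (norm_nonneg _)]
  exact ENNReal.ofReal_le_ofReal (norm_mul_le u v)

lemma enorm_modu (a : Fin d → ℝ) (u : (Fin d → ℝ) →ᵇ B) : ‖modu a u‖ₑ = ‖u‖ₑ := by
  rw [← ofReal_norm, norm_modu, ofReal_norm]

/-! ### Extension bounds and decay of lattice parts. -/

/-- The translates of `z` extend holomorphically in all diagonal directions of size `h`, with
bound `b`. -/
def HasExts (h : ℝ) (z : (Fin d → ℝ) →ᵇ B) (b : ℝ≥0∞) : Prop :=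
  ∀ e : Fin d → Bool, ∃ v, Ext (fun k => h * sgn (e k)) z v ∧ ‖v‖ₑ ≤ b

lemma HasExts.mul {h : ℝ} {z z' : (Fin d → ℝ) →ᵇ B} {b b' : ℝ≥0∞} (hz : HasExts h z b)
    (hz' : HasExts h z' b') : HasExts h (z * z') (b * b') := fun e => by
  obtain ⟨v, hv, hb⟩ := hz e
  obtain ⟨v', hv', hb'⟩ := hz' e
  exact ⟨v * v', hv.mul hv', (enorm_mul_le_mul v v').trans (mul_le_mul' hb hb')⟩

lemma hasExts_one (h : ℝ) : HasExts h (1 : (Fin d → ℝ) →ᵇ B) ‖(1 : (Fin d → ℝ) →ᵇ B)‖ₑ :=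
  fun _ => ⟨1, ⟨fun _ => 1, ⟨differentiableOn_const _, continuousOn_const,
    fun _ _ _ => (trans_one _).symm, fun _ _ => continuous_const.congr fun t => (trans_one t).symm⟩,
    rfl, rfl⟩, le_rfl⟩

-- The constant is taken at width one and does not depend on `h`, since `Ext.restrict` preserves
-- bounds. This uniformity lets the truncation be chosen before the width.
variable (d B) in
lemma exists_hasExts_of_mult_plat_eq : ∃ C : ℝ≥0, 1 ≤ C ∧ ∀ u : (Fin d → ℝ) →ᵇ B,
    mult (plat 0) u = u → ∀ h : ℝ, 0 < h → h ≤ 1 → HasExts h u (C * ‖u‖ₑ) := by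
  choose C hC hC' using fun e : Fin d → Bool =>
    exists_ext_of_mult_plat_eq (B := B) 0 (fun k => sgn (e k))
  have hle : ∀ e, C e ≤ ∑ e, C e := fun e =>
    Finset.single_le_sum (f := C) (fun e _ => zero_le_one.trans (hC e)) (Finset.mem_univ e)
  have h1 : 1 ≤ ∑ e, C e := (hC fun _ => true).trans (hle _)
  refine ⟨(∑ e, C e).toNNReal, Real.one_le_toNNReal.2 h1, fun u hu h h0 hh1 e => ?_⟩
  obtain ⟨v, hv, hv'⟩ := hC' e u hu
  obtain ⟨v', h2, h3⟩ := hv.restrict h0 hh1 (M := (∑ e, C e) * ‖u‖)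
    (le_mul_of_one_le_left (norm_nonneg _) h1)
    (hv'.trans (mul_le_mul_of_nonneg_right (hle e) (norm_nonneg _)))
  refine ⟨v', h2, ?_⟩
  change _ ≤ ENNReal.ofReal (∑ e, C e) * ‖u‖ₑ
  rw [← ofReal_norm, ← ofReal_norm u, ← ENNReal.ofReal_mul (zero_le_one.trans h1)]
  exact ENNReal.ofReal_le_ofReal h3

/-- Left multiples of `w` by functions satisfying `HasExts` have lattice parts controlled
by `g`. -/
def Decays (h : ℝ) (w : (Fin d → ℝ) →ᵇ B) (g : (Fin d → ℤ) → ℝ≥0∞) : Prop :=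
  ∀ z b, HasExts h z b → ∀ m, ‖latPart m (z * w)‖ₑ ≤ b * g m

/-- The arbitrary left factor in `Decays` absorbs `q`, so only its extension bound enters. -/
lemma Decays.hasExts_mul {h : ℝ} {w q : (Fin d → ℝ) →ᵇ B} {g : (Fin d → ℤ) → ℝ≥0∞} {b : ℝ≥0∞}
    (hw : Decays h w g) (hq : HasExts h q b) : Decays h (q * w) fun m => b * g m :=
  fun z b' hz m => by
    rw [← mul_assoc, ← mul_assoc]
    exact hw _ _ (hz.mul hq) m

lemma plat_mul_tri : (plat 0 * tri : (Fin d → ℝ) → ℂ) = tri := by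
  ext l
  rw [Pi.mul_apply]
  by_cases hl : ∃ k, 1 ≤ |l k|
  · obtain ⟨k, hk⟩ := hl
    rw [tri_eq_zero hk, mul_zero]
  · push Not at hl
    rw [plat_eq_one fun k => (hl k).le.trans (by simp), one_mul]

lemma fl1_expFun_mul_tri (α : Fin d → ℝ) : FL1 (expFun α * tri) := by
  rw [← plat_mul_tri, ← mul_assoc]
  exact (fl1_expFun_mul_plat 0 α).mul fl1_tri

lemma expFun_neg_mul (α l : Fin d → ℝ) : expFun α l * expFun (-α) l = 1 := by
  rw [expFun, expFun, ← Complex.ofReal_mul, ← Real.exp_add]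
  simp

lemma expFun_sub (α l m : Fin d → ℝ) : expFun α (l - m) = expFun α l * expFun (-α) m := by
  rw [expFun, expFun, expFun, ← Complex.ofReal_mul, ← Real.exp_add]
  congr 2
  simp only [Pi.sub_apply, Pi.neg_apply, mul_sub, neg_mul, Finset.sum_sub_distrib,
    Finset.sum_neg_distrib]
  ring

/-- For given `m`, take the sign pattern with `α·m = h|m|₁`. Shifting the contour in this direction
replaces the symbol near `m` by `exp(-α·m)` times a shift of a fixed symbol. -/
lemma exists_decays_one (h : ℝ) : ∃ C : ℝ≥0∞, C < ⊤ ∧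
    Decays h (1 : (Fin d → ℝ) →ᵇ B) fun m => C * expSeq h m := by
  set α : (Fin d → Bool) → Fin d → ℝ := fun e k => h * sgn (e k)
  set T : (Fin d → Bool) → ((Fin d → ℝ) →ᵇ B) →L[ℂ] ((Fin d → ℝ) →ᵇ B) := fun e =>
    mult (expFun (-α e) * tri)
  refine ⟨∑ e, ‖T e‖ₑ, ENNReal.sum_lt_top.2 fun e _ => enorm_lt_top, fun z b hz m => ?_⟩
  set e : Fin d → Bool := fun k => decide (0 ≤ m k) with he
  obtain ⟨v, hv, hb⟩ := hz e
  have hα : ∑ k, α e k * latPt m k = h * ∑ k, |(m k : ℝ)| := by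
    rw [Finset.mul_sum]
    refine Finset.sum_congr rfl fun k _ => ?_
    rw [mul_assoc]
    congr 1
    by_cases hk : 0 ≤ m k
    · have : (0 : ℝ) ≤ m k := by exact_mod_cast hk
      simp [he, hk, latPt, abs_of_nonneg this]
    · have : (m k : ℝ) < 0 := by exact_mod_cast not_le.1 hk
      simp [he, hk, latPt, abs_of_neg this]
  have hG := fl1_expFun_mul_tri (-α e)
  have hψ : (fun l => tri (l - latPt m)) = expFun (α e) *
      (expFun (-α e) (latPt m) • fun l => (expFun (-α e) * tri : (Fin d → ℝ) → ℂ) (l - latPt m)) := by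
    ext l
    simp only [Pi.mul_apply, Pi.smul_apply, smul_eq_mul]
    have h1 := expFun_neg_mul (α e) (l - latPt m)
    rw [expFun_sub (α e)] at h1
    linear_combination (-tri (l - latPt m)) * h1
  rw [mul_one, latPart, hv.mult_eq ((hG.shift _).smul _) (fl1_tri.shift _) hψ,
    mult_smul _ (hG.shift _)]
  change ‖expFun (-α e) (latPt m) • mult (fun l => (expFun (-α e) * tri : (Fin d → ℝ) → ℂ) (l - latPt m)) v‖ₑ ≤ _
  have h2 : ‖expFun (-α e) (latPt m)‖ₑ = expSeq h m := by
    rw [expSeq_eq, expFun, ← ofReal_norm, Complex.norm_real, Real.norm_of_nonneg (Real.exp_nonneg _),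
      neg_mul, ← hα]
    simp
  calc _ ≤ ‖expFun (-α e) (latPt m)‖ₑ * (‖T e‖ₑ * ‖v‖ₑ) := by
        refine enorm_smul_le.trans (mul_le_mul_right (enorm_mult_shift_le hG _ v) _)
    _ ≤ expSeq h m * ((∑ e, ‖T e‖ₑ) * b) := by
        rw [h2]
        gcongr
        exact Finset.single_le_sum (f := fun e => ‖T e‖ₑ) (fun _ _ => zero_le) (Finset.mem_univ e)
    _ = _ := by ring

lemma latPart_modu (m n : Fin d → ℤ) (u : (Fin d → ℝ) →ᵇ B) :
    latPart m (modu (latPt n) u) = modu (latPt n) (latPart (m - n) u) := by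
  rw [latPart, latPart, ← mult_modu (fl1_tri.shift _)]
  congr 2
  ext l
  rw [latPt_sub]
  congr 1
  abel

/-- Each modulation is pulled out to the left of the product and turns the lattice index `m` into `m
- n`, which produces the convolution. -/
lemma Decays.hasSum_mul {h : ℝ} {w x : (Fin d → ℝ) →ᵇ B} {g c : (Fin d → ℤ) → ℝ≥0∞}
    {u : (Fin d → ℤ) → (Fin d → ℝ) →ᵇ B} (hw : Decays h w g) (hu : ∀ n, HasExts h (u n) (c n))
    (hx : HasSum (fun n => modu (latPt n) (u n)) x) : Decays h (x * w) (seqConv c g) := by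
  intro z b hz m
  have h1 : HasSum (fun n => latPart m (z * (modu (latPt n) (u n) * w))) (latPart m (z * (x * w))) :=
    ((hx.mul_right w).mul_left z).mapL (latPart m)
  have h2 : ∀ n, ‖latPart m (z * (modu (latPt n) (u n) * w))‖ₑ ≤ b * (c n * g (m - n)) := fun n => by
    rw [modu_mul_left, modu_mul_right, latPart_modu, enorm_modu, ← mul_assoc, ← mul_assoc]
    exact hw _ _ (hz.mul (hu n)) (m - n)
  rw [seqConv, ← ENNReal.tsum_mul_left]
  exact h1.enorm_le_of_bounded ENNReal.summable.hasSum h2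

/-- The part of `u` with spectrum near the lattice point `n`, moved to the origin. -/
def centredPart (n : Fin d → ℤ) (u : (Fin d → ℝ) →ᵇ B) : (Fin d → ℝ) →ᵇ B :=
  modu (-latPt n) (latPart n u)

lemma modu_centredPart (n : Fin d → ℤ) (u : (Fin d → ℝ) →ᵇ B) :
    modu (latPt n) (centredPart n u) = latPart n u := by
  rw [centredPart, modu_modu, add_neg_cancel, modu_zero]

lemma mult_plat_centredPart (n : Fin d → ℤ) (u : (Fin d → ℝ) →ᵇ B) :
    mult (plat 0) (centredPart n u) = centredPart n u := by
  have : centredPart n u = mult tri (modu (-latPt n) u) := by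
    have h := mult_modu fl1_tri (latPt n) (modu (-latPt n) u)
    rw [modu_modu, add_neg_cancel, modu_zero] at h
    rw [centredPart, latPart, h, modu_modu, neg_add_cancel, modu_zero]
  rw [this, ← mult_mul (fl1_plat 0) fl1_tri, plat_mul_tri]

/-! ### Algebra structure and inverse closedness of the weighted classes. -/

/-- The functions whose lattice parts have finite weight. -/
def latClass (N : ((Fin d → ℤ) → ℝ≥0∞) → ℝ≥0∞) : Set ((Fin d → ℝ) →ᵇ B) :=
  {x | N (fun n => ‖latPart n x‖ₑ) < ⊤}

variable {N : ((Fin d → ℤ) → ℝ≥0∞) → ℝ≥0∞}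

lemma IsWeight.seqConv_lt_top (hN : IsWeight N) {b c : (Fin d → ℤ) → ℝ≥0∞} (hb : N b < ⊤)
    (hc : N c < ⊤) : N (seqConv b c) < ⊤ := by
  obtain ⟨K, hK⟩ := hN.conv_le
  exact (hK b c).trans_lt (ENNReal.mul_lt_top ENNReal.coe_lt_top (ENNReal.add_lt_top.2
    ⟨ENNReal.mul_lt_top hb ((hN.le c).trans_lt hc), ENNReal.mul_lt_top ((hN.le b).trans_lt hb) hc⟩))

lemma IsWeight.const_mul_lt_top (hN : IsWeight N) {C : ℝ≥0∞} (hC : C < ⊤)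
    {b : (Fin d → ℤ) → ℝ≥0∞} (hb : N b < ⊤) : N (fun n => C * b n) < ⊤ :=
  (hN.const_mul_le C b).trans_lt (ENNReal.mul_lt_top hC hb)

lemma IsWeight.hasSum_latPart (hN : IsWeight N) {x : (Fin d → ℝ) →ᵇ B} (hx : x ∈ latClass N) :
    HasSum (fun n => latPart n x) x :=
  SpectralDecay.hasSum_latPart ((hN.le _).trans_lt hx).ne

lemma IsWeight.mul_mem (hN : IsWeight N) {x x' : (Fin d → ℝ) →ᵇ B} (hx : x ∈ latClass N)
    (hx' : x' ∈ latClass N) : x * x' ∈ latClass N := by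
  obtain ⟨C, -, hC⟩ := exists_hasExts_of_mult_plat_eq d B
  obtain ⟨C', hC', hD⟩ := exists_decays_one (d := d) (B := B) 1
  have hu : ∀ (y : (Fin d → ℝ) →ᵇ B) n, HasExts 1 (centredPart n y) (C * ‖latPart n y‖ₑ) :=
    fun y n => by
      have := hC _ (mult_plat_centredPart n y) 1 one_pos le_rfl
      rwa [centredPart, enorm_modu] at this
  have hs : ∀ {y : (Fin d → ℝ) →ᵇ B}, y ∈ latClass N →
      HasSum (fun n => modu (latPt n) (centredPart n y)) y := fun {y} hy => by
    simpa only [modu_centredPart] using hN.hasSum_latPart hy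
  -- The product is read as `x * (x' * 1)` with width one and left factor one.
  have h1 := ((hD.hasSum_mul (hu x') (hs hx')).hasSum_mul (hu x) (hs hx)) 1 _ (hasExts_one 1)
  simp only [one_mul, mul_one] at h1
  refine (hN.mono h1).trans_lt (hN.const_mul_lt_top enorm_lt_top (hN.seqConv_lt_top
    (hN.const_mul_lt_top ENNReal.coe_lt_top hx) (hN.seqConv_lt_top
      (hN.const_mul_lt_top ENNReal.coe_lt_top hx') (hN.const_mul_lt_top hC'
        (hN.expSeq_lt_top 1 one_pos)))))

lemma IsWeight.add_mem (hN : IsWeight N) {x x' : (Fin d → ℝ) →ᵇ B} (hx : x ∈ latClass N)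
    (hx' : x' ∈ latClass N) : x + x' ∈ latClass N := by
  have h := hN.tsum_le fun (i : Bool) n => ‖latPart n (bif i then x else x')‖ₑ
  simp only [tsum_bool, cond_true, cond_false] at h
  refine (hN.mono fun n => ?_).trans_lt (h.trans_lt (ENNReal.add_lt_top.2 ⟨hx', hx⟩))
  rw [map_add, add_comm]
  exact enorm_add_le _ _

lemma neg_mem_latClass {x : (Fin d → ℝ) →ᵇ B} (hx : x ∈ latClass N) : -x ∈ latClass N := by
  rw [latClass, Set.mem_ofPred_eq]
  simp only [map_neg, enorm_neg]
  exact hx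

/-- The combination `a k + 4 c s k` at least halves at each step. -/
lemma tsum_lt_top_of_recursion {a s : ℕ → ℝ≥0∞} {c : ℝ≥0∞} (hc : c < ⊤) (ha : a 0 < ⊤)
    (hs : s 0 < ⊤) (has : ∀ k, a (k + 1) ≤ c * s k + 4⁻¹ * a k)
    (hss : ∀ k, s (k + 1) ≤ 4⁻¹ * s k) : ∑' k, a k < ⊤ := by
  have h4 : (4 : ℝ≥0∞) * 4⁻¹ = 1 := ENNReal.mul_inv_cancel (by simp) (by simp)
  have h2 : (2 : ℝ≥0∞)⁻¹ * 4 = 2 := by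
    rw [show (4 : ℝ≥0∞) = 2 * 2 by norm_num, ← mul_assoc,
      ENNReal.inv_mul_cancel (by simp) (by simp), one_mul]
  have h42 : (4 : ℝ≥0∞)⁻¹ ≤ 2⁻¹ := ENNReal.inv_le_inv.2 (by norm_num)
  have hT : ∀ k, a k + 4 * (c * s k) ≤ 2⁻¹ ^ k * (a 0 + 4 * (c * s 0)) := by
    intro k
    induction k with
    | zero => simp
    | succ k ih =>
      calc a (k + 1) + 4 * (c * s (k + 1))
          ≤ (c * s k + 4⁻¹ * a k) + 4 * (c * (4⁻¹ * s k)) := by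
            gcongr
            · exact has k
            · exact hss k
        _ = 4⁻¹ * a k + (1 + 4 * 4⁻¹) * (c * s k) := by ring
        _ = 4⁻¹ * a k + (2⁻¹ * 4) * (c * s k) := by rw [h4, h2, one_add_one_eq_two]
        _ ≤ 2⁻¹ * a k + (2⁻¹ * 4) * (c * s k) := by gcongr
        _ = 2⁻¹ * (a k + 4 * (c * s k)) := by ring
        _ ≤ 2⁻¹ * (2⁻¹ ^ k * (a 0 + 4 * (c * s 0))) := by gcongr
        _ = _ := by rw [pow_succ']; ring
  calc ∑' k, a k ≤ ∑' k, 2⁻¹ ^ k * (a 0 + 4 * (c * s 0)) :=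
        ENNReal.tsum_le_tsum fun k => le_self_add.trans (hT k)
    _ = 2 * (a 0 + 4 * (c * s 0)) := by
        rw [ENNReal.tsum_mul_right, ENNReal.tsum_geometric, ENNReal.one_sub_inv_two, inv_inv]
    _ < ⊤ := ENNReal.mul_lt_top (by simp) (ENNReal.add_lt_top.2
        ⟨ha, ENNReal.mul_lt_top (by simp) (ENNReal.mul_lt_top hc hs)⟩)

lemma mult_plat_finset_sum_latPart (F : Finset (Fin d → ℤ)) (x : (Fin d → ℝ) →ᵇ B) :
    ∃ R, mult (plat R) (∑ n ∈ F, latPart n x) = ∑ n ∈ F, latPart n x := by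
  refine ⟨∑ n ∈ F, ‖latPt n‖, ?_⟩
  rw [map_sum]
  refine Finset.sum_congr rfl fun n hn => ?_
  have hle : ‖latPt n‖ ≤ ∑ n ∈ F, ‖latPt n‖ :=
    Finset.single_le_sum (f := fun n => ‖latPt n‖) (fun _ _ => norm_nonneg _) hn
  rw [latPart, ← mult_mul (fl1_plat _) (fl1_tri.shift _)]
  congr 2
  ext l
  rw [Pi.mul_apply]
  by_cases hl : ∃ k, 1 ≤ |(l - latPt n) k|
  · obtain ⟨k, hk⟩ := hl
    rw [tri_eq_zero hk, mul_zero]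
  · push Not at hl
    rw [plat_eq_one fun k => ?_, one_mul]
    have h1 := norm_le_pi_norm (latPt n) k
    have h2 := abs_sub_abs_le_abs_sub (l k) (latPt n k)
    have h3 := hl k
    rw [Real.norm_eq_abs] at h1
    rw [Pi.sub_apply] at h3
    linarith

/-- Bounded spectrum gives extensions in all diagonal directions. Only the width `h` depends on how
`p` was truncated; the bound involves `‖p⁻¹‖` alone. -/
lemma exists_hasExts_inverse {p : (Fin d → ℝ) →ᵇ B} (hp : IsUnit p) {R : ℝ}
    (hR : mult (plat R) p = p) : ∃ h : ℝ, 0 < h ∧ h ≤ 1 ∧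
      HasExts h (Ring.inverse p) (‖Ring.inverse p‖ₑ + 1) := by
  have hv : ∀ e : Fin d → Bool, ∃ v, Ext (fun k => sgn (e k)) p v := fun e => by
    obtain ⟨C, -, hC⟩ := exists_ext_of_mult_plat_eq (B := B) R (fun k => sgn (e k))
    obtain ⟨v, hv, -⟩ := hC p hR
    exact ⟨v, hv⟩
  choose v hv using hv
  have hev := (eventually_all.2 fun e => (hv e).inverse hp).and
    (Ioo_mem_nhdsGT (one_pos : (0 : ℝ) < 1))
  obtain ⟨h, hh, hh0, hh1⟩ := hev.exists
  refine ⟨h, hh0, hh1.le, fun e => ?_⟩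
  obtain ⟨y, hy, hy'⟩ := hh e
  refine ⟨y, hy, ?_⟩
  rw [← ofReal_norm, ← ofReal_norm (Ring.inverse p), ← ENNReal.ofReal_one,
    ← ENNReal.ofReal_add (norm_nonneg _) zero_le_one]
  exact ENNReal.ofReal_le_ofReal hy'

lemma hasSum_mul_pow_eq_inverse {A : Type*} [NormedRing A] [CompleteSpace A] {x p : A}
    (hx : IsUnit x) (hp : IsUnit p) (h : ‖(p - x) * Ring.inverse p‖ < 1) :
    HasSum (fun k : ℕ => Ring.inverse p * ((p - x) * Ring.inverse p) ^ k) (Ring.inverse x) := by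
  set q := Ring.inverse p
  have hs := summable_geometric_of_norm_lt_one h
  have h1 := mul_neg_geom_series ((p - x) * q) h
  have hpq : p * q = 1 := Ring.mul_inverse_cancel p hp
  have h2 : x * q = 1 - (p - x) * q := by rw [sub_mul, hpq]; abel
  have h3 : Ring.inverse x = q * ∑' k : ℕ, ((p - x) * q) ^ k := by
    have : x * (q * ∑' k : ℕ, ((p - x) * q) ^ k) = 1 := by rw [← mul_assoc, h2, h1]
    rw [← mul_one (Ring.inverse x), ← this, ← mul_assoc, Ring.inverse_mul_cancel x hx, one_mul]
  rw [h3]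
  exact hs.hasSum.mul_left q

/-- The part of a sequence outside a finite set. -/
def tailSeq (F : Finset (Fin d → ℤ)) (b : (Fin d → ℤ) → ℝ≥0∞) : (Fin d → ℤ) → ℝ≥0∞ :=
  Set.indicator {n | n ∉ F} b

lemma tendsto_tsum_tailSeq {b : (Fin d → ℤ) → ℝ≥0∞} (hb : ∑' n, b n ≠ ⊤) :
    Tendsto (fun F => ∑' n, tailSeq F b n) atTop (𝓝 0) := by
  refine (ENNReal.tendsto_tsum_compl_atTop_zero hb).congr fun F => ?_
  exact tsum_subtype {n | n ∉ F} b

/-- The `ℓ¹` sums of `g k` shrink by `1/4` at each step, and `conv_le` bounds `N (g (k + 1))` by a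
multiple of such a sum plus `N (g k) / 4`. -/
lemma IsWeight.tsum_decay_lt_top (hN : IsWeight N) {K : ℝ≥0}
    (hK : ∀ b c, N (seqConv b c) ≤ K * (N b * ∑' n, c n + (∑' n, b n) * N c))
    {c : (Fin d → ℤ) → ℝ≥0∞} {M : ℝ≥0∞} (hM : M < ⊤) (hc : N c < ⊤)
    (h1 : (∑' n, c n) * M ≤ 4⁻¹) (h2 : K * (∑' n, c n) * M ≤ 4⁻¹)
    {g : ℕ → (Fin d → ℤ) → ℝ≥0∞} (hg0 : N (g 0) < ⊤)
    (hg : ∀ k, g (k + 1) = seqConv c fun m => M * g k m) : ∑' k, N (g k) < ⊤ := by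
  refine tsum_lt_top_of_recursion (s := fun k => ∑' n, g k n) (c := K * N c * M)
    (ENNReal.mul_lt_top (ENNReal.mul_lt_top ENNReal.coe_lt_top hc) hM) hg0
    ((hN.le _).trans_lt hg0) (fun k => ?_) fun k => ?_
  · calc N (g (k + 1)) ≤ K * (N c * ∑' n, M * g k n + (∑' n, c n) * N fun m => M * g k m) := by
          rw [hg]; exact hK _ _
      _ ≤ K * (N c * (M * ∑' n, g k n) + (∑' n, c n) * (M * N (g k))) := by
          rw [ENNReal.tsum_mul_left]
          gcongr
          exact hN.const_mul_le _ _
      _ = K * N c * M * ∑' n, g k n + K * (∑' n, c n) * M * N (g k) := by ring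
      _ ≤ _ := by gcongr
  · simp only [hg]
    rw [tsum_seqConv, ENNReal.tsum_mul_left, ← mul_assoc]
    gcongr

lemma IsWeight.exists_finset (hN : IsWeight N) {x : (Fin d → ℝ) →ᵇ B} (hx : x ∈ latClass N)
    (hu : IsUnit x) {D : ℝ≥0∞} (hD : D < ⊤) : ∃ F : Finset (Fin d → ℤ),
      IsUnit (∑ n ∈ F, latPart n x) ∧
      ‖Ring.inverse (∑ n ∈ F, latPart n x)‖ₑ < ‖Ring.inverse x‖ₑ + 1 ∧
      D * ∑' n, tailSeq F (fun n => ‖latPart n x‖ₑ) n < 4⁻¹ := by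
  have hs : Tendsto (fun F => ∑ n ∈ F, latPart n x) atTop (𝓝 x) := hN.hasSum_latPart hx
  have h1 := hs.eventually (Units.isOpen.mem_nhds hu)
  have h2 : ∀ᶠ F in atTop, ‖Ring.inverse (∑ n ∈ F, latPart n x)‖ₑ < ‖Ring.inverse x‖ₑ + 1 :=
    (((continuousAt_inverse hu).tendsto.comp hs).enorm).eventually
      (gt_mem_nhds (ENNReal.lt_add_right enorm_ne_top one_ne_zero))
  have h3 : ∀ᶠ F in atTop, D * ∑' n, tailSeq F (fun n => ‖latPart n x‖ₑ) n < 4⁻¹ := by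
    have := ENNReal.Tendsto.const_mul (a := D) (tendsto_tsum_tailSeq
      (b := fun n => ‖latPart n x‖ₑ) ((hN.le _).trans_lt hx).ne) (Or.inr hD.ne)
    rw [mul_zero] at this
    exact this.eventually (gt_mem_nhds (by simp))
  exact (h1.and (h2.and h3)).exists

theorem IsWeight.inverse_mem (hN : IsWeight N) {x : (Fin d → ℝ) →ᵇ B} (hx : x ∈ latClass N)
    (hu : IsUnit x) : Ring.inverse x ∈ latClass N := by
  obtain ⟨C, hC1, hC⟩ := exists_hasExts_of_mult_plat_eq d B
  obtain ⟨K, hK⟩ := hN.conv_le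
  set b : (Fin d → ℤ) → ℝ≥0∞ := fun n => ‖latPart n x‖ₑ
  -- One unit for passing from `x⁻¹` to `p⁻¹` and one for passing to its extensions; `M` is fixed
  -- before `F` and `h`.
  set M : ℝ≥0∞ := ‖Ring.inverse x‖ₑ + 1 + 1 with hM
  have hMtop : M < ⊤ := by simp [hM]
  -- The factor `K + 1` covers both smallness conditions of `tsum_decay_lt_top`, those with and
  -- without `K`.
  obtain ⟨F, hp, hq, hF⟩ := hN.exists_finset hx hu (D := C * M * (K + 1))
    (ENNReal.mul_lt_top (ENNReal.mul_lt_top ENNReal.coe_lt_top hMtop) (by simp))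
  set p := ∑ n ∈ F, latPart n x with hp'
  set q := Ring.inverse p
  set t := ∑' n, tailSeq F b n
  obtain ⟨R, hR⟩ := mult_plat_finset_sum_latPart F x
  obtain ⟨h, h0, h1, hqe⟩ := exists_hasExts_inverse hp hR
  have hqM : HasExts h q M := fun e => by
    obtain ⟨v, hv, hv'⟩ := hqe e
    exact ⟨v, hv, hv'.trans (add_le_add hq.le le_rfl)⟩
  set u : (Fin d → ℤ) → (Fin d → ℝ) →ᵇ B := fun n =>
    if n ∈ F then 0 else -centredPart n x with hu'
  have hun : ∀ n, ‖u n‖ₑ = tailSeq F b n := fun n => by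
    by_cases hn : n ∈ F
    · simp [hu', hn, tailSeq]
    · simp [hu', hn, tailSeq, b, centredPart, enorm_modu]
  have hue : ∀ n, HasExts h (u n) (C * tailSeq F b n) := fun n => by
    rw [← hun]
    refine hC _ ?_ h h0 h1
    by_cases hn : n ∈ F
    · simp [hu', hn]
    · simp [hu', hn, mult_plat_centredPart]
  have hr : HasSum (fun n => modu (latPt n) (u n)) (p - x) := by
    have h2 : HasSum (fun n => if n ∈ F then latPart n x else 0) p := by
      rw [hp', ← Finset.sum_congr rfl fun n hn => if_pos hn]
      exact hasSum_sum_of_ne_finset_zero fun n hn => if_neg hn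
    refine (h2.sub (hN.hasSum_latPart hx)).congr_fun fun n => ?_
    by_cases hn : n ∈ F
    · simp [hu', hn]
    · simp [hu', hn, modu_centredPart]
  have hrt : ‖p - x‖ₑ ≤ t :=
    hr.enorm_le_of_bounded ENNReal.summable.hasSum fun n => by rw [enorm_modu, hun]
  have hrq : ‖(p - x) * q‖ < 1 := by
    have h3 : ‖(p - x) * q‖ₑ < 1 := by
      calc ‖(p - x) * q‖ₑ ≤ t * M := (enorm_mul_le_mul _ _).trans
            (mul_le_mul' hrt (hq.le.trans le_self_add))
        _ = 1 * M * (0 + 1) * t := by ring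
        _ ≤ C * M * (K + 1) * t := by
            gcongr
            · exact_mod_cast hC1
            · exact zero_le
        _ < 1 := hF.trans (by simp)
    rwa [← ofReal_norm, ENNReal.ofReal_lt_one] at h3
  obtain ⟨C₁, hC₁, hdec⟩ := exists_decays_one (d := d) (B := B) h
  set c : (Fin d → ℤ) → ℝ≥0∞ := fun n => C * tailSeq F b n with hc
  set g : ℕ → (Fin d → ℤ) → ℝ≥0∞ := fun k =>
    (fun g' => seqConv c fun m => M * g' m)^[k] fun m => C₁ * expSeq h m with hg
  have hgs : ∀ k, g (k + 1) = seqConv c fun m => M * g k m := fun k => by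
    simp only [hg, Function.iterate_succ_apply']
  -- Each further factor `(p - x) * q` costs `M` for `q` and one convolution with the small tail
  -- `c`; the exponential sequence enters only at `k = 0`.
  have hD : ∀ k, Decays h (((p - x) * q) ^ k) (g k) := fun k => by
    induction k with
    | zero => rw [pow_zero]; exact hdec
    | succ k ih =>
      rw [pow_succ', mul_assoc, hgs]
      exact (ih.hasExts_mul hqM).hasSum_mul hue hr
  have hy := hasSum_mul_pow_eq_inverse hu hp hrq
  have hle : (fun m => ‖latPart m (Ring.inverse x)‖ₑ) ≤ fun m => ∑' k, M * g k m := fun m =>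
    (hy.mapL (latPart m)).enorm_le_of_bounded ENNReal.summable.hasSum fun k => hD k q M hqM m
  have htc : ∑' n, c n = C * t := ENNReal.tsum_mul_left
  have hsum : ∑' k, N (g k) < ⊤ := by
    have ht : N (tailSeq F b) < ⊤ :=
      (hN.mono (Set.indicator_le_self' fun _ _ => zero_le)).trans_lt hx
    refine hN.tsum_decay_lt_top (c := c) hK hMtop (hN.const_mul_lt_top ENNReal.coe_lt_top ht) ?_ ?_
      (hN.const_mul_lt_top hC₁ (hN.expSeq_lt_top h h0)) hgs
    · rw [htc]
      calc C * t * M = C * M * (0 + 1) * t := by ring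
        _ ≤ C * M * (K + 1) * t := by gcongr; exact zero_le
        _ ≤ _ := hF.le
    · rw [htc]
      calc K * (C * t) * M = C * M * (K + 0) * t := by ring
        _ ≤ C * M * (K + 1) * t := by gcongr; exact zero_le
        _ ≤ _ := hF.le
  refine (hN.mono hle).trans_lt ((hN.tsum_le _).trans_lt ?_)
  refine lt_of_le_of_lt (ENNReal.tsum_le_tsum fun k => hN.const_mul_le M (g k)) ?_
  rw [ENNReal.tsum_mul_left]
  exact ENNReal.mul_lt_top hMtop hsum

/-! ### Partial derivatives of sums, products and inverses. -/

section Derivatives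

variable {f g : (Fin d → ℝ) → B}

lemma partialD_eq (hf : Differentiable ℝ f) (k : Fin d) :
    partialD k f = fun s => fderiv ℝ f s (Pi.single k 1) :=
  funext fun s => (hf s).lineDeriv_eq_fderiv

lemma contDiff_partialD {n : ℕ} (hf : ContDiff ℝ (n + 1 : ℕ) f) (k : Fin d) :
    ContDiff ℝ n (partialD k f) := by
  push_cast at hf
  rw [partialD_eq (hf.differentiable (by simp))]
  exact (hf.fderiv_right le_rfl).clm_apply contDiff_const

lemma partialD_comm (hf : ContDiff ℝ (2 : ℕ) f) (i k : Fin d) :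
    partialD k (partialD i f) = partialD i (partialD k f) := by
  have h1 : Differentiable ℝ f := hf.differentiable (by simp)
  have h2 : Differentiable ℝ (fderiv ℝ f) :=
    (hf.fderiv_right (m := 1) (by norm_num)).differentiable (by simp)
  have key : ∀ i k : Fin d, partialD k (partialD i f) =
      fun s => fderiv ℝ (fderiv ℝ f) s (Pi.single k 1) (Pi.single i 1) := fun i k => by
    rw [partialD_eq h1, partialD_eq fun s => (h2 s).clm_apply (differentiableAt_const _)]
    ext s
    rw [fderiv_clm_apply (h2 s) (differentiableAt_const _)]
    simp
  rw [key, key]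
  ext s
  exact (hf.contDiffAt.isSymmSndFDerivAt (by simp)).eq _ _

lemma contDiff_iterate_partialD {n j : ℕ} (hf : ContDiff ℝ (n + j : ℕ) f) (k : Fin d) :
    ContDiff ℝ n ((partialD k)^[j] f) := by
  induction j generalizing f with
  | zero => simpa using hf
  | succ j ih => exact ih (contDiff_partialD hf k)

lemma iterate_partialD_comm {j : ℕ} (hf : ContDiff ℝ (j + 1 : ℕ) f) (i k : Fin d) :
    (partialD k)^[j] (partialD i f) = partialD i ((partialD k)^[j] f) := by
  induction j generalizing f with
  | zero => rfl
  | succ j ih =>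
    rw [Function.iterate_succ_apply, Function.iterate_succ_apply, ← ih (contDiff_partialD hf k),
      partialD_comm (hf.of_le (by norm_cast; omega))]

/-- The iterated derivative along the coordinates in a list. -/
def listD (L : List (Fin d)) (α : Fin d → ℕ) (f : (Fin d → ℝ) → B) : (Fin d → ℝ) → B :=
  L.foldr (fun k g => (partialD k)^[α k] g) f

lemma contDiff_listD (L : List (Fin d)) (α : Fin d → ℕ) {n : ℕ}
    (hf : ContDiff ℝ (n + (L.map α).sum : ℕ) f) : ContDiff ℝ n (listD L α f) := by
  induction L generalizing n with
  | nil => simpa [listD] using hf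
  | cons k L ih =>
    refine contDiff_iterate_partialD (ih ?_) k
    rwa [List.map_cons, List.sum_cons, ← add_assoc] at hf

lemma listD_partialD (L : List (Fin d)) (α : Fin d → ℕ) (i : Fin d)
    (hf : ContDiff ℝ ((L.map α).sum + 1 : ℕ) f) :
    listD L α (partialD i f) = partialD i (listD L α f) := by
  induction L with
  | nil => rfl
  | cons k L ih =>
    rw [List.map_cons, List.sum_cons] at hf
    change (partialD k)^[α k] (listD L α (partialD i f)) = _
    rw [ih (hf.of_le (by norm_cast; omega))]
    exact iterate_partialD_comm (contDiff_listD L α (hf.of_le (by norm_cast; omega))) i k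

lemma listD_add_single_of_notMem (L : List (Fin d)) (α : Fin d → ℕ) {i : Fin d} (hi : i ∉ L) :
    listD L (α + Pi.single i 1) f = listD L α f := by
  induction L with
  | nil => rfl
  | cons k L ih =>
    rw [List.mem_cons, not_or] at hi
    change (partialD k)^[(α + Pi.single i 1 : Fin d → ℕ) k] (listD L (α + Pi.single i 1) f) = _
    rw [ih hi.2, Pi.add_apply, Pi.single_eq_of_ne (Ne.symm hi.1), add_zero]
    rfl

lemma listD_add_single {L : List (Fin d)} (hL : L.Nodup) (α : Fin d → ℕ) {i : Fin d} (hi : i ∈ L)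
    (hf : ContDiff ℝ ((L.map α).sum + 1 : ℕ) f) :
    listD L (α + Pi.single i 1) f = listD L α (partialD i f) := by
  induction L with
  | nil => simp at hi
  | cons k L ih =>
    rw [List.nodup_cons] at hL
    rw [List.map_cons, List.sum_cons] at hf
    have hf' : ContDiff ℝ ((L.map α).sum + 1 : ℕ) f := hf.of_le (by norm_cast; omega)
    change (partialD k)^[(α + Pi.single i 1 : Fin d → ℕ) k] (listD L (α + Pi.single i 1) f) =
      (partialD k)^[α k] (listD L α (partialD i f))
    rcases eq_or_ne i k with rfl | hik
    · rw [listD_add_single_of_notMem L α hL.1, Pi.add_apply, Pi.single_eq_same,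
        Function.iterate_succ_apply, listD_partialD L α i hf']
    · rw [ih hL.2 ((List.mem_cons.1 hi).resolve_left hik) hf', Pi.add_apply,
        Pi.single_eq_of_ne (Ne.symm hik), add_zero]

lemma sum_map_finRange (α : Fin d → ℕ) : ((List.finRange d).map α).sum = ∑ k, α k :=
  (Fin.sum_univ_def α).symm

lemma continuous_multiD {m : ℕ} (hf : ContDiff ℝ m f) {α : Fin d → ℕ} (hα : ∑ k, α k ≤ m) :
    Continuous (multiD α f) := by
  rw [← contDiff_zero (𝕜 := ℝ)]
  refine contDiff_listD (n := 0) (List.finRange d) α (hf.of_le ?_)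
  rw [sum_map_finRange]
  norm_cast
  omega

/-- Partial derivatives commute, so the extra one can be taken first whatever its place in the fixed
order of `multiD`. -/
lemma multiD_add_single {α : Fin d → ℕ} (hf : ContDiff ℝ (∑ k, α k + 1 : ℕ) f) (i : Fin d) :
    multiD (α + Pi.single i 1) f = multiD α (partialD i f) :=
  listD_add_single (List.nodup_finRange d) α (List.mem_finRange i) (by rwa [sum_map_finRange])

lemma multiD_zero : multiD 0 f = f := by
  have : ∀ L : List (Fin d), listD L 0 f = f := fun L => by
    induction L with
    | nil => rfl
    | cons k L ih => exact ih
  exact this _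

lemma partialD_add (hf : Differentiable ℝ f) (hg : Differentiable ℝ g) (k : Fin d) :
    partialD k (f + g) = partialD k f + partialD k g := by
  rw [partialD_eq hf, partialD_eq hg, partialD_eq (hf.add hg)]
  ext s
  rw [fderiv_add (hf s) (hg s)]; rfl

lemma partialD_neg (hf : Differentiable ℝ f) (k : Fin d) : partialD k (-f) = -partialD k f := by
  rw [partialD_eq hf, partialD_eq hf.neg]
  ext s
  rw [fderiv_neg]; rfl

lemma partialD_mul (hf : Differentiable ℝ f) (hg : Differentiable ℝ g) (k : Fin d) :
    partialD k (f * g) = f * partialD k g + partialD k f * g := by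
  rw [partialD_eq hf, partialD_eq hg, partialD_eq (hf.mul hg)]
  ext s
  rw [fderiv_mul' (hf s) (hg s)]; simp

lemma contDiff_inverse {n : WithTop ℕ∞} (hf : ContDiff ℝ n f) (hu : ∀ s, IsUnit (f s)) :
    ContDiff ℝ n fun s => Ring.inverse (f s) := by
  refine contDiff_iff_contDiffAt.2 fun s => ?_
  obtain ⟨U, hU⟩ := hu s
  have := contDiffAt_ringInverse ℝ (n := n) U
  rw [hU] at this
  exact this.comp s hf.contDiffAt

lemma partialD_inverse (hf : Differentiable ℝ f) (hu : ∀ s, IsUnit (f s)) (k : Fin d) :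
    partialD k (fun s => Ring.inverse (f s)) =
      -((fun s => Ring.inverse (f s)) * partialD k f * fun s => Ring.inverse (f s)) := by
  have h1 : ∀ s, HasFDerivAt (fun s => Ring.inverse (f s))
      ((-ContinuousLinearMap.mulLeftRight ℝ B (Ring.inverse (f s)) (Ring.inverse (f s))).comp
        (fderiv ℝ f s)) s := fun s => by
    obtain ⟨U, hU⟩ := hu s
    have := hasFDerivAt_ringInverse (𝕜 := ℝ) U
    rw [← Ring.inverse_unit, hU] at this
    exact this.comp s (hf s).hasFDerivAt
  rw [partialD_eq hf, partialD_eq fun s => (h1 s).differentiableAt]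
  ext s
  rw [(h1 s).fderiv]; simp

end Derivatives

/-! ### Sobolev classes over an inverse-closed algebra. -/

/-- The functions with all derivatives up to order `m` in a given class. -/
def SobolevOver (P : Set ((Fin d → ℝ) →ᵇ B)) (m : ℕ) (f : (Fin d → ℝ) → B) : Prop :=
  ContDiff ℝ m f ∧ ∀ α : Fin d → ℕ, ∑ k, α k ≤ m → ∃ u ∈ P, ⇑u = multiD α f

variable {P : Set ((Fin d → ℝ) →ᵇ B)} {f g : (Fin d → ℝ) → B} {m : ℕ}

lemma sobolevOver_zero_iff : SobolevOver P 0 f ↔ ∃ u ∈ P, ⇑u = f := by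
  constructor
  · rintro ⟨-, h⟩
    simpa only [multiD_zero] using h 0 (by simp)
  · rintro ⟨u, hu, rfl⟩
    refine ⟨contDiff_zero.2 u.continuous, fun α hα => ⟨u, hu, ?_⟩⟩
    have : α = 0 := by
      ext k
      exact (Finset.sum_eq_zero_iff.1 (Nat.le_zero.1 hα)) k (Finset.mem_univ k)
    rw [this, multiD_zero]

/-- Reduces inductions on `m` to first-order product and quotient rules: a nonzero multi-index
splits off one coordinate derivative. -/
lemma sobolevOver_succ_iff : SobolevOver P (m + 1) f ↔ ContDiff ℝ (m + 1 : ℕ) f ∧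
    (∃ u ∈ P, ⇑u = f) ∧ ∀ k, SobolevOver P m (partialD k f) := by
  have hsum : ∀ (α : Fin d → ℕ) k, ∑ i, (α + Pi.single k 1 : Fin d → ℕ) i = ∑ i, α i + 1 :=
    fun α k => by simp [Finset.sum_add_distrib]
  refine and_congr_right fun hf => ⟨fun h => ⟨?_, fun k => ⟨contDiff_partialD hf k, fun α hα => ?_⟩⟩,
    fun ⟨h0, h⟩ α hα => ?_⟩
  · simpa only [multiD_zero] using h 0 (by simp)
  · rw [← multiD_add_single (hf.of_le (by norm_cast; omega))]
    exact h _ (by rw [hsum]; omega)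
  · by_cases hz : α = 0
    · rw [hz, multiD_zero]; exact h0
    · obtain ⟨k, hk⟩ := Function.ne_iff.1 hz
      have hα' : α = (α - Pi.single k 1) + Pi.single k 1 := by
        ext i
        rcases eq_or_ne i k with rfl | hik
        · have : α i ≠ 0 := hk
          simp; omega
        · simp [hik]
      rw [hα', hsum] at hα
      rw [hα', multiD_add_single (hf.of_le (by norm_cast))]
      exact (h k).2 _ (by omega)

lemma SobolevOver.of_succ (h : SobolevOver P (m + 1) f) : SobolevOver P m f :=
  ⟨h.1.of_le (by norm_cast; omega), fun α hα => h.2 α (by omega)⟩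

lemma SobolevOver.differentiable (h : SobolevOver P (m + 1) f) : Differentiable ℝ f :=
  h.1.differentiable (by norm_cast)

lemma SobolevOver.add (hP : ∀ u ∈ P, ∀ v ∈ P, u + v ∈ P) (hf : SobolevOver P m f)
    (hg : SobolevOver P m g) : SobolevOver P m (f + g) := by
  induction m generalizing f g with
  | zero =>
    rw [sobolevOver_zero_iff] at *
    obtain ⟨u, hu, rfl⟩ := hf
    obtain ⟨v, hv, rfl⟩ := hg
    exact ⟨u + v, hP u hu v hv, rfl⟩
  | succ m ih =>
    have hf1 := hf.differentiable
    have hg1 := hg.differentiable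
    rw [sobolevOver_succ_iff] at *
    obtain ⟨hfc, ⟨u, hu, rfl⟩, hf⟩ := hf
    obtain ⟨hgc, ⟨v, hv, rfl⟩, hg⟩ := hg
    refine ⟨hfc.add hgc, ⟨u + v, hP u hu v hv, rfl⟩, fun k => ?_⟩
    rw [partialD_add hf1 hg1]
    exact ih (hf k) (hg k)

lemma SobolevOver.neg (hP : ∀ u ∈ P, -u ∈ P) (hf : SobolevOver P m f) :
    SobolevOver P m (-f) := by
  induction m generalizing f with
  | zero =>
    rw [sobolevOver_zero_iff] at *
    obtain ⟨u, hu, rfl⟩ := hf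
    exact ⟨-u, hP u hu, rfl⟩
  | succ m ih =>
    have hf1 := hf.differentiable
    rw [sobolevOver_succ_iff] at *
    obtain ⟨hfc, ⟨u, hu, rfl⟩, hf⟩ := hf
    refine ⟨hfc.neg, ⟨-u, hP u hu, rfl⟩, fun k => ?_⟩
    rw [partialD_neg hf1]
    exact ih (hf k)

lemma SobolevOver.mul (hP : ∀ u ∈ P, ∀ v ∈ P, u + v ∈ P) (hP' : ∀ u ∈ P, ∀ v ∈ P, u * v ∈ P)
    (hf : SobolevOver P m f) (hg : SobolevOver P m g) : SobolevOver P m (f * g) := by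
  induction m generalizing f g with
  | zero =>
    rw [sobolevOver_zero_iff] at *
    obtain ⟨u, hu, rfl⟩ := hf
    obtain ⟨v, hv, rfl⟩ := hg
    exact ⟨u * v, hP' u hu v hv, rfl⟩
  | succ m ih =>
    have hf1 := hf.differentiable
    have hg1 := hg.differentiable
    have hf2 := hf.of_succ
    have hg2 := hg.of_succ
    rw [sobolevOver_succ_iff] at *
    obtain ⟨hfc, ⟨u, hu, rfl⟩, hf⟩ := hf
    obtain ⟨hgc, ⟨v, hv, rfl⟩, hg⟩ := hg
    refine ⟨hfc.mul hgc, ⟨u * v, hP' u hu v hv, rfl⟩, fun k => ?_⟩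
    rw [partialD_mul hf1 hg1]
    exact (ih hf2 (hg k)).add hP (ih (hf k) hg2)

/-- In `∂(f⁻¹) = -f⁻¹ (∂f) f⁻¹` every factor has one order of regularity less to supply, so the
inductive hypothesis applies to `f⁻¹`. -/
lemma SobolevOver.inverse (hP : ∀ u ∈ P, ∀ v ∈ P, u + v ∈ P)
    (hP' : ∀ u ∈ P, ∀ v ∈ P, u * v ∈ P) (hPn : ∀ u ∈ P, -u ∈ P) (hu : ∀ s, IsUnit (f s))
    (hi : ∀ u ∈ P, ⇑u = f → ∃ v ∈ P, ⇑v = fun s => Ring.inverse (f s))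
    (hf : SobolevOver P m f) : SobolevOver P m fun s => Ring.inverse (f s) := by
  induction m with
  | zero =>
    rw [sobolevOver_zero_iff] at *
    obtain ⟨u, hu, h⟩ := hf
    exact hi u hu h
  | succ m ih =>
    have hf1 := hf.differentiable
    have hf2 := ih hf.of_succ
    rw [sobolevOver_succ_iff] at *
    obtain ⟨hfc, ⟨u, hu', h⟩, hf⟩ := hf
    refine ⟨contDiff_inverse hfc hu, hi u hu' h, fun k => ?_⟩
    rw [partialD_inverse hf1 hu]
    exact ((hf2.mul hP hP' (hf k)).mul hP hP' hf2).neg hPn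

/-! ### Identification of the concrete classes. -/

lemma wienerClass_eq : (wienerClass : Set ((Fin d → ℝ) →ᵇ B)) = latClass fun b => ∑' n, b n :=
  Set.ext fun u => wienerNorm_lt_top_iff u

lemma beurlingClass_eq :
    (beurlingClass : Set ((Fin d → ℝ) →ᵇ B)) = latClass fun b => ∑' k, radMaj b k := by
  ext u
  change beurlingNorm u < ⊤ ↔ _
  rw [beurlingNorm_eq]; rfl

/-- The boundedness built into `boundedCm` is exactly what turns each continuous derivative into an
element of `C_b`. -/
lemma sobolevOver_iff_of_norm (W : ((Fin d → ℝ) → B) → ℝ≥0∞) (m : ℕ) (x : (Fin d → ℝ) →ᵇ B) :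
    SobolevOver {u : (Fin d → ℝ) →ᵇ B | W u < ⊤} m x ↔ x ∈ boundedCm m ∧
      ∀ α : Fin d → ℕ, ∑ k, α k ≤ m → W (multiD α x) < ⊤ := by
  constructor
  · rintro ⟨hc, h⟩
    refine ⟨⟨hc, fun α hα => ?_⟩, fun α hα => ?_⟩ <;> obtain ⟨u, hu, he⟩ := h α hα <;> rw [← he]
    · exact ⟨‖u‖, u.norm_coe_le_norm⟩
    · exact hu
  · rintro ⟨⟨hc, hb⟩, h⟩
    refine ⟨hc, fun α hα => ?_⟩
    obtain ⟨C, hC⟩ := hb α hα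
    exact ⟨BoundedContinuousFunction.ofNormedAddCommGroup _ (continuous_multiD hc hα) C hC,
      h α hα, rfl⟩

lemma exists_inverse {x : (Fin d → ℝ) →ᵇ B} (hx : ∀ s, IsUnit (x s))
    (hb : ∃ C : ℝ, ∀ s, ‖Ring.inverse (x s)‖ ≤ C) :
    IsUnit x ∧ ∀ s, Ring.inverse x s = Ring.inverse (x s) := by
  obtain ⟨C, hC⟩ := hb
  have hc : Continuous fun s => Ring.inverse (x s) := continuous_iff_continuousAt.2 fun s =>
    (continuousAt_inverse (hx s)).comp x.continuous.continuousAt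
  set y := BoundedContinuousFunction.ofNormedAddCommGroup _ hc C hC
  let U : ((Fin d → ℝ) →ᵇ B)ˣ := ⟨x, y,
    by ext s; exact Ring.mul_inverse_cancel _ (hx s),
    by ext s; exact Ring.inverse_mul_cancel _ (hx s)⟩
  exact ⟨⟨U, rfl⟩, fun s => by rw [show x = U from rfl, Ring.inverse_unit]; rfl⟩

lemma IsWeight.sobolevOver_inverse (hN : IsWeight N)
    {x : (Fin d → ℝ) →ᵇ B} (hx : ∀ s, IsUnit (x s))
    (hb : ∃ C : ℝ, ∀ s, ‖Ring.inverse (x s)‖ ≤ C) {m : ℕ} (h : SobolevOver (latClass N) m x) :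
    SobolevOver (latClass N) m ⇑(Ring.inverse x : (Fin d → ℝ) →ᵇ B) := by
  obtain ⟨hu, hy⟩ := exists_inverse hx hb
  have := h.inverse (fun _ hu _ hv => hN.add_mem hu hv) (fun _ hu _ hv => hN.mul_mem hu hv)
    (fun _ hu => neg_mem_latClass hu) hx fun u hu' he => by
      obtain rfl : u = x := DFunLike.coe_injective he
      exact ⟨Ring.inverse u, hN.inverse_mem hu' hu, funext hy⟩
  rwa [← funext hy] at this

end SpectralDecay

end

theorem theorem10p1 (d : ℕ) (B : Type*) [NormedRing B] [NormedAlgebra ℂ B] [CompleteSpace B]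
    (x : (Fin d → ℝ) →ᵇ B) (hx : ∀ s, IsUnit (x s))
    (hb : ∃ C : ℝ, ∀ s, ‖Ring.inverse (x s)‖ ≤ C) :
    ∃ y : (Fin d → ℝ) →ᵇ B, (∀ s, y s = Ring.inverse (x s)) ∧
      (x ∈ SpectralDecay.wienerClass → y ∈ SpectralDecay.wienerClass) ∧
      (x ∈ SpectralDecay.expClass → y ∈ SpectralDecay.expClass) ∧
      (x ∈ SpectralDecay.expClassPos → y ∈ SpectralDecay.expClassPos) ∧
      (x ∈ SpectralDecay.expClassNeg → y ∈ SpectralDecay.expClassNeg) ∧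
      (x ∈ SpectralDecay.beurlingClass → y ∈ SpectralDecay.beurlingClass) ∧
      (∀ m : ℕ, x ∈ SpectralDecay.sobolevWienerClass m →
        y ∈ SpectralDecay.sobolevWienerClass m) ∧
      (∀ m : ℕ, x ∈ SpectralDecay.sobolevBeurlingClass m →
        y ∈ SpectralDecay.sobolevBeurlingClass m) := by
  obtain ⟨hu, hy⟩ := SpectralDecay.exists_inverse hx hb
  have hW := SpectralDecay.isWeight_tsum (d := d)
  have hB := SpectralDecay.isWeight_beurling (d := d)
  refine ⟨Ring.inverse x, hy, fun h => ?_, SpectralDecay.inverse_mem_expClass hu,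
    SpectralDecay.inverse_mem_expClassPos hu, SpectralDecay.inverse_mem_expClassNeg hu,
    fun h => ?_, fun m h => ?_, fun m h => ?_⟩
  · rw [SpectralDecay.wienerClass_eq] at *
    exact hW.inverse_mem h hu
  · rw [SpectralDecay.beurlingClass_eq] at *
    exact hB.inverse_mem h hu
  · have h1 := (SpectralDecay.sobolevOver_iff_of_norm SpectralDecay.wienerNorm m x).2 h
    change SpectralDecay.SobolevOver SpectralDecay.wienerClass m x at h1
    rw [SpectralDecay.wienerClass_eq] at h1
    have h2 := hW.sobolevOver_inverse hx hb h1
    rw [← SpectralDecay.wienerClass_eq] at h2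
    exact (SpectralDecay.sobolevOver_iff_of_norm SpectralDecay.wienerNorm m _).1 h2
  · have h1 := (SpectralDecay.sobolevOver_iff_of_norm SpectralDecay.beurlingNorm m x).2 h
    change SpectralDecay.SobolevOver SpectralDecay.beurlingClass m x at h1
    rw [SpectralDecay.beurlingClass_eq] at h1
    have h2 := hB.sobolevOver_inverse hx hb h1
    rw [← SpectralDecay.beurlingClass_eq] at h2
    exact (SpectralDecay.sobolevOver_iff_of_norm SpectralDecay.beurlingNorm m _).1 h2
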